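/- Let $k$ be a commutative artinian ring, let $E$ be an injective envelope of the $k$-module $k/\operatorname{rad} k$, let $R$ be an artin $k$-algebra (a $k$-algebra that is finitely generated as a $k$-module), and write $D=\operatorname{Hom}_k(-,E)$. Modules are right modules unless a left action is indicated, and $\operatorname{mod}R$ denotes the category of finitely generated right $R$-modules. **Cotorsion pairs.** A pair $(\mathcal B,\mathcal A)$ of full subcategories of $\operatorname{mod}R$ is a *cotorsion pair* if $\mathcal B=\{X\in\operatorname{mod}R:\operatorname{Ext}^1_R(X,A)=0\ \forall A\in\mathcal A\}$ and $\mathcal A=\{Y\in\operatorname{mod}R:\operatorname{Ext}^1_R(B,Y)=0\ \forall B\in\mathcal B\}$. It is *hereditary* if $\mathcal B$ is resolving, i.e. contains all finitely generated projective modules and is closed under extensions, kernels of epimorphisms and direct summands. It is *complete* if every $X\in\operatorname{mod}R$ admits exact sequences $0\to X\to A\to B\to0$ and $0\to A'\to B'\to X\to0$ with $A,A'\in\mathcal A$ and $B,B'\in\mathcal B$. **Repetitive category.** Let $\mathcal{RC}(R)$ be the category of finitely generated modules over the repetitive algebra $\widehat R=\bigoplus_{n\in\mathbb Z}R\oplus\bigoplus_{n\in\mathbb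 Z}DR$ of $R$, described as follows. Objects are families $X=\{X_i,\delta_i\}_{i\in\mathbb Z}$ with $X_i\in\operatorname{mod}R$, almost all $X_i=0$, and $R$-linear maps $\delta_i:X_i\to\operatorname{Hom}_R(DR,X_{i-1})$ such that the composite of $\delta_{i}$ followed by $\operatorname{Hom}_R(DR,\delta_{i-1})$ is zero for every $i$. Morphisms are families of $R$-linear maps $X_i\to Y_i$ compatible with the $\delta_i$. The *repetitive category* $\underline{\mathcal{RC}}(R)$ is its stable category: the same objects, with morphisms taken modulo those that factor through a projective object of $\mathcal{RC}(R)$. A module in $\operatorname{mod}R$ is viewed as an object of $\underline{\mathcal{RC}}(R)$ concentrated in degree $0$. **Good Wakamatsu-tilting modules.** Let $T\in\operatorname{mod}R$ and $S=\operatorname{End}(T_R)$, so that $T$ is an $S$-$R$-bimodule, $DT$ is an $R$-$S$-bimodule, and $S$ is again an artin $k$-algebra. Then $T$ is *Wakamatsu-tilting* if the right action of $R$ on $T$ identifies $R$ with $\operatorname{End}({}_ST)$ (endomorphisms of the left module ${}_ST$ acting on the right) and $\operatorname{Ext}^i_R(T,T)=0=\operatorname{Ext}^i_S(T,T)$ for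 all $i>0$. It is *good* if moreover there are complete hereditary cotorsion pairs $(\mathcal B,\mathcal A)$ in $\operatorname{mod}R$ and $(\mathcal G,\mathcal K)$ in $\operatorname{mod}S$ such that ${}_ST_R$ and ${}_RDT_S$ represent a cotorsion pair counter equivalence between them, i.e. the functors $$\operatorname{Hom}_R(T,-):\mathcal A\rightleftarrows\mathcal G:-\otimes_ST\qquad\text{and}\qquad\operatorname{Hom}_S(DT,-):\mathcal K\rightleftarrows\mathcal B:-\otimes_RDT$$ restrict as indicated and form equivalences of categories. **Theorem.** Let $T$ be a good Wakamatsu-tilting $R$-module with $S=\operatorname{End}(T_R)$, and let $(\mathcal B,\mathcal A)$ and $(\mathcal G,\mathcal K)$ be any complete hereditary cotorsion pairs as in the definition. Then $R$ and $S$ are repetitive equivalent: there is an equivalence of categories $\mathbb F:\underline{\mathcal{RC}}(R)\to\underline{\mathcal{RC}}(S)$, with quasi-inverse $\mathbb G$. It can be chosen to restrict to the given equivalence between $\mathcal A$ and $\mathcal G$: there are natural isomorphisms $\mathbb F|_{\mathcal A}\simeq\operatorname{Hom}_R(T,-)$ of functors $\mathcal A\to\underline{\mathcal{RC}}(S)$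 and $\mathbb G|_{\mathcal G}\simeq-\otimes_ST$ of functors $\mathcal G\to\underline{\mathcal{RC}}(R)$. -/

import Mathlib

universe u

open CategoryTheory MulOpposite
open scoped TensorProduct

noncomputable section

namespace Repetitive

/-! ## Artin algebras: the duality `D`

Right modules over a ring `A` are modules over `Aᵐᵒᵖ`; an `S`-`R`-bimodule is an abelian group with
commuting structures of `S`-module and of `Rᵐᵒᵖ`-module. -/

/-- `E` is an injective envelope of the `k`-module `M`: it is injective and contains a copy of `M` as
an essential submodule. -/
def IsInjectiveEnvelope (k : Type u) [CommRing k] (M E : Type u) [AddCommGroup M] [Module k M]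
    [AddCommGroup E] [Module k E] : Prop :=
  Module.Injective k E ∧ ∃ j : M →ₗ[k] E, Function.Injective j ∧
    ∀ N : Submodule k E, N ⊓ LinearMap.range j = ⊥ → N = ⊥

/-- The dual `D M = Hom_k(M, E)`. (A type synonym, so that rings acting on `M` may act on `D M` by
precomposition.) -/
def KDual (k E M : Type u) [CommRing k] [AddCommGroup E] [Module k E] [AddCommGroup M]
    [Module k M] : Type u :=
  M →ₗ[k] E

namespace KDual

variable {k E M : Type u} [CommRing k] [AddCommGroup E] [Module k E] [AddCommGroup M] [Module k M]

instance : AddCommGroup (KDual k E M) := inferInstanceAs (AddCommGroup (M →ₗ[k] E))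

instance : FunLike (KDual k E M) M E := inferInstanceAs (FunLike (M →ₗ[k] E) M E)

instance : AddMonoidHomClass (KDual k E M) M E :=
  inferInstanceAs (AddMonoidHomClass (M →ₗ[k] E) M E)

@[ext]
theorem ext {f g : KDual k E M} (h : ∀ m, f m = g m) : f = g := DFunLike.ext f g h

@[simp]
theorem add_apply (f g : KDual k E M) (m : M) : (f + g) m = f m + g m := rfl

@[simp]
theorem zero_apply (m : M) : (0 : KDual k E M) m = 0 := rfl

/-- If `M` is a left `A`-module, then `D M` is a right `A`-module, by `(f a)(m) = f (a m)`. -/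
instance rightModule {A : Type u} [Ring A] [Module A M] [SMulCommClass A k M] :
    Module Aᵐᵒᵖ (KDual k E M) where
  smul a f := LinearMap.comp (show M →ₗ[k] E from f) (Module.toModuleEnd k M (unop a))
  one_smul f := by
    ext m
    change f ((1 : A) • m) = f m
    rw [one_smul]
  mul_smul a b f := by
    ext m
    change f ((unop b * unop a) • m) = f (unop b • unop a • m)
    rw [mul_smul]
  smul_zero a := by
    ext m
    rfl
  smul_add a f g := by
    ext m
    rfl
  add_smul a b f := by
    ext m
    change f ((unop a + unop b) • m) = f (unop a • m) + f (unop b • m)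
    rw [add_smul, map_add]
  zero_smul f := by
    ext m
    change f ((0 : A) • m) = 0
    rw [zero_smul, map_zero]

/-- If `M` is a right `A`-module, then `D M` is a left `A`-module, by `(a f)(m) = f (m a)`. -/
instance leftModule {A : Type u} [Ring A] [Module Aᵐᵒᵖ M] [SMulCommClass Aᵐᵒᵖ k M] :
    Module A (KDual k E M) where
  smul a f := LinearMap.comp (show M →ₗ[k] E from f) (Module.toModuleEnd k M (op a))
  one_smul f := by
    ext m
    change f ((1 : Aᵐᵒᵖ) • m) = f m
    rw [one_smul]
  mul_smul a b f := by
    ext m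
    change f ((op b * op a) • m) = f (op b • op a • m)
    rw [mul_smul]
  smul_zero a := by
    ext m
    rfl
  smul_add a f g := by
    ext m
    rfl
  add_smul a b f := by
    ext m
    change f ((op a + op b) • m) = f (op a • m) + f (op b • m)
    rw [add_smul, map_add]
  zero_smul f := by
    ext m
    change f ((0 : Aᵐᵒᵖ) • m) = 0
    rw [zero_smul, map_zero]

@[simp]
theorem op_smul_apply {A : Type u} [Ring A] [Module A M] [SMulCommClass A k M] (a : A)
    (f : KDual k E M) (m : M) : (op a • f) m = f (a • m) := rfl

@[simp]
theorem smul_apply {A : Type u} [Ring A] [Module Aᵐᵒᵖ M] [SMulCommClass Aᵐᵒᵖ k M] (a : A)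
    (f : KDual k E M) (m : M) : (a • f) m = f (op a • m) := rfl

/-- The dual of an `S`-`R`-bimodule is an `R`-`S`-bimodule. -/
instance bimodule {S R : Type u} [Ring S] [Ring R] [Module S M] [Module Rᵐᵒᵖ M]
    [SMulCommClass S k M] [SMulCommClass Rᵐᵒᵖ k M] [SMulCommClass S Rᵐᵒᵖ M] :
    SMulCommClass R Sᵐᵒᵖ (KDual k E M) where
  smul_comm r s f := by
    ext m
    change f (unop s • op r • m) = f (op r • unop s • m)
    rw [smul_comm]

end KDual

/-! ## The functors `Hom_R(V, -)` and `- ⊗_S V` of an `S`-`R`-bimodule `V` -/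

section Bimodule

variable (S R : Type u) [Ring S] [Ring R]

/-- `Hom_R(V, M)` for right `R`-modules `V` and `M`. (A type synonym, so that a ring acting on the
left of `V` may act by precomposition.) -/
def HomRight (V M : Type u) [AddCommGroup V] [Module Rᵐᵒᵖ V] [AddCommGroup M] [Module Rᵐᵒᵖ M] :
    Type u :=
  V →ₗ[Rᵐᵒᵖ] M

namespace HomRight

variable {S R} {V M : Type u} [AddCommGroup V] [Module Rᵐᵒᵖ V] [AddCommGroup M] [Module Rᵐᵒᵖ M]

instance : AddCommGroup (HomRight R V M) := inferInstanceAs (AddCommGroup (V →ₗ[Rᵐᵒᵖ] M))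

instance : FunLike (HomRight R V M) V M := inferInstanceAs (FunLike (V →ₗ[Rᵐᵒᵖ] M) V M)

instance : AddMonoidHomClass (HomRight R V M) V M :=
  inferInstanceAs (AddMonoidHomClass (V →ₗ[Rᵐᵒᵖ] M) V M)

@[ext]
theorem ext {f g : HomRight R V M} (h : ∀ v, f v = g v) : f = g := DFunLike.ext f g h

@[simp]
theorem add_apply (f g : HomRight R V M) (v : V) : (f + g) v = f v + g v := rfl

@[simp]
theorem zero_apply (v : V) : (0 : HomRight R V M) v = 0 := rfl

/-- The right `S`-module structure `(f s)(v) = f (s v)` on `Hom_R(V, M)`. -/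
instance rightModule [Module S V] [SMulCommClass S Rᵐᵒᵖ V] : Module Sᵐᵒᵖ (HomRight R V M) where
  smul s f := LinearMap.comp (show V →ₗ[Rᵐᵒᵖ] M from f) (Module.toModuleEnd Rᵐᵒᵖ V (unop s))
  one_smul f := by
    ext v
    change f ((1 : S) • v) = f v
    rw [one_smul]
  mul_smul s t f := by
    ext v
    change f ((unop t * unop s) • v) = f (unop t • unop s • v)
    rw [mul_smul]
  smul_zero s := by
    ext v
    rfl
  smul_add s f g := by
    ext v
    rfl
  add_smul s t f := by
    ext v
    change f ((unop s + unop t) • v) = f (unop s • v) + f (unop t • v)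
    rw [add_smul, map_add]
  zero_smul f := by
    ext v
    change f ((0 : S) • v) = 0
    rw [zero_smul, map_zero]

@[simp]
theorem op_smul_apply [Module S V] [SMulCommClass S Rᵐᵒᵖ V] (s : S) (f : HomRight R V M) (v : V) :
    (op s • f) v = f (s • v) := rfl

end HomRight

/-- The subgroup of `X ⊗_ℤ V` generated by all `x s ⊗ v - x ⊗ s v`. -/
def balancing (X V : Type u) [AddCommGroup X] [Module Sᵐᵒᵖ X] [AddCommGroup V] [Module S V] :
    AddSubgroup (X ⊗[ℤ] V) :=
  AddSubgroup.closure {z | ∃ (x : X) (s : S) (v : V), z = (op s • x) ⊗ₜ[ℤ] v - x ⊗ₜ[ℤ] (s • v)}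

/-- The tensor product `X ⊗_S V` of a right `S`-module `X` and a left `S`-module `V` over a
not necessarily commutative ring `S`. -/
def TensorOver (X V : Type u) [AddCommGroup X] [Module Sᵐᵒᵖ X] [AddCommGroup V] [Module S V] :
    Type u :=
  (X ⊗[ℤ] V) ⧸ balancing S X V

namespace TensorOver

variable {S R} {X Y V : Type u} [AddCommGroup X] [Module Sᵐᵒᵖ X] [AddCommGroup Y] [Module Sᵐᵒᵖ Y]
  [AddCommGroup V] [Module S V]

instance : AddCommGroup (TensorOver S X V) :=
  inferInstanceAs (AddCommGroup ((X ⊗[ℤ] V) ⧸ balancing S X V))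

/-- The class `x ⊗ v` in `X ⊗_S V`. -/
def tmul (x : X) (v : V) : TensorOver S X V :=
  QuotientAddGroup.mk' (balancing S X V) (x ⊗ₜ[ℤ] v)

theorem smul_tmul (x : X) (s : S) (v : V) :
    (tmul (op s • x) v : TensorOver S X V) = tmul x (s • v) :=
  (QuotientAddGroup.eq_iff_sub_mem (N := balancing S X V)).2
    (AddSubgroup.subset_closure ⟨x, s, v, rfl⟩)

theorem tmul_add (x : X) (v w : V) :
    (tmul x (v + w) : TensorOver S X V) = tmul x v + tmul x w := by
  rw [tmul, TensorProduct.tmul_add, map_add]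
  rfl

theorem tmul_zero (x : X) : (tmul x (0 : V) : TensorOver S X V) = 0 := by
  rw [tmul, TensorProduct.tmul_zero, map_zero]
  rfl

/-- Additive maps out of `X ⊗_S V` are determined by their values at the elements `x ⊗ v`. -/
theorem addHom_ext {N : Type u} [AddCommGroup N] {f g : TensorOver S X V →+ N}
    (h : ∀ x v, f (tmul x v) = g (tmul x v)) : f = g := by
  refine AddMonoidHom.ext fun z => ?_
  obtain ⟨w, rfl⟩ := QuotientAddGroup.mk'_surjective (balancing S X V) z
  induction w with
  | zero => exact (map_zero f).trans (map_zero g).symm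
  | tmul x v => exact h x v
  | add a b ha hb => exact (map_add f _ _).trans ((congrArg₂ _ ha hb).trans (map_add g _ _).symm)

/-- The additive map `f ⊗ g : X ⊗_S V → Y ⊗_S V`. -/
def map (f : X →ₗ[Sᵐᵒᵖ] Y) (g : V →ₗ[S] V) : TensorOver S X V →+ TensorOver S Y V :=
  QuotientAddGroup.map (balancing S X V) (balancing S Y V)
    (TensorProduct.map f.toAddMonoidHom.toIntLinearMap
      g.toAddMonoidHom.toIntLinearMap).toAddMonoidHom (by
      refine (AddSubgroup.closure_le _).2 ?_
      rintro _ ⟨x, s, v, rfl⟩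
      refine AddSubgroup.subset_closure ⟨f x, s, g v, ?_⟩
      rw [map_sub, ← map_smul f, ← map_smul g]
      rfl)

@[simp]
theorem map_tmul (f : X →ₗ[Sᵐᵒᵖ] Y) (g : V →ₗ[S] V) (x : X) (v : V) :
    map f g (tmul x v : TensorOver S X V) = tmul (f x) (g v) := rfl

section

variable [Module Rᵐᵒᵖ V] [SMulCommClass Rᵐᵒᵖ S V]

/-- The right `R`-module structure `(x ⊗ v) r = x ⊗ v r` on `X ⊗_S V`. -/
instance rightModule : Module Rᵐᵒᵖ (TensorOver S X V) where
  smul r z := map LinearMap.id (Module.toModuleEnd S V r) z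
  one_smul z := by
    refine DFunLike.congr_fun (f := map LinearMap.id (Module.toModuleEnd S V (1 : Rᵐᵒᵖ)))
      (g := AddMonoidHom.id (TensorOver S X V)) (addHom_ext fun x v => ?_) z
    change tmul x ((1 : Rᵐᵒᵖ) • v) = tmul x v
    rw [one_smul]
  mul_smul r t z := by
    refine DFunLike.congr_fun (f := map LinearMap.id (Module.toModuleEnd S V (r * t)))
      (g := (map LinearMap.id (Module.toModuleEnd S V r)).comp
        (map (X := X) LinearMap.id (Module.toModuleEnd S V t))) (addHom_ext fun x v => ?_) z
    change tmul x ((r * t) • v) = tmul x (r • t • v)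
    rw [mul_smul]
  smul_zero r := map_zero _
  smul_add r := map_add _
  add_smul r t z := by
    refine DFunLike.congr_fun (f := map LinearMap.id (Module.toModuleEnd S V (r + t)))
      (g := map LinearMap.id (Module.toModuleEnd S V r) +
        map (X := X) LinearMap.id (Module.toModuleEnd S V t)) (addHom_ext fun x v => ?_) z
    change tmul x ((r + t) • v) = tmul x (r • v) + tmul x (t • v)
    rw [add_smul, tmul_add]
  zero_smul z := by
    refine DFunLike.congr_fun (f := map LinearMap.id (Module.toModuleEnd S V (0 : Rᵐᵒᵖ)))
      (g := (0 : TensorOver S X V →+ TensorOver S X V)) (addHom_ext fun x v => ?_) z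
    change tmul x ((0 : Rᵐᵒᵖ) • v) = 0
    rw [zero_smul, tmul_zero]

theorem smul_tmul_right (r : Rᵐᵒᵖ) (x : X) (v : V) :
    r • (tmul x v : TensorOver S X V) = tmul x (r • v) := rfl

/-- The right `R`-linear map `f ⊗ V : X ⊗_S V → Y ⊗_S V`. -/
def mapLinear (f : X →ₗ[Sᵐᵒᵖ] Y) : TensorOver S X V →ₗ[Rᵐᵒᵖ] TensorOver S Y V where
  toFun := map f LinearMap.id
  map_add' := map_add _
  map_smul' r z := by
    refine DFunLike.congr_fun
      (f := (map f LinearMap.id).comp (map LinearMap.id (Module.toModuleEnd S V r)))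
      (g := (map LinearMap.id (Module.toModuleEnd S V r)).comp (map f LinearMap.id))
      (addHom_ext fun x v => ?_) z
    rfl

end

end TensorOver

variable (V : Type u) [AddCommGroup V] [Module S V] [Module Rᵐᵒᵖ V] [SMulCommClass S Rᵐᵒᵖ V]

/-- The functor `Hom_R(V, -)` from right `R`-modules to right `S`-modules. -/
def homFunctor : ModuleCat.{u} Rᵐᵒᵖ ⥤ ModuleCat.{u} Sᵐᵒᵖ where
  obj M := ModuleCat.of Sᵐᵒᵖ (HomRight R V M)
  map {M N} f := ModuleCat.ofHom
    { toFun := fun g => (LinearMap.comp f.hom (show V →ₗ[Rᵐᵒᵖ] M from g) : V →ₗ[Rᵐᵒᵖ] N)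
      map_add' := fun g h => by
        refine HomRight.ext fun v => ?_
        exact map_add f.hom (g v) (h v)
      map_smul' := fun _ _ => rfl }
  map_id _ := rfl
  map_comp _ _ := rfl

/-- The functor `- ⊗_S V` from right `S`-modules to right `R`-modules. -/
def tensorFunctor : ModuleCat.{u} Sᵐᵒᵖ ⥤ ModuleCat.{u} Rᵐᵒᵖ where
  obj X := haveI := SMulCommClass.symm S Rᵐᵒᵖ V; ModuleCat.of Rᵐᵒᵖ (TensorOver S X V)
  map f := haveI := SMulCommClass.symm S Rᵐᵒᵖ V; ModuleCat.ofHom (TensorOver.mapLinear f.hom)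
  map_id X := by
    have := SMulCommClass.symm S Rᵐᵒᵖ V
    ext z
    exact DFunLike.congr_fun
      (f := TensorOver.map (LinearMap.id : X →ₗ[Sᵐᵒᵖ] X) (LinearMap.id : V →ₗ[S] V))
      (g := AddMonoidHom.id _) (TensorOver.addHom_ext fun x v => rfl) z
  map_comp {X Y Z} f g := by
    have := SMulCommClass.symm S Rᵐᵒᵖ V
    ext z
    exact DFunLike.congr_fun
      (f := TensorOver.map (g.hom ∘ₗ f.hom) (LinearMap.id : V →ₗ[S] V))
      (g := (TensorOver.map g.hom LinearMap.id).comp (TensorOver.map f.hom LinearMap.id))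
      (TensorOver.addHom_ext fun x v => rfl) z

/-! ## Representing an equivalence between subcategories -/

/-- `Hom_R(V, -) : A ⇄ G : - ⊗_S V` is an equivalence between the full subcategories `A` of right
`R`-modules and `G` of right `S`-modules: both functors restrict, and the restrictions are the
two functors of an equivalence of categories. -/
structure RepresentsEquivalence (A : ObjectProperty (ModuleCat.{u} Rᵐᵒᵖ))
    (G : ObjectProperty (ModuleCat.{u} Sᵐᵒᵖ)) : Prop where
  hom_mem : ∀ M, A M → G ((homFunctor S R V).obj M)
  tensor_mem : ∀ X, G X → A ((tensorFunctor S R V).obj X)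
  exists_equivalence : ∃ e : A.FullSubcategory ≌ G.FullSubcategory,
    Nonempty (e.functor ≅ G.lift (A.ι ⋙ homFunctor S R V) fun M => hom_mem M.obj M.property) ∧
    Nonempty (e.inverse ≅ A.lift (G.ι ⋙ tensorFunctor S R V) fun X => tensor_mem X.obj X.property)

namespace RepresentsEquivalence

variable {S R V} {A : ObjectProperty (ModuleCat.{u} Rᵐᵒᵖ)} {G : ObjectProperty (ModuleCat.{u} Sᵐᵒᵖ)}

/-- The restricted functor `Hom_R(V, -) : A ⥤ G`. -/
def restrictedHom (h : RepresentsEquivalence S R V A G) : A.FullSubcategory ⥤ G.FullSubcategory :=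
  G.lift (A.ι ⋙ homFunctor S R V) fun M => h.hom_mem M.obj M.property

/-- The restricted functor `- ⊗_S V : G ⥤ A`. -/
def restrictedTensor (h : RepresentsEquivalence S R V A G) :
    G.FullSubcategory ⥤ A.FullSubcategory :=
  A.lift (G.ι ⋙ tensorFunctor S R V) fun X => h.tensor_mem X.obj X.property

end RepresentsEquivalence

end Bimodule

/-! ## Cotorsion pairs in the category of finitely generated modules

These are used for `Λ = Rᵐᵒᵖ`, that is, for right modules over an artin algebra `R`. -/

section Cotorsion

variable {Λ : Type u} [Ring Λ]

/-- `Ext¹(X, Y) = 0`. -/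
def ExtOneVanishes (X Y : ModuleCat.{u} Λ) : Prop := Subsingleton (Abelian.Ext X Y 1)

/-- `(B, A)` is a cotorsion pair in the category of finitely generated modules. -/
structure IsCotorsionPair (B A : ObjectProperty (ModuleCat.{u} Λ)) : Prop where
  left_iff : ∀ X, B X ↔ Module.Finite Λ X ∧ ∀ Y, A Y → ExtOneVanishes X Y
  right_iff : ∀ Y, A Y ↔ Module.Finite Λ Y ∧ ∀ X, B X → ExtOneVanishes X Y

/-- A class of finitely generated modules is resolving if it contains the finitely generated
projective modules and is closed under extensions, kernels of epimorphisms and direct summands. -/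
structure IsResolving (B : ObjectProperty (ModuleCat.{u} Λ)) : Prop where
  projective_mem : ∀ P : ModuleCat.{u} Λ, Module.Finite Λ P → Module.Projective Λ P → B P
  extensions : ∀ s : ShortComplex (ModuleCat.{u} Λ), s.ShortExact → B s.X₁ → B s.X₃ → B s.X₂
  kernels : ∀ s : ShortComplex (ModuleCat.{u} Λ), s.ShortExact → B s.X₂ → B s.X₃ → B s.X₁
  summands : ∀ X Y : ModuleCat.{u} Λ, Retract X Y → B Y → B X

/-- A complete hereditary cotorsion pair in the category of finitely generated modules. -/
structure IsCompleteHereditaryCotorsionPair (B A : ObjectProperty (ModuleCat.{u} Λ)) : Prop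
    extends IsCotorsionPair B A where
  resolving : IsResolving B
  /-- an exact sequence `0 → X → Y → Z → 0` with `Y` in `A` and `Z` in `B` -/
  preenvelope : ∀ X : ModuleCat.{u} Λ, Module.Finite Λ X →
    ∃ (Y Z : ModuleCat.{u} Λ) (f : X ⟶ Y) (g : Y ⟶ Z) (w : f ≫ g = 0),
      (ShortComplex.mk f g w).ShortExact ∧ A Y ∧ B Z
  /-- an exact sequence `0 → Y → Z → X → 0` with `Y` in `A` and `Z` in `B` -/
  precover : ∀ X : ModuleCat.{u} Λ, Module.Finite Λ X →
    ∃ (Y Z : ModuleCat.{u} Λ) (f : Y ⟶ Z) (g : Z ⟶ X) (w : f ≫ g = 0),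
      (ShortComplex.mk f g w).ShortExact ∧ A Y ∧ B Z

theorem IsCotorsionPair.left_le {B A : ObjectProperty (ModuleCat.{u} Λ)}
    (h : IsCotorsionPair B A) : B ≤ ModuleCat.isFG Λ := fun X hX => ((h.left_iff X).1 hX).1

theorem IsCotorsionPair.right_le {B A : ObjectProperty (ModuleCat.{u} Λ)}
    (h : IsCotorsionPair B A) : A ≤ ModuleCat.isFG Λ := fun X hX => ((h.right_iff X).1 hX).1

end Cotorsion

/-! ## Good Wakamatsu-tilting modules -/

/-- A finitely generated right `R`-module `T`, with `S = End(T_R)` acting on the left, is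
Wakamatsu-tilting if `R` is the (opposite) endomorphism ring of the left `S`-module `T`, through its
action on `T`, and `Ext_R^i(T, T) = 0 = Ext_S^i(T, T)` for all `i > 0`. -/
structure IsWakamatsuTilting (R T : Type u) [Ring R] [AddCommGroup T] [Module Rᵐᵒᵖ T] : Prop where
  finite : Module.Finite Rᵐᵒᵖ T
  double_centralizer :
    Function.Bijective (Module.toModuleEnd (Module.End Rᵐᵒᵖ T) T : Rᵐᵒᵖ →+* _)
  ext_right : ∀ i : ℕ, 0 < i →
    Subsingleton (Abelian.Ext (ModuleCat.of Rᵐᵒᵖ T) (ModuleCat.of Rᵐᵒᵖ T) i)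
  ext_left : ∀ i : ℕ, 0 < i →
    Subsingleton (Abelian.Ext (ModuleCat.of (Module.End Rᵐᵒᵖ T) T)
      (ModuleCat.of (Module.End Rᵐᵒᵖ T) T) i)

/-! ## The repetitive category -/

section RepeComplex

variable (k R E : Type u) [CommRing k] [Ring R] [Algebra k R] [AddCommGroup E] [Module k E]

/-- The functor `Hom_R(DR, -)` on right `R`-modules. -/
abbrev homDual : ModuleCat.{u} Rᵐᵒᵖ ⥤ ModuleCat.{u} Rᵐᵒᵖ := homFunctor R R (KDual k E R)

/-- A finitely generated (right) module over the repetitive algebra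
`⨁_{n ∈ ℤ} R ⊕ ⨁_{n ∈ ℤ} DR` of `R`, in the form of a repe-complex: finitely generated right
`R`-modules `X i`, almost all zero, and right `R`-linear maps `δ i : X i → Hom_R(DR, X (i - 1))`
such that `δ i` followed by `Hom_R(DR, δ (i - 1))` vanishes. -/
structure RepeComplex where
  X : ℤ → ModuleCat.{u} Rᵐᵒᵖ
  finite : ∀ i, Module.Finite Rᵐᵒᵖ (X i)
  bounded : {i | Nontrivial (X i)}.Finite
  δ : ∀ i, X i ⟶ (homDual k R E).obj (X (i - 1))
  δ_comp_δ : ∀ i, δ i ≫ (homDual k R E).map (δ (i - 1)) = 0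

namespace RepeComplex

variable {k R E}

/-- A morphism of repe-complexes. -/
@[ext]
structure Hom (X Y : RepeComplex k R E) where
  f : ∀ i, X.X i ⟶ Y.X i
  comm : ∀ i, f i ≫ Y.δ i = X.δ i ≫ (homDual k R E).map (f (i - 1))

instance : Category (RepeComplex k R E) where
  Hom := Hom
  id X :=
    { f := fun i => 𝟙 (X.X i)
      comm := fun i => by simp }
  comp φ ψ :=
    { f := fun i => φ.f i ≫ ψ.f i
      comm := fun i => by
        rw [Category.assoc, ψ.comm, ← Category.assoc, φ.comm, Category.assoc, Functor.map_comp] }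

@[ext]
theorem hom_ext {X Y : RepeComplex k R E} {φ ψ : X ⟶ Y} (h : ∀ i, φ.f i = ψ.f i) : φ = ψ :=
  Hom.ext (funext h)

@[simp]
theorem id_f (X : RepeComplex k R E) (i : ℤ) : Hom.f (𝟙 X) i = 𝟙 (X.X i) := rfl

@[simp]
theorem comp_f {X Y Z : RepeComplex k R E} (φ : X ⟶ Y) (ψ : Y ⟶ Z) (i : ℤ) :
    (φ ≫ ψ).f i = φ.f i ≫ ψ.f i := rfl

end RepeComplex

/-- Two morphisms of repe-complexes are identified in the stable category if their difference
factors through a projective object. -/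
def stableRel : HomRel (RepeComplex k R E) := fun X Y φ ψ =>
  ∃ (P : RepeComplex k R E) (_ : Projective P) (a : X ⟶ P) (b : P ⟶ Y),
    ∀ i, φ.f i - ψ.f i = a.f i ≫ b.f i

/-- The repetitive category of `R`: the stable category of the category of finitely generated
modules over the repetitive algebra of `R`. -/
abbrev RepetitiveCategory := CategoryTheory.Quotient (stableRel k R E)

variable {R} in
/-- The graded right `R`-module that is `M` in degree `0` and zero elsewhere. -/
abbrev singleObj (M : ModuleCat.{u} Rᵐᵒᵖ) (i : ℤ) : ModuleCat.{u} Rᵐᵒᵖ :=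
  (GradedObject.single₀ (C := ModuleCat.{u} Rᵐᵒᵖ) ℤ).obj M i

variable {R} in
theorem subsingleton_single (M : ModuleCat.{u} Rᵐᵒᵖ) (i : ℤ) (h : i ≠ 0) :
    Subsingleton (singleObj M i) :=
  ModuleCat.subsingleton_of_isZero ((Limits.isZero_zero _).of_iso
    ((GradedObject.isInitialSingleObjApply 0 M i h).uniqueUpToIso
      (Limits.isZero_zero _).isInitial))

variable {R} in
theorem finite_single (M : FGModuleCat.{u} Rᵐᵒᵖ) (i : ℤ) :
    Module.Finite Rᵐᵒᵖ (singleObj M.obj i) := by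
  by_cases h : i = 0
  · have : Module.Finite Rᵐᵒᵖ M.obj := M.property
    exact Module.Finite.equiv (GradedObject.singleObjApplyIsoOfEq 0 M.obj i h).symm.toLinearEquiv
  · have := subsingleton_single M.obj i h
    infer_instance

variable {R} in
theorem bounded_single (M : ModuleCat.{u} Rᵐᵒᵖ) :
    {i : ℤ | Nontrivial (singleObj M i)}.Finite := by
  refine (Set.finite_singleton (0 : ℤ)).subset fun i hi => ?_
  by_contra h
  exact not_nontrivial_iff_subsingleton.2 (subsingleton_single M i h) hi

/-- The finitely generated module `M` as a repe-complex concentrated in degree `0`. -/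
def singleFunctor : FGModuleCat.{u} Rᵐᵒᵖ ⥤ RepeComplex k R E where
  obj M :=
    { X := (GradedObject.single₀ ℤ).obj M.obj
      finite := finite_single M
      bounded := bounded_single M.obj
      δ := fun _ => 0
      δ_comp_δ := fun _ => Limits.zero_comp }
  map φ :=
    { f := (GradedObject.single₀ ℤ).map φ.hom
      comm := fun _ => by rw [Limits.comp_zero, Limits.zero_comp] }
  map_id M := by
    refine RepeComplex.hom_ext fun i => ?_
    exact congrFun ((GradedObject.single₀ ℤ).map_id M.obj) i
  map_comp φ ψ := by
    refine RepeComplex.hom_ext fun i => ?_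
    exact congrFun ((GradedObject.single₀ ℤ).map_comp φ.hom ψ.hom) i

variable {R} in
/-- A full subcategory `C` of `mod R`, mapped to the repetitive category of `R` by viewing modules
as repe-complexes concentrated in degree `0`. -/
def toRepetitive (C : ObjectProperty (ModuleCat.{u} Rᵐᵒᵖ)) (hC : C ≤ ModuleCat.isFG Rᵐᵒᵖ) :
    C.FullSubcategory ⥤ RepetitiveCategory k R E :=
  ObjectProperty.ιOfLE hC ⋙ singleFunctor k R E ⋙ CategoryTheory.Quotient.functor (stableRel k R E)

end RepeComplex

end Repetitive

end

open Repetitive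

noncomputable section

set_option linter.unusedSectionVars false

/-! Write `L = - ⊗_S T`, `H = Hom_R(T, -)`, `L' = - ⊗_R DT`, `H' = Hom_S(DT, -)`, so that `L ⊣ H`
and `L' ⊣ H'`. Since `T` is faithfully balanced and `D` is a duality, `Hom_R(DR, -) ≅ H' H` and
`Hom_S(DS, -) ≅ H H'` on finitely generated modules (`isIso_nakayamaRight`, `isIso_nakayamaLeft`).
Pass to graded modules and put the degree shift into the second adjunction: a repe-complex over `R`
becomes an object `X` with a square-zero map `X → H' H X`, and one over `S` an object `Y` with a
square-zero map `Y → H H' Y`. The rest of the argument uses only the formal properties collected in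
`CounterSystem`. Among these are embeddings into `L L' P` and `L' L Q` with `P`, `Q` projective,
which exist because `DR ≅ L L' R` and `DS ≅ L' L S`; they yield the exactness of `L` and `L'` on the
short exact sequences that occur.

Given `X`, choose a special preenvelope `0 → X → A → B → 0`, and let `Φ` be the pushout of `L' A ←
L' X → H X → H A`, where the map `L' X → H X` is the transpose of the structure map. Given `Y` and a
map `G → Y` from an object of the class `G`, let `Ψ` be the pullback of `H' G → H' Y ← L G`. A link
is a pair of mates `A → L G`, `H A → G` that induces both a morphism `φ : Φ → Y` and a morphism `ψ :
X → Ψ`. Three facts carry the theorem. If the cover `G → Y` is good, then `φ` is stably trivial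
exactly when `ψ` is (`Link.stablyZero_phi`, `Link.stablyZero_psi`). Every `X` has a good cover of
its `Φ` and a link with `φ = 1` and `ψ` stably invertible (`Enveloped.exists_retraction`). Every `Y`
has a cover and a preenvelope of the corresponding `Ψ`, with a link whose `φ` is stably invertible
(`Embedded.exists_section`).

Now take the category of objects `X` with a chosen preenvelope. Forgetting the preenvelope and
applying `Φ` give two functors from it to the two stable categories. Both are full and essentially
surjective, and they identify the same morphisms, so their targets are equivalent
(`exists_equivalence_of_map_eq_iff`); preenvelopes need not be chosen functorially. An object of `A`
with zero structure map has its identity as preenvelope, and then `Φ` is `H A` (`zeroIso`). This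
gives the restriction to `A`, and the restriction of the inverse to `G` follows formally. -/

namespace Repetitive

/-! ## Transposition along an adjunction -/

section Transpose

universe v₁ v₂ u₁ u₂

variable {C : Type u₁} [Category.{v₁} C] {D : Type u₂} [Category.{v₂} D]
  {L : D ⥤ C} {H : C ⥤ D} (adj : L ⊣ H)

/-- The right transpose of a map `L X ⟶ Y`. -/
def tr {X : D} {Y : C} (f : L.obj X ⟶ Y) : X ⟶ H.obj Y := adj.homEquiv X Y f

/-- The left transpose of a map `X ⟶ H Y`. -/
def trs {X : D} {Y : C} (f : X ⟶ H.obj Y) : L.obj X ⟶ Y := (adj.homEquiv X Y).symm f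

/-- The unit of the adjunction. -/
def un (X : D) : X ⟶ H.obj (L.obj X) := adj.unit.app X

/-- The counit of the adjunction. -/
def cu (Y : C) : L.obj (H.obj Y) ⟶ Y := adj.counit.app Y

@[simp]
theorem tr_trs {X : D} {Y : C} (f : X ⟶ H.obj Y) : tr adj (trs adj f) = f :=
  Equiv.apply_symm_apply _ _

@[simp]
theorem trs_tr {X : D} {Y : C} (f : L.obj X ⟶ Y) : trs adj (tr adj f) = f :=
  Equiv.symm_apply_apply _ _

theorem tr_injective {X : D} {Y : C} {f g : L.obj X ⟶ Y} (h : tr adj f = tr adj g) : f = g :=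
  (adj.homEquiv X Y).injective h

theorem trs_injective {X : D} {Y : C} {f g : X ⟶ H.obj Y} (h : trs adj f = trs adj g) : f = g :=
  (adj.homEquiv X Y).symm.injective h

theorem tr_comp {X : D} {Y Z : C} (f : L.obj X ⟶ Y) (g : Y ⟶ Z) :
    tr adj (f ≫ g) = tr adj f ≫ H.map g := adj.homEquiv_naturality_right f g

theorem tr_map_comp {X X' : D} {Y : C} (f : X ⟶ X') (g : L.obj X' ⟶ Y) :
    tr adj (L.map f ≫ g) = f ≫ tr adj g := adj.homEquiv_naturality_left f g

theorem trs_comp {X X' : D} {Y : C} (f : X ⟶ X') (g : X' ⟶ H.obj Y) :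
    trs adj (f ≫ g) = L.map f ≫ trs adj g := adj.homEquiv_naturality_left_symm f g

theorem trs_comp_map {X : D} {Y Y' : C} (f : X ⟶ H.obj Y) (g : Y ⟶ Y') :
    trs adj (f ≫ H.map g) = trs adj f ≫ g := adj.homEquiv_naturality_right_symm f g

theorem tr_id (X : D) : tr adj (𝟙 (L.obj X)) = un adj X := adj.homEquiv_id X

theorem trs_id (Y : C) : trs adj (𝟙 (H.obj Y)) = cu adj Y := adj.homEquiv_symm_id Y

theorem un_map {X : D} {Y : C} (f : L.obj X ⟶ Y) : un adj X ≫ H.map f = tr adj f := by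
  rw [← tr_id, ← tr_comp, Category.id_comp]

theorem map_cu {X : D} {Y : C} (f : X ⟶ H.obj Y) : L.map f ≫ cu adj Y = trs adj f := by
  rw [← trs_id, ← trs_comp, Category.comp_id]

theorem tr_map {X X' : D} (f : X ⟶ X') : tr adj (L.map f) = f ≫ un adj X' := by
  rw [← tr_id, ← tr_map_comp, Category.comp_id]

theorem trs_map {Y Y' : C} (f : Y ⟶ Y') : trs adj (H.map f) = cu adj Y ≫ f := by
  rw [← trs_id, ← trs_comp_map, Category.id_comp]

theorem un_naturality {X X' : D} (f : X ⟶ X') :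
    un adj X ≫ H.map (L.map f) = f ≫ un adj X' := by
  rw [un_map, tr_map]

@[simp]
theorem un_cu (Y : C) : un adj (H.obj Y) ≫ H.map (cu adj Y) = 𝟙 _ :=
  adj.right_triangle_components Y

@[simp]
theorem map_un_cu (X : D) : L.map (un adj X) ≫ cu adj (L.obj X) = 𝟙 _ :=
  adj.left_triangle_components X

variable [Preadditive C] [Preadditive D]

@[simp]
theorem tr_zero [H.Additive] {X : D} {Y : C} : tr adj (0 : L.obj X ⟶ Y) = 0 := by
  rw [← un_map, H.map_zero, Limits.comp_zero]

@[simp]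
theorem trs_zero [L.Additive] {X : D} {Y : C} : trs adj (0 : X ⟶ H.obj Y) = 0 := by
  rw [← map_cu, L.map_zero, Limits.zero_comp]

end Transpose

/-! ## Objects with a square-zero map to an endofunctor

The endofunctor is given as a composite `H ⋙ H'` of two right adjoint functors. -/

section RepObj

universe v₁ v₂ u₁ u₂

open Limits

variable {C : Type u₁} [Category.{v₁} C] [Abelian C]
  {D : Type u₂} [Category.{v₂} D] [Abelian D]

/-- An object `X` of the class `F` with a map `δ : X ⟶ H' (H X)` such that
`δ ≫ H' (H δ) = 0`. -/
structure RepObj (H : C ⥤ D) (H' : D ⥤ C) (F : ObjectProperty C) where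
  X : C
  mem : F X
  δ : X ⟶ H'.obj (H.obj X)
  sq : δ ≫ H'.map (H.map δ) = 0

namespace RepObj

variable {L : D ⥤ C} {H : C ⥤ D} {L' : C ⥤ D} {H' : D ⥤ C} {F : ObjectProperty C}

/-- A morphism of objects with square-zero maps. -/
@[ext]
structure Hom (X Y : RepObj H H' F) where
  f : X.X ⟶ Y.X
  comm : f ≫ Y.δ = X.δ ≫ H'.map (H.map f)

instance : Category (RepObj H H' F) where
  Hom := Hom
  id X := { f := 𝟙 X.X, comm := by simp }
  comp φ ψ :=
    { f := φ.f ≫ ψ.f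
      comm := by rw [Category.assoc, ψ.comm, ← Category.assoc, φ.comm, Category.assoc, H.map_comp, H'.map_comp] }

@[ext]
theorem hom_ext {X Y : RepObj H H' F} {φ ψ : X ⟶ Y} (h : φ.f = ψ.f) : φ = ψ := Hom.ext h

@[simp]
theorem id_f (X : RepObj H H' F) : Hom.f (𝟙 X) = 𝟙 X.X := rfl

@[simp]
theorem comp_f {X Y Z : RepObj H H' F} (φ : X ⟶ Y) (ψ : Y ⟶ Z) : (φ ≫ ψ).f = φ.f ≫ ψ.f := rfl

theorem hom_comm {X Y : RepObj H H' F} (φ : X ⟶ Y) : φ.f ≫ Y.δ = X.δ ≫ H'.map (H.map φ.f) := φ.comm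

theorem epi_of_epi_f {X Y : RepObj H H' F} (φ : X ⟶ Y) [Epi φ.f] : Epi φ where
  left_cancellation g h e := by
    ext
    exact (cancel_epi φ.f).1 (congrArg Hom.f e)

variable [H.Additive] [H'.Additive]

instance {X Y : RepObj H H' F} : Add (X ⟶ Y) where
  add φ ψ :=
    { f := φ.f + ψ.f
      comm := by
        rw [Preadditive.add_comp, hom_comm, hom_comm, H.map_add, H'.map_add, Preadditive.comp_add] }

instance {X Y : RepObj H H' F} : Sub (X ⟶ Y) where
  sub φ ψ :=
    { f := φ.f - ψ.f
      comm := by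
        rw [Preadditive.sub_comp, hom_comm, hom_comm, H.map_sub, H'.map_sub, Preadditive.comp_sub] }

@[simp]
theorem add_f {X Y : RepObj H H' F} (φ ψ : X ⟶ Y) : (φ + ψ).f = φ.f + ψ.f := rfl

@[simp]
theorem sub_f {X Y : RepObj H H' F} (φ ψ : X ⟶ Y) : (φ - ψ).f = φ.f - ψ.f := rfl

/-- The cokernel of a morphism of objects with square-zero maps. -/
def coker (hF : ∀ {A B : C} (f : A ⟶ B) [Epi f], F A → F B) {X Y : RepObj H H' F} (φ : X ⟶ Y) :
    RepObj H H' F where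
  X := cokernel φ.f
  mem := hF (cokernel.π φ.f) Y.mem
  δ := cokernel.desc φ.f (Y.δ ≫ H'.map (H.map (cokernel.π φ.f))) (by
    rw [reassoc_of% hom_comm, ← H'.map_comp, ← H.map_comp, cokernel.condition, H.map_zero, H'.map_zero, comp_zero])
  sq := by
    rw [← cancel_epi (cokernel.π φ.f), cokernel.π_desc_assoc, Category.assoc, ← H'.map_comp, ← H.map_comp,
      cokernel.π_desc, H.map_comp, H'.map_comp, ← Category.assoc, Y.sq, zero_comp, comp_zero]

/-- The cokernel of the underlying map is again an object of the category, and an epimorphism cannot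
distinguish its projection from zero. Hence that cokernel vanishes. -/
theorem epi_f_of_epi (hF : ∀ {A B : C} (f : A ⟶ B) [Epi f], F A → F B) {X Y : RepObj H H' F}
    (φ : X ⟶ Y) [Epi φ] : Epi φ.f := by
  let p : Y ⟶ coker hF φ := { f := cokernel.π φ.f, comm := cokernel.π_desc _ _ _ }
  let z : Y ⟶ coker hF φ := { f := 0, comm := by rw [H.map_zero, H'.map_zero, zero_comp, comp_zero] }
  have h : p = z := by
    rw [← cancel_epi φ]
    ext
    exact (cokernel.condition φ.f).trans comp_zero.symm
  exact Preadditive.epi_of_cokernel_zero (congrArg Hom.f h)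

/-! ### Free objects with a square-zero map. -/

section Free

variable (adj : L ⊣ H) (adj' : L' ⊣ H')

/-- The object `P ⊞ L (L' P)` freely generated by `P`. -/
def free (P : C) (h : F (P ⊞ L.obj (L'.obj P))) : RepObj H H' F where
  X := P ⊞ L.obj (L'.obj P)
  mem := h
  δ := biprod.fst ≫ tr adj' (tr adj biprod.inr)
  sq := by
    rw [Category.assoc, ← tr_comp, ← tr_comp, biprod.inr_fst_assoc, zero_comp, tr_zero, tr_zero,
      comp_zero]

variable {adj adj'}
variable {P : C} {h : F (P ⊞ L.obj (L'.obj P))}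

/-- The inclusion of the generators in the free object. -/
def freeInl : P ⟶ (free adj adj' P h).X := biprod.inl (X := P) (Y := L.obj (L'.obj P))

/-- The inclusion of the second summand in the free object. -/
def freeInr : L.obj (L'.obj P) ⟶ (free adj adj' P h).X := biprod.inr (X := P) (Y := L.obj (L'.obj P))

/-- The first projection of the free object. -/
def freeFst : (free adj adj' P h).X ⟶ P := biprod.fst (X := P) (Y := L.obj (L'.obj P))

/-- The second projection of the free object. -/
def freeSnd : (free adj adj' P h).X ⟶ L.obj (L'.obj P) := biprod.snd (X := P) (Y := L.obj (L'.obj P))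

@[simp]
theorem freeInl_fst : (freeInl : P ⟶ (free adj adj' P h).X) ≫ freeFst = 𝟙 P := biprod.inl_fst

@[simp]
theorem freeInr_fst : (freeInr : L.obj (L'.obj P) ⟶ (free adj adj' P h).X) ≫ freeFst = 0 := biprod.inr_fst

@[simp]
theorem freeInl_snd : (freeInl : P ⟶ (free adj adj' P h).X) ≫ freeSnd = 0 := biprod.inl_snd

@[simp]
theorem freeInr_snd : (freeInr : L.obj (L'.obj P) ⟶ (free adj adj' P h).X) ≫ freeSnd = 𝟙 _ := biprod.inr_snd

theorem free_total :
    freeFst ≫ freeInl + freeSnd ≫ freeInr = 𝟙 (free adj adj' P h).X := biprod.total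

theorem comp_free_comp {X Z : C} (x : X ⟶ (free adj adj' P h).X) (y : (free adj adj' P h).X ⟶ Z) :
    x ≫ y = x ≫ freeFst ≫ freeInl ≫ y + x ≫ freeSnd ≫ freeInr ≫ y := by
  rw [← Preadditive.comp_add, ← Category.assoc freeFst, ← Category.assoc freeSnd,
    ← Preadditive.add_comp, free_total, Category.id_comp]

theorem free_δ : (free adj adj' P h).δ = freeFst ≫ tr adj' (tr adj freeInr) := rfl

theorem free_ext {Z : C} {f g : (free adj adj' P h).X ⟶ Z} (h₁ : freeInl ≫ f = freeInl ≫ g)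
    (h₂ : freeInr ≫ f = freeInr ≫ g) : f = g := biprod.hom_ext' (X := P) (Y := L.obj (L'.obj P)) f g h₁ h₂

/-- A morphism out of the free object is given by its restriction to the generators. -/
def freeDesc (h : F (P ⊞ L.obj (L'.obj P))) {Y : RepObj H H' F} (p : P ⟶ Y.X) :
    free adj adj' P h ⟶ Y where
  f := freeFst ≫ p + freeSnd ≫ trs adj (trs adj' (p ≫ Y.δ))
  comm := by
    -- The structure map of the free object kills the second summand, so its image must lie in the
    -- kernel of `Y.δ`. This is where the square-zero condition enters.
    have e : trs adj (trs adj' (p ≫ Y.δ)) ≫ Y.δ = 0 := by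
      have := adj.left_adjoint_additive
      have := adj'.left_adjoint_additive
      rw [← trs_comp_map, ← trs_comp_map, Category.assoc, Y.sq, comp_zero, trs_zero, trs_zero]
    rw [Preadditive.add_comp, Category.assoc, Category.assoc, e, comp_zero, add_zero, free_δ,
      Category.assoc, ← tr_comp, ← tr_comp, Preadditive.comp_add, reassoc_of% freeInr_fst,
      reassoc_of% freeInr_snd, zero_comp, zero_add, tr_trs, tr_trs]

@[simp]
theorem freeInl_desc {Y : RepObj H H' F} (p : P ⟶ Y.X) :
    freeInl ≫ (freeDesc (adj := adj) (adj' := adj') h p).f = p := by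
  rw [freeDesc, Preadditive.comp_add, reassoc_of% freeInl_fst, reassoc_of% freeInl_snd, zero_comp,
    add_zero]

@[simp]
theorem freeInr_desc {Y : RepObj H H' F} (p : P ⟶ Y.X) :
    freeInr ≫ (freeDesc (adj := adj) (adj' := adj') h p).f = trs adj (trs adj' (p ≫ Y.δ)) := by
  rw [freeDesc, Preadditive.comp_add, reassoc_of% freeInr_fst, reassoc_of% freeInr_snd, zero_comp,
    zero_add]

/-- Compatibility with the structure maps, restricted to the generators, determines the second
component by transposition. This is the uniqueness half of freeness. -/
theorem freeInr_hom {Y : RepObj H H' F} (y : free adj adj' P h ⟶ Y) :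
    freeInr ≫ y.f = trs adj (trs adj' (freeInl ≫ y.f ≫ Y.δ)) := by
  rw [hom_comm, free_δ, Category.assoc, reassoc_of% freeInl_fst, ← tr_comp, ← tr_comp, trs_tr,
    trs_tr]

theorem free_hom_ext {Y : RepObj H H' F} {y z : free adj adj' P h ⟶ Y}
    (e : freeInl ≫ y.f = freeInl ≫ z.f) : y = z := by
  ext
  refine free_ext e ?_
  rw [freeInr_hom, freeInr_hom, ← Category.assoc, e, Category.assoc]

/-- A morphism to the free object in terms of its components. -/
def freeLift (h : F (P ⊞ L.obj (L'.obj P))) {X : RepObj H H' F} (x₀ : X.X ⟶ P)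
    (x₁ : X.X ⟶ L.obj (L'.obj P)) (e₀ : X.δ ≫ H'.map (H.map x₀) = 0)
    (e₁ : x₀ ≫ tr adj' (un adj (L'.obj P)) = X.δ ≫ H'.map (H.map x₁)) :
    X ⟶ free adj adj' P h where
  f := x₀ ≫ freeInl + x₁ ≫ freeInr
  comm := by
    rw [free_δ, Preadditive.add_comp, Category.assoc, Category.assoc, reassoc_of% freeInl_fst,
      reassoc_of% freeInr_fst, zero_comp, comp_zero, add_zero, ← un_map adj, tr_comp,
      reassoc_of% e₁, H.map_add, H'.map_add, H.map_comp, H'.map_comp,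
      H.map_comp, H'.map_comp, Preadditive.comp_add, reassoc_of% e₀, zero_comp, zero_add]

theorem freeLift_f {X : RepObj H H' F} (x₀ : X.X ⟶ P) (x₁ : X.X ⟶ L.obj (L'.obj P))
    (e₀ : X.δ ≫ H'.map (H.map x₀) = 0)
    (e₁ : x₀ ≫ tr adj' (un adj (L'.obj P)) = X.δ ≫ H'.map (H.map x₁)) :
    (freeLift h x₀ x₁ e₀ e₁).f = x₀ ≫ freeInl + x₁ ≫ freeInr := rfl

theorem hom_freeSnd {X : RepObj H H' F} (x : X ⟶ free adj adj' P h) :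
    (x.f ≫ freeFst) ≫ tr adj' (un adj (L'.obj P)) = X.δ ≫ H'.map (H.map (x.f ≫ freeSnd)) := by
  rw [H.map_comp, H'.map_comp, ← reassoc_of% hom_comm, free_δ, Category.assoc, Category.assoc,
    ← tr_comp, ← tr_comp, freeInr_snd, tr_id]

/-- By freeness it suffices to lift the restriction to `P`, and `epi_f_of_epi` makes the
projectivity of `P` applicable to the underlying map. -/
theorem projective_free (hF : ∀ {A B : C} (f : A ⟶ B) [Epi f], F A → F B) [Projective P] :
    Projective (free adj adj' P h) where
  factors {E X} f e _ := by
    have := epi_f_of_epi hF e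
    refine ⟨freeDesc h (Projective.factorThru (freeInl ≫ f.f) e.f), free_hom_ext ?_⟩
    rw [comp_f, reassoc_of% freeInl_desc, Projective.factorThru_comp]

end Free

/-- The map of underlying objects factors through a free object on a generator in the class `Q`. -/
def StablyZero (adj : L ⊣ H) (adj' : L' ⊣ H') (Q : ObjectProperty C) {X Y : RepObj H H' F} (x : X.X ⟶ Y.X) : Prop :=
  ∃ (P : C) (h : F (P ⊞ L.obj (L'.obj P))) (_ : Q P) (a : X ⟶ free adj adj' P h) (b : free adj adj' P h ⟶ Y),
    x = a.f ≫ b.f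

/-! ### The ideal of stably trivial maps. -/

section StablyZero

variable {adj : L ⊣ H} {adj' : L' ⊣ H'} {Q : ObjectProperty C}

theorem StablyZero.comp {X Y Z : RepObj H H' F} {x : X.X ⟶ Y.X} (hx : StablyZero adj adj' Q x)
    (g : Y ⟶ Z) : StablyZero adj adj' Q (x ≫ g.f) := by
  obtain ⟨P, h, hP, a, b, rfl⟩ := hx
  exact ⟨P, h, hP, a, b ≫ g, by simp⟩

theorem StablyZero.precomp {X Y Z : RepObj H H' F} {y : Y.X ⟶ Z.X} (hy : StablyZero adj adj' Q y)
    (g : X ⟶ Y) : StablyZero adj adj' Q (g.f ≫ y) := by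
  obtain ⟨P, h, hP, a, b, rfl⟩ := hy
  exact ⟨P, h, hP, g ≫ a, b, by simp⟩

/-- There are enough projective objects in the class `F`, chosen in the class `Q`. -/
structure EnoughFree (adj : L ⊣ H) (adj' : L' ⊣ H') (F Q : ObjectProperty C) : Prop where
  quotient : ∀ {A B : C} (f : A ⟶ B) [Epi f], F A → F B
  projective : ∀ P, Q P → Projective P
  free_mem : ∀ P, Q P → F (P ⊞ L.obj (L'.obj P))
  cover : ∀ X, F X → ∃ (P : C) (_ : Q P) (p : P ⟶ X), Epi p

variable (hQ : EnoughFree adj adj' F Q)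
include hQ

/-- A projective object is a retract of the free object on a cover of its underlying object. So free
objects suffice to define the stable category. -/
theorem EnoughFree.stablyZero_of_projective {X Y P : RepObj H H' F} [Projective P]
    (a : X ⟶ P) (b : P ⟶ Y) : StablyZero adj adj' Q (a.f ≫ b.f) := by
  obtain ⟨P', hP', p, hp⟩ := hQ.cover P.X P.mem
  let e := freeDesc (adj := adj) (adj' := adj') (hQ.free_mem P' hP') p
  have he : freeInl ≫ e.f = p := freeInl_desc p
  have : Epi e.f := by
    have : Epi (freeInl ≫ e.f) := he ▸ hp
    exact epi_of_epi freeInl e.f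
  have := epi_of_epi_f e
  refine ⟨P', _, hP', a ≫ Projective.factorThru (𝟙 P) e, e ≫ b, ?_⟩
  have h := congrArg Hom.f (Projective.factorThru_comp (𝟙 P) e)
  rw [comp_f, id_f] at h
  rw [comp_f, comp_f, Category.assoc, reassoc_of% h]

theorem EnoughFree.projective_free {P : C} (h : Q P) :
    Projective (free adj adj' P (hQ.free_mem P h)) := by
  have := hQ.projective P h
  exact RepObj.projective_free hQ.quotient

/-- The free object in a given factorization is projective, so its map to `Y` lifts to the free
object on any cover of `Y`. With the middle object fixed by the target, factorizations can be added
and subtracted. -/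
theorem EnoughFree.exists_factorization {X Y : RepObj H H' F} {x : X.X ⟶ Y.X}
    (hx : StablyZero adj adj' Q x) {P : C} (h : Q P) (p : P ⟶ Y.X) [Epi p] :
    ∃ a : X ⟶ free adj adj' P (hQ.free_mem P h), x = a.f ≫ (freeDesc (hQ.free_mem P h) p).f := by
  obtain ⟨P', h', hP', a, b, rfl⟩ := hx
  have := hQ.projective P' hP'
  have : Projective (free adj adj' P' h') := RepObj.projective_free hQ.quotient
  let e := freeDesc (adj := adj) (adj' := adj') (hQ.free_mem P h) p
  have he : freeInl ≫ e.f = p := freeInl_desc p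
  have : Epi e.f := by
    have : Epi (freeInl ≫ e.f) := he.symm ▸ inferInstance
    exact epi_of_epi freeInl e.f
  have := epi_of_epi_f e
  refine ⟨a ≫ Projective.factorThru b e, ?_⟩
  have h := congrArg Hom.f (Projective.factorThru_comp b e)
  rw [comp_f] at h
  rw [comp_f, Category.assoc, h]

theorem EnoughFree.add {X Y : RepObj H H' F} {x y : X.X ⟶ Y.X} (hx : StablyZero adj adj' Q x)
    (hy : StablyZero adj adj' Q y) : StablyZero adj adj' Q (x + y) := by
  obtain ⟨P, hP, p, hp⟩ := hQ.cover Y.X Y.mem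
  obtain ⟨a, ha⟩ := hQ.exists_factorization hx hP p
  obtain ⟨b, hb⟩ := hQ.exists_factorization hy hP p
  exact ⟨P, _, hP, a + b, _, by rw [add_f, Preadditive.add_comp, ha, hb]⟩

theorem EnoughFree.sub {X Y : RepObj H H' F} {x y : X.X ⟶ Y.X} (hx : StablyZero adj adj' Q x)
    (hy : StablyZero adj adj' Q y) : StablyZero adj adj' Q (x - y) := by
  obtain ⟨P, hP, p, hp⟩ := hQ.cover Y.X Y.mem
  obtain ⟨a, ha⟩ := hQ.exists_factorization hx hP p
  obtain ⟨b, hb⟩ := hQ.exists_factorization hy hP p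
  exact ⟨P, _, hP, a - b, _, by rw [sub_f, Preadditive.sub_comp, ha, hb]⟩

end StablyZero

end RepObj

end RepObj

/-! ## Counter equivalences of cotorsion pairs in abelian categories -/

section CounterSystem

universe v₁ v₂ u₁ u₂

open Limits

/-- Two adjunctions `L ⊣ H`, `L' ⊣ H'` between abelian categories in opposite directions, with
hereditary complete cotorsion pairs `(B, A)` and `(G, K)` relative to classes `FC` and `FD` of objects
such that `H : A ⇄ G : L` and `H' : K ⇄ B : L'` are equivalences, and with enough projective objects,
in classes `P` and `Q`, whose images under `L'` and `L` lie in `G` and `B`. -/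
structure CounterSystem (C : Type u₁) [Category.{v₁} C] [Abelian C] (D : Type u₂)
    [Category.{v₂} D] [Abelian D] where
  L : D ⥤ C
  H : C ⥤ D
  L' : C ⥤ D
  H' : D ⥤ C
  adj : L ⊣ H
  adj' : L' ⊣ H'
  additiveL : L.Additive
  additiveH : H.Additive
  additiveL' : L'.Additive
  additiveH' : H'.Additive
  FC : ObjectProperty C
  A : ObjectProperty C
  B : ObjectProperty C
  P : ObjectProperty C
  FD : ObjectProperty D
  G : ObjectProperty D
  K : ObjectProperty D
  Q : ObjectProperty D
  FC_epi : ∀ {X Y : C} (f : X ⟶ Y) [Epi f], FC X → FC Y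
  FC_mono : ∀ {X Y : C} (f : X ⟶ Y) [Mono f], FC Y → FC X
  FC_biprod : ∀ {X Y : C}, FC X → FC Y → FC (X ⊞ Y)
  FD_epi : ∀ {X Y : D} (f : X ⟶ Y) [Epi f], FD X → FD Y
  FD_mono : ∀ {X Y : D} (f : X ⟶ Y) [Mono f], FD Y → FD X
  FD_biprod : ∀ {X Y : D}, FD X → FD Y → FD (X ⊞ Y)
  FC_L : ∀ {Y : D}, FD Y → FC (L.obj Y)
  FD_H : ∀ {X : C}, FC X → FD (H.obj X)
  FD_L' : ∀ {X : C}, FC X → FD (L'.obj X)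
  FC_H' : ∀ {Y : D}, FD Y → FC (H'.obj Y)
  A_le : A ≤ FC
  B_le : B ≤ FC
  G_le : G ≤ FD
  K_le : K ≤ FD
  A_biprod : ∀ {X Y : C}, A X → A Y → A (X ⊞ Y)
  G_biprod : ∀ {X Y : D}, G X → G Y → G (X ⊞ Y)
  extC : ∀ {s : ShortComplex C}, s.ShortExact → B s.X₃ → ∀ {Y : C}, A Y → ∀ f : s.X₁ ⟶ Y,
    ∃ g : s.X₂ ⟶ Y, s.f ≫ g = f
  liftC : ∀ {s : ShortComplex C}, s.ShortExact → A s.X₁ → ∀ {Y : C}, B Y → ∀ f : Y ⟶ s.X₃,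
    ∃ g : Y ⟶ s.X₂, g ≫ s.g = f
  extD : ∀ {s : ShortComplex D}, s.ShortExact → G s.X₃ → ∀ {Y : D}, K Y → ∀ f : s.X₁ ⟶ Y,
    ∃ g : s.X₂ ⟶ Y, s.f ≫ g = f
  liftD : ∀ {s : ShortComplex D}, s.ShortExact → K s.X₁ → ∀ {Y : D}, G Y → ∀ f : Y ⟶ s.X₃,
    ∃ g : Y ⟶ s.X₂, g ≫ s.g = f
  B_kernel : ∀ {s : ShortComplex C}, s.ShortExact → B s.X₂ → B s.X₃ → B s.X₁
  G_kernel : ∀ {s : ShortComplex D}, s.ShortExact → G s.X₂ → G s.X₃ → G s.X₁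
  K_cokernel : ∀ {s : ShortComplex D}, s.ShortExact → K s.X₁ → K s.X₂ → K s.X₃
  preenvelope : ∀ {X : C}, FC X → ∃ (Y Z : C) (f : X ⟶ Y) (g : Y ⟶ Z) (w : f ≫ g = 0),
      (ShortComplex.mk f g w).ShortExact ∧ A Y ∧ B Z
  precover : ∀ {X : D}, FD X → ∃ (Y Z : D) (f : Y ⟶ Z) (g : Z ⟶ X) (w : f ≫ g = 0),
      (ShortComplex.mk f g w).ShortExact ∧ K Y ∧ G Z
  P_projective : ∀ {X : C}, P X → Projective X
  P_le : P ≤ B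
  P_cover : ∀ {X : C}, FC X → ∃ (Y : C) (_ : P Y) (f : Y ⟶ X), Epi f
  Q_projective : ∀ {X : D}, Q X → Projective X
  Q_le : Q ≤ G
  Q_cover : ∀ {X : D}, FD X → ∃ (Y : D) (_ : Q Y) (f : Y ⟶ X), Epi f
  A_H : ∀ {X : C}, A X → G (H.obj X)
  G_L : ∀ {Y : D}, G Y → A (L.obj Y)
  B_L' : ∀ {X : C}, B X → K (L'.obj X)
  K_H' : ∀ {Y : D}, K Y → B (H'.obj Y)
  isIso_cu : ∀ {X : C}, A X → IsIso (cu adj X)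
  isIso_un : ∀ {Y : D}, G Y → IsIso (un adj Y)
  isIso_cu' : ∀ {Y : D}, K Y → IsIso (cu adj' Y)
  isIso_un' : ∀ {X : C}, B X → IsIso (un adj' X)
  Q_L : ∀ {Y : D}, Q Y → B (L.obj Y)
  P_L' : ∀ {X : C}, P X → G (L'.obj X)
  P_embedding : ∀ {X : C}, FC X → ∃ (Y : C) (_ : P Y) (f : X ⟶ L.obj (L'.obj Y)), Mono f
  Q_embedding : ∀ {X : D}, FD X → ∃ (Y : D) (_ : Q Y) (f : X ⟶ L'.obj (L.obj Y)), Mono f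

namespace CounterSystem

attribute [instance] CounterSystem.additiveL CounterSystem.additiveH CounterSystem.additiveL'
  CounterSystem.additiveH'

variable {C : Type u₁} [Category.{v₁} C] [Abelian C] {D : Type u₂} [Category.{v₂} D] [Abelian D]
  (S : CounterSystem C D)

/-- The objects of `C` with a square-zero map to `H' H`. -/
abbrev RepC := RepObj S.H S.H' S.FC

/-- The objects of `D` with a square-zero map to `H H'`. -/
abbrev RepD := RepObj S.H' S.H S.FD

/-- A special preenvelope of the underlying object of an object of `RepC`. -/
structure Enveloped where
  X : S.RepC
  A : C
  B : C
  ι : X.X ⟶ A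
  κ : A ⟶ B
  w : ι ≫ κ = 0
  exact : (ShortComplex.mk ι κ w).ShortExact
  memA : S.A A
  memB : S.B B

/-- A map from an object of `G` to the underlying object of an object of `RepD`. -/
structure Covered where
  Y : S.RepD
  G : D
  π : G ⟶ Y.X
  memG : S.G G

variable {S}

/-- A pushout is a quotient of a biproduct and, dually, a pullback is a subobject of one. This keeps
`Phi` in `FD` and `Psi` in `FC`. -/
theorem epi_desc_pushout {E : Type*} [Category* E] [Abelian E] {X Y Z : E} (f : X ⟶ Y) (g : X ⟶ Z) :
    Epi (biprod.desc (pushout.inl f g) (pushout.inr f g)) where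
  left_cancellation a b e := by
    refine pushout.hom_ext ?_ ?_
    · simpa using biprod.inl ≫= e
    · simpa using biprod.inr ≫= e

theorem mono_lift_pullback {E : Type*} [Category* E] [Abelian E] {X Y Z : E} (f : X ⟶ Z)
    (g : Y ⟶ Z) : Mono (biprod.lift (pullback.fst f g) (pullback.snd f g)) where
  right_cancellation a b e := by
    refine pullback.hom_ext ?_ ?_
    · simpa using e =≫ biprod.fst
    · simpa using e =≫ biprod.snd

/-! ### The pushout `Φ` of an enveloped object. -/

namespace Enveloped

variable (W : S.Enveloped)

theorem trs_δ_comp : trs S.adj' W.X.δ ≫ S.H.map W.X.δ = 0 := by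
  rw [← trs_comp_map, W.X.sq, trs_zero]

/-- The pushout condition in transposed form. Together with `trs_δ_comp` it makes the structure map
of `Phi` well defined. -/
theorem tr_inl_pushout :
    W.ι ≫ tr S.adj' (pushout.inl (S.L'.map W.ι) (trs S.adj' W.X.δ ≫ S.H.map W.ι)) =
      W.X.δ ≫ S.H'.map (S.H.map W.ι ≫ pushout.inr _ _) := by
  rw [← tr_map_comp, pushout.condition, Category.assoc, tr_comp, tr_trs]

/-- The object of `RepD` attached to an object of `RepC` with a special preenvelope. -/
def Phi : S.RepD where
  X := pushout (S.L'.map W.ι) (trs S.adj' W.X.δ ≫ S.H.map W.ι)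
  mem :=
    haveI := epi_desc_pushout (S.L'.map W.ι) (trs S.adj' W.X.δ ≫ S.H.map W.ι)
    S.FD_epi (biprod.desc (pushout.inl _ _) (pushout.inr _ _))
      (S.FD_biprod (S.FD_L' (S.A_le _ W.memA)) (S.FD_H (S.A_le _ W.memA)))
  δ := pushout.desc 0 (S.H.map (tr S.adj' (pushout.inl _ _))) (by
    rw [comp_zero, Category.assoc, ← S.H.map_comp, tr_inl_pushout, S.H.map_comp,
      ← Category.assoc, trs_δ_comp, zero_comp])
  sq := by
    refine pushout.hom_ext ?_ ?_
    · rw [pushout.inl_desc_assoc, zero_comp, comp_zero]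
    · rw [pushout.inr_desc_assoc, ← S.H.map_comp, ← tr_comp, pushout.inl_desc, tr_zero,
        S.H.map_zero]
      exact comp_zero.symm

/-- The canonical map `L' A ⟶ Φ`. -/
def j : S.L'.obj W.A ⟶ W.Phi.X := pushout.inl (S.L'.map W.ι) (trs S.adj' W.X.δ ≫ S.H.map W.ι)

/-- The canonical map `H A ⟶ Φ`. -/
def h : S.H.obj W.A ⟶ W.Phi.X := pushout.inr (S.L'.map W.ι) (trs S.adj' W.X.δ ≫ S.H.map W.ι)

theorem map_ι_j : S.L'.map W.ι ≫ W.j = trs S.adj' W.X.δ ≫ S.H.map W.ι ≫ W.h :=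
  pushout.condition.trans (Category.assoc _ _ _)

theorem ι_tr_j : W.ι ≫ tr S.adj' W.j = W.X.δ ≫ S.H'.map (S.H.map W.ι ≫ W.h) :=
  W.tr_inl_pushout

theorem j_δ : W.j ≫ W.Phi.δ = 0 := pushout.inl_desc _ _ _

theorem h_δ : W.h ≫ W.Phi.δ = S.H.map (tr S.adj' W.j) := pushout.inr_desc _ _ _

variable {W}

theorem phi_ext {Z : D} {f g : W.Phi.X ⟶ Z} (h₁ : W.j ≫ f = W.j ≫ g) (h₂ : W.h ≫ f = W.h ≫ g) :
    f = g := pushout.hom_ext h₁ h₂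

/-- Maps out of `Φ`. -/
def phiDesc {Z : D} (f : S.L'.obj W.A ⟶ Z) (g : S.H.obj W.A ⟶ Z)
    (e : S.L'.map W.ι ≫ f = trs S.adj' W.X.δ ≫ S.H.map W.ι ≫ g) : W.Phi.X ⟶ Z :=
  pushout.desc f g (e.trans (Category.assoc _ _ _).symm)

@[simp]
theorem j_desc {Z : D} (f : S.L'.obj W.A ⟶ Z) (g : S.H.obj W.A ⟶ Z)
    (e : S.L'.map W.ι ≫ f = trs S.adj' W.X.δ ≫ S.H.map W.ι ≫ g) : W.j ≫ phiDesc f g e = f :=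
  pushout.inl_desc _ _ _

@[simp]
theorem h_desc {Z : D} (f : S.L'.obj W.A ⟶ Z) (g : S.H.obj W.A ⟶ Z)
    (e : S.L'.map W.ι ≫ f = trs S.adj' W.X.δ ≫ S.H.map W.ι ≫ g) : W.h ≫ phiDesc f g e = g :=
  pushout.inr_desc _ _ _

variable (W)

/-- The functor `H` is faithful on maps out of objects of `A`. -/
theorem map_injective {Z : C} {f g : W.A ⟶ Z} (e : S.H.map f = S.H.map g) : f = g := by
  have := S.isIso_cu W.memA
  rw [← cancel_epi (cu S.adj W.A), ← trs_map, ← trs_map, e]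

variable {W}

/-- A map out of `Φ` is a morphism of `RepD` if it is so on the two parts. -/
def phiHom {Y : S.RepD} (f : S.L'.obj W.A ⟶ Y.X) (g : S.H.obj W.A ⟶ Y.X)
    (e : S.L'.map W.ι ≫ f = trs S.adj' W.X.δ ≫ S.H.map W.ι ≫ g)
    (e₁ : f ≫ Y.δ = 0) (e₂ : g ≫ Y.δ = S.H.map (tr S.adj' f)) : W.Phi ⟶ Y where
  f := phiDesc f g e
  comm := by
    refine phi_ext ?_ ?_
    · rw [reassoc_of% j_desc, e₁, reassoc_of% W.j_δ, zero_comp]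
    · rw [reassoc_of% h_desc, e₂, reassoc_of% W.h_δ, ← S.H.map_comp, ← tr_comp, j_desc]

@[simp]
theorem j_phiHom {Y : S.RepD} (f : S.L'.obj W.A ⟶ Y.X) (g : S.H.obj W.A ⟶ Y.X)
    (e : S.L'.map W.ι ≫ f = trs S.adj' W.X.δ ≫ S.H.map W.ι ≫ g)
    (e₁ : f ≫ Y.δ = 0) (e₂ : g ≫ Y.δ = S.H.map (tr S.adj' f)) :
    W.j ≫ (phiHom f g e e₁ e₂).f = f := j_desc f g e

@[simp]
theorem h_phiHom {Y : S.RepD} (f : S.L'.obj W.A ⟶ Y.X) (g : S.H.obj W.A ⟶ Y.X)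
    (e : S.L'.map W.ι ≫ f = trs S.adj' W.X.δ ≫ S.H.map W.ι ≫ g)
    (e₁ : f ≫ Y.δ = 0) (e₂ : g ≫ Y.δ = S.H.map (tr S.adj' f)) :
    W.h ≫ (phiHom f g e e₁ e₂).f = g := h_desc f g e

theorem h_hom_δ {Y : S.RepD} (y : W.Phi ⟶ Y) :
    W.h ≫ y.f ≫ Y.δ = S.H.map (tr S.adj' (W.j ≫ y.f)) := by
  rw [RepObj.hom_comm, reassoc_of% W.h_δ, tr_comp, S.H.map_comp]

/-- A morphism out of `Φ` is determined by its restriction to `H A`. -/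
theorem phi_hom_ext {Y : S.RepD} {y z : W.Phi ⟶ Y} (e : W.h ≫ y.f = W.h ≫ z.f) : y = z := by
  ext
  refine phi_ext ?_ e
  -- The component on `L' A` is recovered from the one on `H A`: composing the latter with `Y.δ`
  -- gives `H` of its transpose, and `H` is faithful on maps out of `A`.
  refine tr_injective S.adj' (W.map_injective ?_)
  rw [← h_hom_δ, ← h_hom_δ, reassoc_of% e]

end Enveloped

/-! ### The pullback `Ψ` of a covered object. -/

namespace Covered

variable (V : S.Covered)

/-- Up to transposition, `e` replaces `f` followed by `π` by `g` followed by `π ≫ δ`, so the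
composite applies the structure map of `Y` twice. This makes `psiMap` well defined. -/
theorem comp_trs_eq_zero {Z : C} (f : Z ⟶ S.H'.obj V.G) (g : Z ⟶ S.L.obj V.G)
    (e : f ≫ S.H'.map V.π = g ≫ trs S.adj (V.π ≫ V.Y.δ)) :
    S.L.map (trs S.adj' f) ≫ trs S.adj (V.π ≫ V.Y.δ) = 0 := by
  rw [← trs_comp, ← Category.assoc, ← trs_comp_map, e, ← trs_comp_map, Category.assoc,
    ← trs_comp_map, Category.assoc, V.Y.sq, comp_zero, trs_zero, comp_zero, trs_zero, trs_zero]

/-- The map `L L' Ψ ⟶ Ψ` that transposes to the structure map of `Ψ`. -/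
def psiMap : S.L.obj (S.L'.obj (pullback (S.H'.map V.π) (trs S.adj (V.π ≫ V.Y.δ)))) ⟶
    pullback (S.H'.map V.π) (trs S.adj (V.π ≫ V.Y.δ)) :=
  pullback.lift 0 (S.L.map (trs S.adj' (pullback.fst _ _))) (by
    rw [zero_comp, comp_trs_eq_zero V _ _ pullback.condition])

/-- The object of `RepC` attached to an object of `RepD` covered by an object of `G`. -/
def Psi : S.RepC where
  X := pullback (S.H'.map V.π) (trs S.adj (V.π ≫ V.Y.δ))
  mem :=
    haveI := mono_lift_pullback (S.H'.map V.π) (trs S.adj (V.π ≫ V.Y.δ))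
    S.FC_mono (biprod.lift (pullback.fst _ _) (pullback.snd _ _))
      (S.FC_biprod (S.FC_H' (S.G_le _ V.memG)) (S.FC_L (S.G_le _ V.memG)))
  δ := tr S.adj' (tr S.adj V.psiMap)
  sq := by
    -- `psiMap` has no component in `H' G`, and its component in `L G` depends only on the component
    -- of its argument in `H' G`.
    have e : S.L.map (S.L'.map V.psiMap) ≫ V.psiMap = 0 := by
      refine pullback.hom_ext ?_ ?_
      · rw [Category.assoc, psiMap, pullback.lift_fst, comp_zero, zero_comp]
      · rw [Category.assoc, psiMap, pullback.lift_snd, zero_comp, ← S.L.map_comp, ← trs_comp,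
          pullback.lift_fst, trs_zero, S.L.map_zero]
    rw [← tr_comp, ← tr_comp, ← tr_map_comp, ← tr_map_comp, e, tr_zero, tr_zero, tr_zero, tr_zero]

/-- The projection `Ψ ⟶ H' G`. -/
def b : V.Psi.X ⟶ S.H'.obj V.G := pullback.fst (S.H'.map V.π) (trs S.adj (V.π ≫ V.Y.δ))

/-- The projection `Ψ ⟶ L G`. -/
def a : V.Psi.X ⟶ S.L.obj V.G := pullback.snd (S.H'.map V.π) (trs S.adj (V.π ≫ V.Y.δ))

theorem b_map_π : V.b ≫ S.H'.map V.π = V.a ≫ trs S.adj (V.π ≫ V.Y.δ) := pullback.condition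

theorem δ_b : V.Psi.δ ≫ S.H'.map (S.H.map V.b) = 0 := by
  have e : V.psiMap ≫ pullback.fst _ _ = 0 := pullback.lift_fst _ _ _
  have : tr S.adj' (tr S.adj V.psiMap) ≫ S.H'.map (S.H.map (pullback.fst _ _)) = 0 := by
    rw [← tr_comp, ← tr_comp, e, tr_zero, tr_zero]
  exact this

theorem δ_a : V.Psi.δ ≫ S.H'.map (S.H.map V.a) = V.b ≫ S.H'.map (un S.adj V.G) := by
  have e : V.psiMap ≫ pullback.snd _ _ = S.L.map (trs S.adj' (pullback.fst _ _)) :=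
    pullback.lift_snd _ _ _
  have : tr S.adj' (tr S.adj V.psiMap) ≫ S.H'.map (S.H.map (pullback.snd _ _)) =
      pullback.fst _ _ ≫ S.H'.map (un S.adj V.G) := by
    rw [← tr_comp, ← tr_comp, e, tr_map, tr_comp, tr_trs]
  exact this

variable {V}

theorem psi_ext {Z : C} {f g : Z ⟶ V.Psi.X} (h₁ : f ≫ V.b = g ≫ V.b) (h₂ : f ≫ V.a = g ≫ V.a) :
    f = g := pullback.hom_ext h₁ h₂

/-- Maps to `Ψ`. -/
def psiLift {Z : C} (f : Z ⟶ S.H'.obj V.G) (g : Z ⟶ S.L.obj V.G)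
    (e : f ≫ S.H'.map V.π = g ≫ trs S.adj (V.π ≫ V.Y.δ)) : Z ⟶ V.Psi.X := pullback.lift f g e

@[simp]
theorem lift_b {Z : C} (f : Z ⟶ S.H'.obj V.G) (g : Z ⟶ S.L.obj V.G)
    (e : f ≫ S.H'.map V.π = g ≫ trs S.adj (V.π ≫ V.Y.δ)) : psiLift f g e ≫ V.b = f :=
  pullback.lift_fst _ _ _

@[simp]
theorem lift_a {Z : C} (f : Z ⟶ S.H'.obj V.G) (g : Z ⟶ S.L.obj V.G)
    (e : f ≫ S.H'.map V.π = g ≫ trs S.adj (V.π ≫ V.Y.δ)) : psiLift f g e ≫ V.a = g :=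
  pullback.lift_snd _ _ _

/-- The two projections of `Psi` stay jointly monic under the right adjoint `H' H`; transposition
reduces this to `psi_ext`. -/
theorem map_psi_ext {Z : C} {f g : Z ⟶ S.H'.obj (S.H.obj V.Psi.X)}
    (h₁ : f ≫ S.H'.map (S.H.map V.b) = g ≫ S.H'.map (S.H.map V.b))
    (h₂ : f ≫ S.H'.map (S.H.map V.a) = g ≫ S.H'.map (S.H.map V.a)) : f = g := by
  refine trs_injective S.adj' (trs_injective S.adj (psi_ext ?_ ?_))
  · rw [← trs_comp_map, ← trs_comp_map, ← trs_comp_map, ← trs_comp_map, h₁]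
  · rw [← trs_comp_map, ← trs_comp_map, ← trs_comp_map, ← trs_comp_map, h₂]

/-- A map to `Ψ` is a morphism of `RepC` if it is so on the two parts. -/
def psiHom {X : S.RepC} (f : X.X ⟶ S.H'.obj V.G) (g : X.X ⟶ S.L.obj V.G)
    (e : f ≫ S.H'.map V.π = g ≫ trs S.adj (V.π ≫ V.Y.δ))
    (e₁ : X.δ ≫ S.H'.map (S.H.map f) = 0)
    (e₂ : X.δ ≫ S.H'.map (S.H.map g) = f ≫ S.H'.map (un S.adj V.G)) : X ⟶ V.Psi where
  f := psiLift f g e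
  comm := by
    refine map_psi_ext ?_ ?_
    · rw [Category.assoc, δ_b, comp_zero, Category.assoc, ← S.H'.map_comp, ← S.H.map_comp, lift_b,
        e₁]
    · rw [Category.assoc, δ_a, reassoc_of% lift_b, Category.assoc, ← S.H'.map_comp, ← S.H.map_comp,
        lift_a, e₂]

@[simp]
theorem psiHom_b {X : S.RepC} (f : X.X ⟶ S.H'.obj V.G) (g : X.X ⟶ S.L.obj V.G)
    (e : f ≫ S.H'.map V.π = g ≫ trs S.adj (V.π ≫ V.Y.δ))
    (e₁ : X.δ ≫ S.H'.map (S.H.map f) = 0)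
    (e₂ : X.δ ≫ S.H'.map (S.H.map g) = f ≫ S.H'.map (un S.adj V.G)) :
    (psiHom f g e e₁ e₂).f ≫ V.b = f := lift_b f g e

@[simp]
theorem psiHom_a {X : S.RepC} (f : X.X ⟶ S.H'.obj V.G) (g : X.X ⟶ S.L.obj V.G)
    (e : f ≫ S.H'.map V.π = g ≫ trs S.adj (V.π ≫ V.Y.δ))
    (e₁ : X.δ ≫ S.H'.map (S.H.map f) = 0)
    (e₂ : X.δ ≫ S.H'.map (S.H.map g) = f ≫ S.H'.map (un S.adj V.G)) :
    (psiHom f g e e₁ e₂).f ≫ V.a = g := lift_a f g e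

theorem δ_hom_a {X : S.RepC} (x : X ⟶ V.Psi) :
    X.δ ≫ S.H'.map (S.H.map (x.f ≫ V.a)) = (x.f ≫ V.b) ≫ S.H'.map (un S.adj V.G) := by
  rw [S.H.map_comp, S.H'.map_comp, ← reassoc_of% RepObj.hom_comm x, δ_a, Category.assoc]

/-- A morphism to `Ψ` is determined by its component in `L G`. -/
theorem psi_hom_ext {X : S.RepC} {x y : X ⟶ V.Psi} (e : x.f ≫ V.a = y.f ≫ V.a) : x = y := by
  ext
  refine psi_ext ?_ e
  -- By `δ_hom_a` the component in `L G` determines the one in `H' G` up to `H'` of the unit at `G`,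
  -- which is invertible.
  have := S.isIso_un V.memG
  rw [← cancel_mono (S.H'.map (un S.adj V.G)), ← δ_hom_a, ← δ_hom_a, e]

end Covered

end CounterSystem

end CounterSystem

section Links

universe v₁ v₂ u₁ u₂

open Limits

namespace CounterSystem

variable {C : Type u₁} [Category.{v₁} C] [Abelian C] {D : Type u₂} [Category.{v₂} D] [Abelian D]
  {S : CounterSystem C D}

theorem trs_comp_un {L : D ⥤ C} {H : C ⥤ D} (adj : L ⊣ H) {X Y : D} (f : X ⟶ Y) :
    trs adj (f ≫ un adj Y) = L.map f := by
  rw [← tr_map, trs_tr]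

/-! ### Exactness of the functors on conflations -/

/-- Embed `L' X₁` into some `L' L Q`. Since `L Q` lies in `B`, its unit is invertible and the
embedding is `L'` of a map `X₁ ⟶ L Q`. Since `L Q` also lies in `A`, that map extends to `X₂`, so
the embedding factors through `L' s.f`. -/
theorem mono_map_L' {s : ShortComplex C} (hs : s.ShortExact) (h₃ : S.B s.X₃) (h₁ : S.FC s.X₁) :
    Mono (S.L'.map s.f) := by
  obtain ⟨Q, hQ, f, hf⟩ := S.Q_embedding (S.FD_L' h₁)
  have := S.isIso_un' (S.Q_L hQ)
  obtain ⟨g, hg⟩ := S.extC hs h₃ (S.G_L (S.Q_le _ hQ)) (tr S.adj' f ≫ inv (un S.adj' _))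
  have e : S.L'.map s.f ≫ S.L'.map g = f := by
    refine tr_injective S.adj' ?_
    rw [← S.L'.map_comp, hg, tr_map, Category.assoc, IsIso.inv_hom_id, Category.comp_id]
  have : Mono (S.L'.map s.f ≫ S.L'.map g) := e ▸ hf
  exact mono_of_mono _ (S.L'.map g)

/-- The argument of `mono_map_L'` with an embedding into `L L' P`: here `L' P` lies in `G`, so its
unit is invertible, and in `K`, so maps to it extend. -/
theorem mono_map_L {s : ShortComplex D} (hs : s.ShortExact) (h₃ : S.G s.X₃) (h₁ : S.FD s.X₁) :
    Mono (S.L.map s.f) := by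
  obtain ⟨P, hP, f, hf⟩ := S.P_embedding (S.FC_L h₁)
  have := S.isIso_un (S.P_L' hP)
  obtain ⟨g, hg⟩ := S.extD hs h₃ (S.B_L' (S.P_le _ hP)) (tr S.adj f ≫ inv (un S.adj _))
  have e : S.L.map s.f ≫ S.L.map g = f := by
    refine tr_injective S.adj ?_
    rw [← S.L.map_comp, hg, tr_map, Category.assoc, IsIso.inv_hom_id, Category.comp_id]
  have : Mono (S.L.map s.f ≫ S.L.map g) := e ▸ hf
  exact mono_of_mono _ (S.L.map g)

/-- Cover `H' X₃` by a projective `P`. The transpose `L' P ⟶ X₃` lifts to `X₂` because `L' P` lies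
in `G` and the kernel in `K`; transposing back factors the cover through `H' s.g`. -/
theorem epi_map_H' {s : ShortComplex D} (hs : s.ShortExact) (h₁ : S.K s.X₁) (h₃ : S.FD s.X₃) :
    Epi (S.H'.map s.g) := by
  obtain ⟨P, hP, f, hf⟩ := S.P_cover (S.FC_H' h₃)
  obtain ⟨g, hg⟩ := S.liftD hs h₁ (S.P_L' hP) (trs S.adj' f)
  have e : tr S.adj' g ≫ S.H'.map s.g = f := by
    rw [← tr_comp, hg, tr_trs]
  have : Epi (tr S.adj' g ≫ S.H'.map s.g) := e ▸ hf
  exact epi_of_epi (tr S.adj' g) _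

theorem shortExact_map_L' {s : ShortComplex C} (hs : s.ShortExact) (h₃ : S.B s.X₃)
    (h₁ : S.FC s.X₁) : (s.map S.L').ShortExact := by
  have := S.adj'.leftAdjoint_preservesColimits
  have := hs.epi_g
  have := mono_map_L' hs h₃ h₁
  exact { exact := ShortComplex.exact_of_g_is_cokernel _
            (CokernelCofork.mapIsColimit _ hs.gIsCokernel S.L')
          mono_f := this
          epi_g := inferInstanceAs (Epi (S.L'.map s.g)) }

theorem shortExact_map_L {s : ShortComplex D} (hs : s.ShortExact) (h₃ : S.G s.X₃)
    (h₁ : S.FD s.X₁) : (s.map S.L).ShortExact := by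
  have := S.adj.leftAdjoint_preservesColimits
  have := hs.epi_g
  have := mono_map_L hs h₃ h₁
  exact { exact := ShortComplex.exact_of_g_is_cokernel _
            (CokernelCofork.mapIsColimit _ hs.gIsCokernel S.L)
          mono_f := this
          epi_g := inferInstanceAs (Epi (S.L.map s.g)) }

theorem shortExact_kernel {E : Type*} [Category* E] [Abelian E] {X Y : E} (f : X ⟶ Y) [Epi f] :
    (ShortComplex.mk (kernel.ι f) f (kernel.condition f)).ShortExact where
  exact := ShortComplex.exact_of_f_is_kernel _ (kernelIsKernel f)

theorem shortExact_cokernel {E : Type*} [Category* E] [Abelian E] {X Y : E} (f : X ⟶ Y) [Mono f] :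
    (ShortComplex.mk f (cokernel.π f) (cokernel.condition f)).ShortExact where
  exact := ShortComplex.exact_of_g_is_cokernel _ (cokernelIsCokernel f)

/-- Every object of `B` has an `A`-preenvelope of the form `L Q` with `Q` projective. -/
theorem exists_preenvelope_L {B : C} (hB : S.B B) : ∃ (Q : D) (_ : S.Q Q) (β : B ⟶ S.L.obj Q),
    ∀ {A : C}, S.A A → ∀ f : B ⟶ A, ∃ g, β ≫ g = f := by
  obtain ⟨A₀, B₀, i, p, w, hs, hA₀, hB₀⟩ := S.preenvelope (S.B_le _ hB)
  obtain ⟨Q, hQ, q, hq⟩ := S.Q_cover (S.FD_H (S.A_le _ hA₀))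
  have hk := shortExact_kernel q
  have hG := S.G_kernel hk (S.Q_le _ hQ) (S.A_H hA₀)
  have hL := shortExact_map_L hk (S.A_H hA₀) (S.G_le _ hG)
  have := S.isIso_cu hA₀
  -- The kernel of `L Q ⟶ L H A₀ ≅ A₀` is the image under `L` of an object of `G`, hence lies in
  -- `A`, so the special preenvelope `i` lifts to `L Q`. Any map that factors through `i` then
  -- factors through `β`.
  obtain ⟨β, hβ⟩ : ∃ β : B ⟶ S.L.obj Q, β ≫ S.L.map q = i ≫ inv (cu S.adj A₀) :=
    S.liftC hL (S.G_L hG) hB _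
  refine ⟨Q, hQ, β, fun {A} hA f => ?_⟩
  obtain ⟨g, hg⟩ : ∃ g : A₀ ⟶ A, i ≫ g = f := S.extC hs hB₀ hA f
  exact ⟨S.L.map q ≫ cu S.adj A₀ ≫ g, by simp [reassoc_of% hβ, hg]⟩

/-- Every object of `K` has a `G`-precover of the form `L' P` with `P` projective. -/
theorem exists_precover_L' {K : D} (hK : S.K K) : ∃ (P : C) (_ : S.P P) (ρ : S.L'.obj P ⟶ K),
    ∀ {G : D}, S.G G → ∀ f : G ⟶ K, ∃ g, g ≫ ρ = f := by
  obtain ⟨P, hP, p, hp⟩ := S.P_cover (S.FC_H' (S.K_le _ hK))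
  have hk := shortExact_kernel p
  have hB := S.B_kernel hk (S.P_le _ hP) (S.K_H' hK)
  have hL := shortExact_map_L' hk (S.K_H' hK) (S.B_le _ hB)
  have := S.isIso_cu' hK
  refine ⟨P, hP, S.L'.map p ≫ cu S.adj' K, fun {G} hG f => ?_⟩
  -- The kernel of `L' P ⟶ L' H' K ≅ K` is the image under `L'` of an object of `B`, hence lies in
  -- `K`.
  obtain ⟨g, hg⟩ : ∃ g : G ⟶ S.L'.obj P, g ≫ S.L'.map p = f ≫ inv (cu S.adj' K) :=
    S.liftD hL (S.B_L' hB) hG _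
  exact ⟨g, by simp [reassoc_of% hg]⟩

/-! ### Links -/

/-- A map `A ⟶ L G`, together with its mate `H A ⟶ G`, that induces both a morphism `Φ ⟶ Y` and a
morphism `X ⟶ Ψ`. -/
structure Link (W : S.Enveloped) (V : S.Covered) where
  a : W.A ⟶ S.L.obj V.G
  c : S.H.obj W.A ⟶ V.G
  mate : c ≫ un S.adj V.G = S.H.map a
  compat : W.ι ≫ a ≫ trs S.adj (V.π ≫ V.Y.δ) = W.X.δ ≫ S.H'.map (S.H.map W.ι ≫ c ≫ V.π)

namespace Link

variable {W W' : S.Enveloped} {V : S.Covered}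

/-- The morphism `Φ ⟶ Y` induced by a link. -/
def phi (m : Link W V) : W.Phi ⟶ V.Y :=
  Enveloped.phiHom (trs S.adj' (m.a ≫ trs S.adj (V.π ≫ V.Y.δ))) (m.c ≫ V.π)
    (by rw [← trs_comp, m.compat, trs_comp_map])
    (by rw [← trs_comp_map, Category.assoc, ← trs_comp_map, Category.assoc, V.Y.sq, comp_zero,
      trs_zero, comp_zero, trs_zero])
    (by rw [tr_trs, S.H.map_comp, ← m.mate, Category.assoc, Category.assoc, un_map, tr_trs])

/-- The morphism `X ⟶ Ψ` induced by a link. -/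
def psi (m : Link W V) : W.X ⟶ V.Psi :=
  Covered.psiHom (W.X.δ ≫ S.H'.map (S.H.map W.ι ≫ m.c)) (W.ι ≫ m.a)
    (by rw [Category.assoc, ← S.H'.map_comp, Category.assoc, ← m.compat, Category.assoc])
    (by rw [S.H.map_comp, S.H'.map_comp, ← Category.assoc, W.X.sq, zero_comp])
    (by rw [S.H.map_comp, ← m.mate, Category.assoc, ← S.H'.map_comp, Category.assoc])

theorem h_phi (m : Link W V) : W.h ≫ m.phi.f = m.c ≫ V.π := Enveloped.h_phiHom _ _ _ _ _

theorem j_phi (m : Link W V) :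
    W.j ≫ m.phi.f = trs S.adj' (m.a ≫ trs S.adj (V.π ≫ V.Y.δ)) := Enveloped.j_phiHom _ _ _ _ _

theorem psi_a (m : Link W V) : m.psi.f ≫ V.a = W.ι ≫ m.a := Covered.psiHom_a _ _ _ _ _

theorem psi_b (m : Link W V) : m.psi.f ≫ V.b = W.X.δ ≫ S.H'.map (S.H.map W.ι ≫ m.c) :=
  Covered.psiHom_b _ _ _ _ _

/-- The difference of two links. -/
def sub (m n : Link W V) : Link W V where
  a := m.a - n.a
  c := m.c - n.c
  mate := by rw [Preadditive.sub_comp, m.mate, n.mate, S.H.map_sub]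
  compat := by
    simp only [Preadditive.sub_comp, Preadditive.comp_sub, m.compat, n.compat, S.H'.map_sub]

theorem phi_sub (m n : Link W V) : (m.sub n).phi = m.phi - n.phi := by
  refine Enveloped.phi_hom_ext ?_
  rw [h_phi, RepObj.sub_f, Preadditive.comp_sub, h_phi, h_phi, ← Preadditive.sub_comp]
  rfl

theorem psi_sub (m n : Link W V) : (m.sub n).psi = m.psi - n.psi := by
  refine Covered.psi_hom_ext ?_
  rw [psi_a, RepObj.sub_f, Preadditive.sub_comp, psi_a, psi_a, ← Preadditive.comp_sub]
  rfl

end Link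

/-- The counit identifies `L H A` with `A`, so `L c` is a map out of `A`; the mate equation is
naturality of the unit. -/
theorem exists_mate_of_left {A : C} (hA : S.A A) {G : D} (c : S.H.obj A ⟶ G) :
    ∃ a : A ⟶ S.L.obj G, c ≫ un S.adj G = S.H.map a := by
  have := S.isIso_cu hA
  refine ⟨inv (cu S.adj A) ≫ S.L.map c, ?_⟩
  rw [← cancel_epi (S.H.map (cu S.adj A)), ← S.H.map_comp, IsIso.hom_inv_id_assoc,
    ← un_naturality, ← Category.assoc]
  have e : S.H.map (cu S.adj A) ≫ un S.adj (S.H.obj A) = 𝟙 _ := by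
    rw [← cancel_mono (S.H.map (cu S.adj A)), Category.assoc, un_cu, Category.comp_id,
      Category.id_comp]
  rw [e, Category.id_comp]

theorem exists_mate_of_right {A : C} {G : D} (hG : S.G G) (a : A ⟶ S.L.obj G) :
    ∃ c : S.H.obj A ⟶ G, c ≫ un S.adj G = S.H.map a := by
  have := S.isIso_un hG
  exact ⟨S.H.map a ≫ inv (un S.adj G), by simp⟩

/-- A link that factors through projective objects induces stably trivial morphisms. -/
theorem Link.stablyZero {W : S.Enveloped} {V : S.Covered} (m : Link W V) {P : C} (hP : S.P P)
    {Q : D} (hQ : S.Q Q) (u : P ⟶ S.L.obj Q) (x₀ : W.X.X ⟶ P) (s : W.A ⟶ S.L.obj Q)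
    (s₁ : S.H.obj W.A ⟶ Q) (t : S.H.obj W.A ⟶ S.L'.obj P) (s' : Q ⟶ V.G) (t' : S.L'.obj P ⟶ V.G)
    (hc : m.c = s₁ ≫ s' + t ≫ t') (hs : s₁ ≫ un S.adj Q = S.H.map s)
    (hx : x₀ ≫ un S.adj' P = W.X.δ ≫ S.H'.map (S.H.map W.ι ≫ t)) (hιs : W.ι ≫ s = x₀ ≫ u)
    (ht' : t' ≫ V.π = S.L'.map u ≫ trs S.adj' (trs S.adj (s' ≫ V.π ≫ V.Y.δ))) :
    RepObj.StablyZero S.adj' S.adj S.Q m.phi.f ∧ RepObj.StablyZero S.adj S.adj' S.P m.psi.f := by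
  -- By `hx` the map `x₀` is, up to the unit at `P`, a map that begins with the structure map of
  -- `X`, so the square-zero condition kills this composite.
  have e₀ : W.X.δ ≫ S.H'.map (S.H.map x₀) = 0 := by
    have := S.isIso_un' (S.P_le _ hP)
    rw [← cancel_mono (S.H'.map (S.H.map (un S.adj' P))), Category.assoc, ← S.H'.map_comp,
      ← S.H.map_comp, hx, S.H.map_comp, S.H'.map_comp, ← Category.assoc, W.X.sq, zero_comp,
      zero_comp]
  have e₁ : S.L'.map x₀ = trs S.adj' W.X.δ ≫ S.H.map W.ι ≫ t := by
    refine tr_injective S.adj' ?_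
    rw [tr_map, hx, tr_comp, tr_trs]
  -- Needed for the pair `(0, s₁)` to define a map on the pushout `Phi`. After the unit at `Q` it
  -- reduces to `e₀`.
  have e₂ : trs S.adj' W.X.δ ≫ S.H.map W.ι ≫ s₁ = 0 := by
    have := S.isIso_un (S.Q_le _ hQ)
    rw [← cancel_mono (un S.adj Q), Category.assoc, Category.assoc, hs, ← S.H.map_comp, hιs,
      ← trs_comp_map, S.H.map_comp, S.H'.map_comp, ← Category.assoc, e₀, zero_comp, trs_zero,
      zero_comp]
  obtain ⟨t₁, ht₁⟩ := exists_mate_of_left W.memA t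
  have ha : m.a = s ≫ S.L.map s' + t₁ ≫ S.L.map t' := by
    refine W.map_injective ?_
    rw [← m.mate, hc, S.H.map_add, S.H.map_comp, S.H.map_comp, ← hs, ← ht₁, Preadditive.add_comp,
      Category.assoc, Category.assoc, Category.assoc, Category.assoc, un_naturality, un_naturality]
  constructor
  · have hFQ : S.FD (Q ⊞ S.L'.obj (S.L.obj Q)) :=
      S.FD_biprod (S.G_le _ (S.Q_le _ hQ)) (S.FD_L' (S.B_le _ (S.Q_L hQ)))
    -- The morphism on `Phi` passes through the free object on `Q`: `s₁` enters at the generators,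
    -- `t ≫ L' u` and `L' s` enter at the second summand.
    let y₀ : W.Phi.X ⟶ Q := Enveloped.phiDesc 0 s₁ (by rw [comp_zero, e₂])
    let y₁ : W.Phi.X ⟶ S.L'.obj (S.L.obj Q) := Enveloped.phiDesc (S.L'.map s) (t ≫ S.L'.map u) (by
      rw [← S.L'.map_comp, hιs, S.L'.map_comp, e₁, Category.assoc, Category.assoc])
    have hj₀ : W.j ≫ y₀ = 0 := Enveloped.j_desc _ _ _
    have hh₀ : W.h ≫ y₀ = s₁ := Enveloped.h_desc _ _ _
    have hj₁ : W.j ≫ y₁ = S.L'.map s := Enveloped.j_desc _ _ _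
    have hh₁ : W.h ≫ y₁ = t ≫ S.L'.map u := Enveloped.h_desc _ _ _
    let n : W.Phi ⟶ RepObj.free S.adj' S.adj Q hFQ := RepObj.freeLift hFQ y₀ y₁
      (by
        refine Enveloped.phi_ext ?_ ?_
        · rw [reassoc_of% W.j_δ, zero_comp, comp_zero]
        · rw [reassoc_of% W.h_δ, ← S.H.map_comp, ← tr_comp, hj₀, tr_zero, S.H.map_zero, comp_zero])
      (by
        refine Enveloped.phi_ext ?_ ?_
        · rw [reassoc_of% W.j_δ, zero_comp, reassoc_of% hj₀, zero_comp]
        · rw [reassoc_of% W.h_δ, ← S.H.map_comp, ← tr_comp, hj₁, tr_map, reassoc_of% hh₀, ← un_map,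
            reassoc_of% hs, S.H.map_comp])
    refine ⟨Q, hFQ, hQ, n, RepObj.freeDesc hFQ (s' ≫ V.π), ?_⟩
    refine congrArg RepObj.Hom.f (?_ : m.phi = n ≫ RepObj.freeDesc hFQ (s' ≫ V.π))
    refine Enveloped.phi_hom_ext ?_
    rw [m.h_phi, RepObj.comp_f, RepObj.freeLift_f, Preadditive.add_comp, Preadditive.comp_add,
      Category.assoc, Category.assoc, RepObj.freeInl_desc, RepObj.freeInr_desc, reassoc_of% hh₀,
      reassoc_of% hh₁, hc, Preadditive.add_comp, Category.assoc, Category.assoc, ht',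
      Category.assoc]
  · have hFP : S.FC (P ⊞ S.L.obj (S.L'.obj P)) :=
      S.FC_biprod (S.B_le _ (S.P_le _ hP)) (S.FC_L (S.G_le _ (S.P_L' hP)))
    -- The morphism to `Psi` passes through the free object on `P`, whose generators map to `Psi` by
    -- `t'` and `s'`; the hypothesis `ht'` is exactly the pullback condition.
    let p : P ⟶ V.Psi.X := Covered.psiLift (tr S.adj' t') (u ≫ S.L.map s') (by
      rw [← tr_comp, ht', tr_map_comp, tr_trs, Category.assoc, trs_comp])
    have hpa : p ≫ V.a = u ≫ S.L.map s' := Covered.lift_a _ _ _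
    have hpb : p ≫ V.b = tr S.adj' t' := Covered.lift_b _ _ _
    let x : W.X ⟶ RepObj.free S.adj S.adj' P hFP := RepObj.freeLift hFP x₀ (W.ι ≫ t₁) e₀
      (by rw [S.H.map_comp, ← ht₁, ← Category.assoc (S.H.map W.ι), S.H'.map_comp, ← Category.assoc,
        ← hx, Category.assoc, un_map])
    refine ⟨P, hFP, hP, x, RepObj.freeDesc hFP p, ?_⟩
    refine congrArg RepObj.Hom.f (?_ : m.psi = x ≫ RepObj.freeDesc hFP p)
    refine Covered.psi_hom_ext ?_
    rw [m.psi_a, RepObj.comp_f, RepObj.freeLift_f, Preadditive.add_comp, Preadditive.add_comp,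
      Category.assoc, Category.assoc, Category.assoc, Category.assoc, reassoc_of% RepObj.freeInr_desc,
      reassoc_of% RepObj.freeInl_desc, hpa, ← trs_comp_map, ← trs_comp_map, Category.assoc,
      Category.assoc, V.δ_a, reassoc_of% hpb, trs_comp_map, trs_tr, trs_comp_un, ← reassoc_of% hιs, ha,
      Preadditive.comp_add]

end CounterSystem

end Links

/-! ### Stable triviality of the two morphisms of a link. -/

section StableLinks

universe v₁ v₂ u₁ u₂

open Limits

namespace CounterSystem

variable {C : Type u₁} [Category.{v₁} C] [Abelian C] {D : Type u₂} [Category.{v₂} D] [Abelian D]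
  {S : CounterSystem C D}

variable (S) in
theorem enoughC : RepObj.EnoughFree S.adj S.adj' S.FC S.P where
  quotient f _ h := S.FC_epi f h
  projective _ h := S.P_projective h
  free_mem _ h := S.FC_biprod (S.B_le _ (S.P_le _ h)) (S.FC_L (S.G_le _ (S.P_L' h)))
  cover _ h := S.P_cover h

variable (S) in
theorem enoughD : RepObj.EnoughFree S.adj' S.adj S.FD S.Q where
  quotient f _ h := S.FD_epi f h
  projective _ h := S.Q_projective h
  free_mem _ h := S.FD_biprod (S.G_le _ (S.Q_le _ h)) (S.FD_L' (S.B_le _ (S.Q_L h)))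
  cover _ h := S.Q_cover h

/-- The unit at `G` is invertible, so the transpose of `g` descends to a map `Q ⟶ G`. -/
theorem exists_map_L_eq {Q G : D} (hG : S.G G) (g : S.L.obj Q ⟶ S.L.obj G) :
    ∃ f : Q ⟶ G, S.L.map f = g := by
  have := S.isIso_un hG
  refine ⟨tr S.adj g ≫ inv (un S.adj G), ?_⟩
  rw [← trs_comp_un S.adj, Category.assoc, IsIso.inv_hom_id, Category.comp_id, trs_tr]

theorem Enveloped.exists_ext (W : S.Enveloped) {A : C} (hA : S.A A) (f : W.X.X ⟶ A) :
    ∃ g, W.ι ≫ g = f := S.extC W.exact W.memB hA f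

theorem Enveloped.exists_desc (W : S.Enveloped) {Z : C} (f : W.A ⟶ Z) (hf : W.ι ≫ f = 0) :
    ∃ g, W.κ ≫ g = f := by
  have := W.exact.epi_g
  exact ⟨W.exact.exact.desc f hf, W.exact.exact.g_desc f hf⟩

theorem Enveloped.exists_lift (W : S.Enveloped) {Z : C} (f : Z ⟶ W.A) (hf : f ≫ W.κ = 0) :
    ∃ g, g ≫ W.ι = f := by
  have := W.exact.mono_f
  exact ⟨W.exact.exact.lift f hf, W.exact.exact.lift_f f hf⟩

/-- Maps `A ⟶ A'` that vanish on `X` factor through an object `L Q` with `Q` projective. -/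
theorem Enveloped.exists_syzygy (W : S.Enveloped) : ∃ (Q : D) (_ : S.Q Q) (s : W.A ⟶ S.L.obj Q),
    W.ι ≫ s = 0 ∧ ∀ {A : C}, S.A A → ∀ f : W.A ⟶ A, W.ι ≫ f = 0 → ∃ g, s ≫ g = f := by
  obtain ⟨Q, hQ, β, hβ⟩ := exists_preenvelope_L W.memB
  refine ⟨Q, hQ, W.κ ≫ β, by rw [← Category.assoc, W.w, zero_comp], fun {A} hA f hf => ?_⟩
  obtain ⟨f', rfl⟩ := W.exists_desc f hf
  obtain ⟨g, rfl⟩ := hβ hA f'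
  exact ⟨g, Category.assoc _ _ _⟩

/-- The map `G ⟶ Y` is a precover by `G` whose kernel is generated by `L' P` with `P` projective. -/
structure Covered.IsGood (V : S.Covered) : Prop where
  lift : ∀ {G : D}, S.G G → ∀ y : G ⟶ V.Y.X, ∃ c, c ≫ V.π = y
  syzygy : ∃ (P : C) (_ : S.P P) (t : S.L'.obj P ⟶ V.G), t ≫ V.π = 0 ∧
    ∀ {G : D}, S.G G → ∀ c : G ⟶ V.G, c ≫ V.π = 0 → ∃ e, e ≫ t = c

namespace Link

variable {W : S.Enveloped} {V : S.Covered}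

/-- A factorization of `ψ` through the free object on `P` is spread out to the preenvelope: its
second component extends to `A ⟶ L L' P`, its first is pushed along an `A`-preenvelope `P ⟶ L Q` and
then extended. The link differs from the resulting one by a link that vanishes on `X`, which factors
through the syzygy `B ⟶ L Q₂`. Both pieces have the shape required by `Link.stablyZero`. -/
theorem stablyZero_phi (m : Link W V) (hm : RepObj.StablyZero S.adj S.adj' S.P m.psi.f) :
    RepObj.StablyZero S.adj' S.adj S.Q m.phi.f := by
  obtain ⟨P, hF, hP, x, y, hxy⟩ := hm
  obtain ⟨t₁, ht₁⟩ := W.exists_ext (S.G_L (S.P_L' hP)) (x.f ≫ RepObj.freeSnd)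
  obtain ⟨t, ht⟩ := exists_mate_of_right (S.P_L' hP) t₁
  obtain ⟨Q, hQ, β, hβ⟩ := exists_preenvelope_L (S.P_le _ hP)
  obtain ⟨s, hs⟩ := W.exists_ext (S.G_L (S.Q_le _ hQ)) (x.f ≫ RepObj.freeFst ≫ β)
  obtain ⟨s₁, hs₁⟩ := exists_mate_of_right (S.Q_le _ hQ) s
  obtain ⟨g, hg⟩ := hβ (S.G_L V.memG) ((RepObj.freeInl ≫ y.f) ≫ V.a)
  obtain ⟨s', rfl⟩ := exists_map_L_eq V.memG g
  obtain ⟨Q₂, hQ₂, s₂, hs₂, hs₂'⟩ := W.exists_syzygy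
  let t' : S.L'.obj P ⟶ V.G := trs S.adj' ((RepObj.freeInl ≫ y.f) ≫ V.b)
  have hya : RepObj.freeInr ≫ y.f ≫ V.a = S.L.map t' := by
    rw [← Category.assoc, RepObj.freeInr_hom, ← trs_comp_map, ← trs_comp_map, Category.assoc,
      Category.assoc, V.δ_a, ← trs_comp_un S.adj t', ← trs_comp_map, Category.assoc, Category.assoc]
  -- On `X` the two extended terms sum to the `L G`-component of the factorization of `ψ`, which is
  -- also the restriction of `m.a`.
  have hd : W.ι ≫ (m.a - s ≫ S.L.map s' - t₁ ≫ S.L.map t') = 0 := by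
    rw [Preadditive.comp_sub, Preadditive.comp_sub, ← m.psi_a, hxy, reassoc_of% hs,
      reassoc_of% ht₁, ← hya, hg, Category.assoc, RepObj.comp_free_comp x.f, Category.assoc]
    abel
  obtain ⟨g₂, hg₂⟩ := hs₂' (S.G_L V.memG) _ hd
  obtain ⟨s₂', rfl⟩ := exists_map_L_eq V.memG g₂
  obtain ⟨r₂, hr₂⟩ := exists_mate_of_right (S.Q_le _ hQ₂) s₂
  have hιr : S.H.map W.ι ≫ r₂ = 0 := by
    have := S.isIso_un (S.Q_le _ hQ₂)
    rw [← cancel_mono (un S.adj Q₂), Category.assoc, hr₂, ← S.H.map_comp, hs₂, S.H.map_zero,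
      zero_comp]
  let m₂ : Link W V :=
    { a := s₂ ≫ S.L.map s₂'
      c := r₂ ≫ s₂'
      mate := by rw [Category.assoc, ← un_naturality, reassoc_of% hr₂, S.H.map_comp]
      compat := by
        rw [Category.assoc, reassoc_of% hs₂, zero_comp, Category.assoc, reassoc_of% hιr, zero_comp,
          S.H'.map_zero, comp_zero] }
  -- The correcting link runs entirely through `Q₂`; all maps to and from `P` are zero.
  have h₂ := (m₂.stablyZero hP hQ₂ 0 0 s₂ r₂ 0 s₂' 0 (by simp [m₂]) hr₂ (by simp) (by simp [hs₂])
    (by simp)).1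
  have h₁ := ((m.sub m₂).stablyZero hP hQ β (x.f ≫ RepObj.freeFst) s s₁ t s' t'
    (by
      have := S.isIso_un V.memG
      have e : m.a - m₂.a = s ≫ S.L.map s' + t₁ ≫ S.L.map t' := by
        change m.a - s₂ ≫ S.L.map s₂' = _
        rw [hg₂]
        abel
      rw [← cancel_mono (un S.adj V.G), (m.sub m₂).mate]
      change S.H.map (m.a - m₂.a) = _
      rw [e, S.H.map_add, S.H.map_comp, S.H.map_comp, ← hs₁, ← ht, Preadditive.add_comp,
        Category.assoc, Category.assoc, Category.assoc, Category.assoc, un_naturality,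
        un_naturality])
    hs₁
    (by
      have := S.isIso_un (S.P_L' hP)
      rw [← cancel_mono (S.H'.map (un S.adj (S.L'.obj P))), Category.assoc, un_map,
        RepObj.hom_freeSnd, ← ht₁, S.H.map_comp, ← ht, Category.assoc, ← S.H'.map_comp,
        Category.assoc])
    (by rw [hs, Category.assoc])
    (by
      refine tr_injective S.adj' ?_
      rw [tr_comp, tr_trs, Category.assoc, V.b_map_π, tr_map_comp, tr_trs, trs_comp S.adj s',
        reassoc_of% hg, Category.assoc])).1
  have := S.enoughD.add h₁ h₂
  rwa [phi_sub, RepObj.sub_f, sub_add_cancel] at this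

/-- The dual argument. The generators `Q` of the free object lift to `G` because the cover is good,
and the component in `L' L Q` lifts to `L' P` along a projective cover `P ⟶ L Q`. The remaining part
of the link is killed by `π`, hence factors through the syzygy `L' P₂ ⟶ G` of the good cover. -/
theorem stablyZero_psi (hV : V.IsGood) (m : Link W V)
    (hm : RepObj.StablyZero S.adj' S.adj S.Q m.phi.f) :
    RepObj.StablyZero S.adj S.adj' S.P m.psi.f := by
  obtain ⟨Q, hF, hQ, n, y, hny⟩ := hm
  obtain ⟨s', hs'⟩ := hV.lift (S.Q_le _ hQ) (RepObj.freeInl ≫ y.f)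
  obtain ⟨P, hP, ρ, hρ⟩ := S.P_cover (S.B_le _ (S.Q_L hQ))
  have hk := shortExact_kernel ρ
  have hB := S.B_kernel hk (S.P_le _ hP) (S.Q_L hQ)
  have hL := shortExact_map_L' hk (S.Q_L hQ) (S.B_le _ hB)
  obtain ⟨t, ht⟩ : ∃ t : S.H.obj W.A ⟶ S.L'.obj P,
      t ≫ S.L'.map ρ = W.h ≫ n.f ≫ RepObj.freeSnd := S.liftD hL (S.B_L' hB) (S.A_H W.memA) _
  obtain ⟨s, hs⟩ := exists_mate_of_left W.memA (W.h ≫ n.f ≫ RepObj.freeFst)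
  have hP' := S.isIso_un' (S.P_le _ hP)
  -- The hypothesis `hx` of `Link.stablyZero` leaves no choice here, since the unit at `P` is
  -- invertible.
  let x₀ : W.X.X ⟶ P := W.X.δ ≫ S.H'.map (S.H.map W.ι ≫ t) ≫ inv (un S.adj' P)
  have hx₀ : x₀ ≫ un S.adj' P = W.X.δ ≫ S.H'.map (S.H.map W.ι ≫ t) := by simp [x₀]
  -- `H` is faithful on maps out of `A`, and after `H` this is the compatibility of `n` with the
  -- structure maps of `Phi` and of the free object.
  have hs₂ : s ≫ un S.adj' (S.L.obj Q) = tr S.adj' (W.j ≫ n.f ≫ RepObj.freeSnd) := by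
    refine W.map_injective ?_
    rw [S.H.map_comp, ← hs, Category.assoc, un_map, tr_comp, S.H.map_comp, ← reassoc_of% W.h_δ,
      ← RepObj.hom_freeSnd]
    simp only [Category.assoc]
  have hιs : W.ι ≫ s = x₀ ≫ ρ := by
    have := S.isIso_un' (S.Q_L hQ)
    rw [← cancel_mono (un S.adj' _), Category.assoc, hs₂, Category.assoc, ← un_naturality,
      reassoc_of% hx₀, ← S.H'.map_comp, Category.assoc, ht, ← tr_map_comp, reassoc_of% W.map_ι_j,
      tr_comp, tr_trs]
  obtain ⟨t', ht'⟩ := hV.lift (S.P_L' hP)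
    (S.L'.map ρ ≫ trs S.adj' (trs S.adj (s' ≫ V.π ≫ V.Y.δ)))
  have hd : (m.c - (W.h ≫ n.f ≫ RepObj.freeFst) ≫ s' - t ≫ t') ≫ V.π = 0 := by
    rw [Preadditive.sub_comp, Preadditive.sub_comp, ← m.h_phi, hny, Category.assoc,
      Category.assoc t, hs', ht', reassoc_of% ht, reassoc_of% hs', ← RepObj.freeInr_hom,
      RepObj.comp_free_comp n.f, Preadditive.comp_add]
    simp only [Category.assoc]
    abel
  obtain ⟨P₂, hP₂, t₂, ht₂, ht₂'⟩ := hV.syzygy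
  obtain ⟨e, he⟩ := ht₂' (S.A_H W.memA) _ hd
  obtain ⟨a₂, ha₂⟩ := exists_mate_of_left W.memA (e ≫ t₂)
  let m₂ : Link W V :=
    { a := a₂
      c := e ≫ t₂
      mate := ha₂
      compat := by
        have : a₂ ≫ trs S.adj (V.π ≫ V.Y.δ) = 0 := by
          refine W.map_injective ?_
          rw [S.H.map_comp, ← ha₂, Category.assoc, Category.assoc, un_map, tr_trs,
            reassoc_of% ht₂, zero_comp, comp_zero, S.H.map_zero]
        rw [this, comp_zero, Category.assoc, ht₂, comp_zero, comp_zero, S.H'.map_zero, comp_zero] }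
  have hP₂' := S.isIso_un' (S.P_le _ hP₂)
  have h₂ := (m₂.stablyZero hP₂ hQ 0 (W.X.δ ≫ S.H'.map (S.H.map W.ι ≫ e) ≫ inv (un S.adj' P₂)) 0 0
    e 0 t₂ (by simp [m₂]) (by simp) (by simp) (by simp) (by simp [ht₂])).2
  have h₁ := ((m.sub m₂).stablyZero hP hQ ρ x₀ s (W.h ≫ n.f ≫ RepObj.freeFst) t s' t'
    (by
      change m.c - e ≫ t₂ = _
      rw [he]
      abel) hs hx₀ hιs ht').2
  have := S.enoughC.add h₁ h₂
  rwa [psi_sub, RepObj.sub_f, sub_add_cancel] at this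

/-- The restriction of `y` to `H A` lifts to `G`, as `H A` lies in `G` and the cover is good; its
left mate completes the link, and a morphism out of `Phi` is determined on `H A`. -/
theorem exists_phi_eq (hV : V.IsGood) (y : W.Phi ⟶ V.Y) : ∃ m : Link W V, m.phi = y := by
  obtain ⟨c, hc⟩ := hV.lift (S.A_H W.memA) (W.h ≫ y.f)
  obtain ⟨a, ha⟩ := exists_mate_of_left W.memA c
  have e : a ≫ trs S.adj (V.π ≫ V.Y.δ) = tr S.adj' (W.j ≫ y.f) := by
    refine W.map_injective ?_
    rw [S.H.map_comp, ← ha, Category.assoc, un_map, tr_trs, ← Enveloped.h_hom_δ, reassoc_of% hc]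
  refine ⟨⟨a, c, ha, ?_⟩, Enveloped.phi_hom_ext ?_⟩
  · rw [e, hc, ← tr_map_comp, reassoc_of% W.map_ι_j, tr_comp, tr_trs]
  · rw [h_phi, hc]

end Link

/-! ### A link with stably invertible morphisms, from the enveloped side -/

namespace Enveloped

variable (W : S.Enveloped)

/-- The projection `Φ ⟶ L' B`. -/
def σ : W.Phi.X ⟶ S.L'.obj W.B := phiDesc (S.L'.map W.κ) 0 (by
  rw [← S.L'.map_comp, W.w, S.L'.map_zero, comp_zero, comp_zero])

theorem j_σ : W.j ≫ W.σ = S.L'.map W.κ := j_desc _ _ _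

theorem h_σ : W.h ≫ W.σ = 0 := h_desc _ _ _

theorem mono_h : Mono W.h := by
  have : Mono (S.L'.map W.ι) := mono_map_L' W.exact W.memB W.X.mem
  exact inferInstanceAs (Mono (pushout.inr (S.L'.map W.ι) (trs S.adj' W.X.δ ≫ S.H.map W.ι)))

/-- In the pushout square the map `h` is monic and has the same cokernel `L' B` as `L' ι`, so `H A`
is the kernel of `σ`. -/
theorem exists_lift_h {Z : D} (z : Z ⟶ W.Phi.X) (hz : z ≫ W.σ = 0) : ∃ f, f ≫ W.h = z := by
  have := W.mono_h
  have hL := shortExact_map_L' W.exact W.memB W.X.mem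
  have := hL.epi_g
  have : Epi W.σ := by
    have : Epi (W.j ≫ W.σ) := W.j_σ ▸ this
    exact epi_of_epi W.j _
  have key : (ShortComplex.mk W.h W.σ W.h_σ).Exact := by
    refine ShortComplex.exact_of_g_is_cokernel _ (
      CokernelCofork.IsColimit.ofπ' _ _ fun {Z} (f : W.Phi.X ⟶ Z) (hf : W.h ≫ f = 0) => ?_)
    have e : S.L'.map W.ι ≫ W.j ≫ f = 0 := by
      rw [reassoc_of% W.map_ι_j, hf, comp_zero, comp_zero]
    let d : S.L'.obj W.B ⟶ Z := hL.exact.desc (W.j ≫ f) e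
    have hd : S.L'.map W.κ ≫ d = W.j ≫ f := hL.exact.g_desc _ e
    have hσ : W.σ ≫ d = f :=
      phi_ext (by rw [reassoc_of% W.j_σ, hd]) (by rw [reassoc_of% W.h_σ, zero_comp, hf])
    exact ⟨d, hσ⟩
  exact ⟨key.lift z hz, key.lift_f z hz⟩

end Enveloped

end CounterSystem

end StableLinks

/-! ### The canonical good cover of `Φ`. -/

section CanonicalCover

universe v₁ v₂ u₁ u₂

open Limits

namespace CounterSystem

variable {C : Type u₁} [Category.{v₁} C] [Abelian C] {D : Type u₂} [Category.{v₂} D] [Abelian D]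
  {S : CounterSystem C D}

namespace Enveloped

variable (W : S.Enveloped) {P : C} (hP : S.P P) (ρ : P ⟶ W.A)

/-- The object `Φ` covered by `H A ⊞ L' P`. -/
def cover : S.Covered where
  Y := W.Phi
  G := S.H.obj W.A ⊞ S.L'.obj P
  π := biprod.desc W.h (S.L'.map ρ ≫ W.j)
  memG := S.G_biprod (S.A_H W.memA) (S.P_L' hP)

/-- The inclusion of `H A` in the cover. -/
def inlC : S.H.obj W.A ⟶ (W.cover hP ρ).G := biprod.inl (X := S.H.obj W.A) (Y := S.L'.obj P)

/-- The inclusion of `L' P` in the cover. -/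
def inrC : S.L'.obj P ⟶ (W.cover hP ρ).G := biprod.inr (X := S.H.obj W.A) (Y := S.L'.obj P)

/-- The projection of the cover to `H A`. -/
def fstC : (W.cover hP ρ).G ⟶ S.H.obj W.A := biprod.fst (X := S.H.obj W.A) (Y := S.L'.obj P)

/-- The projection of the cover to `L' P`. -/
def sndC : (W.cover hP ρ).G ⟶ S.L'.obj P := biprod.snd (X := S.H.obj W.A) (Y := S.L'.obj P)

/-- The map from the cover, with values in `Φ`. -/
def πC : (W.cover hP ρ).G ⟶ W.Phi.X := biprod.desc W.h (S.L'.map ρ ≫ W.j)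

theorem inl_fstC : W.inlC hP ρ ≫ W.fstC hP ρ = 𝟙 _ := biprod.inl_fst

theorem inr_fstC : W.inrC hP ρ ≫ W.fstC hP ρ = 0 := biprod.inr_fst

theorem inl_sndC : W.inlC hP ρ ≫ W.sndC hP ρ = 0 := biprod.inl_snd

theorem inr_sndC : W.inrC hP ρ ≫ W.sndC hP ρ = 𝟙 _ := biprod.inr_snd

theorem inl_πC : W.inlC hP ρ ≫ W.πC hP ρ = W.h := biprod.inl_desc _ _

theorem inr_πC : W.inrC hP ρ ≫ W.πC hP ρ = S.L'.map ρ ≫ W.j := biprod.inr_desc _ _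

theorem totalC : W.fstC hP ρ ≫ W.inlC hP ρ + W.sndC hP ρ ≫ W.inrC hP ρ = 𝟙 _ := biprod.total

variable {W hP ρ} in
theorem coverExt {Z : D} {f g : (W.cover hP ρ).G ⟶ Z} (h₁ : W.inlC hP ρ ≫ f = W.inlC hP ρ ≫ g)
    (h₂ : W.inrC hP ρ ≫ f = W.inrC hP ρ ≫ g) : f = g :=
  biprod.hom_ext' (X := S.H.obj W.A) (Y := S.L'.obj P) f g h₁ h₂

variable {W hP ρ} in
theorem coverExt' {Z : D} {f g : Z ⟶ (W.cover hP ρ).G} (h₁ : f ≫ W.fstC hP ρ = g ≫ W.fstC hP ρ)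
    (h₂ : f ≫ W.sndC hP ρ = g ≫ W.sndC hP ρ) : f = g :=
  biprod.hom_ext (X := S.H.obj W.A) (Y := S.L'.obj P) f g h₁ h₂

theorem πC_eq : W.πC hP ρ = W.fstC hP ρ ≫ W.h + W.sndC hP ρ ≫ S.L'.map ρ ≫ W.j := by
  refine coverExt ?_ ?_
  · rw [inl_πC, Preadditive.comp_add, reassoc_of% inl_fstC, reassoc_of% inl_sndC, zero_comp, add_zero]
  · rw [inr_πC, Preadditive.comp_add, reassoc_of% inr_fstC, reassoc_of% inr_sndC, zero_comp, zero_add]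

theorem πC_σ : W.πC hP ρ ≫ W.σ = W.sndC hP ρ ≫ S.L'.map (ρ ≫ W.κ) := by
  rw [πC_eq, Preadditive.add_comp, Category.assoc, W.h_σ, comp_zero, zero_add, Category.assoc,
    Category.assoc, W.j_σ, S.L'.map_comp]

/-- The transpose of the structure map of `Φ` on the cover. -/
theorem trs_cover : trs S.adj ((W.cover hP ρ).π ≫ (W.cover hP ρ).Y.δ) =
    S.L.map (W.fstC hP ρ) ≫ cu S.adj W.A ≫ tr S.adj' W.j := by
  have e : W.πC hP ρ ≫ W.Phi.δ = W.fstC hP ρ ≫ S.H.map (tr S.adj' W.j) := by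
    rw [πC_eq, Preadditive.add_comp, Category.assoc, W.h_δ, Category.assoc, Category.assoc, W.j_δ,
      comp_zero, comp_zero, add_zero]
  have : trs S.adj (W.πC hP ρ ≫ W.Phi.δ) =
    S.L.map (W.fstC hP ρ) ≫ cu S.adj W.A ≫ tr S.adj' W.j := by
    rw [e, trs_comp, trs_map]
  exact this

theorem cover_b : (W.cover hP ρ).b ≫ S.H'.map (W.πC hP ρ) =
    (W.cover hP ρ).a ≫ S.L.map (W.fstC hP ρ) ≫ cu S.adj W.A ≫ tr S.adj' W.j :=
  (W.cover hP ρ).b_map_π.trans (congrArg _ (W.trs_cover hP ρ))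

section

variable [Epi ρ]

theorem shortExact_cover : (ShortComplex.mk (kernel.ι (ρ ≫ W.κ)) (ρ ≫ W.κ)
    (kernel.condition _)).ShortExact :=
  have := W.exact.epi_g
  have : Epi W.κ := this
  have : Epi (ρ ≫ W.κ) := epi_comp _ _
  shortExact_kernel _

include hP in
theorem mem_kernel_cover : S.B (kernel (ρ ≫ W.κ)) :=
  S.B_kernel (W.shortExact_cover ρ) (S.P_le _ hP) W.memB

/-- `Phi` is an extension of `L' B` by `H A`, and `L' P` maps onto `L' B` with kernel `L' N` in `K`,
where `N` is the kernel of `P ⟶ B`. This gives the lifts. The second component of a map killed by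
`π` lies in `L' N` and determines the first, because `h` is monic; so a `G`-precover of `L' N`
yields the syzygy. -/
theorem isGood_cover : (W.cover hP ρ).IsGood := by
  have hB := W.mem_kernel_cover hP ρ
  have hL := shortExact_map_L' (W.shortExact_cover ρ) W.memB (S.B_le _ hB)
  have := hL.mono_f
  refine ⟨fun {G} hG y => ?_, ?_⟩
  · have key : ∀ y : G ⟶ W.Phi.X, ∃ c, c ≫ W.πC hP ρ = y := by
      intro y
      obtain ⟨l, hl⟩ : ∃ l : G ⟶ S.L'.obj P, l ≫ S.L'.map (ρ ≫ W.κ) = y ≫ W.σ :=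
        S.liftD hL (S.B_L' hB) hG _
      -- After subtracting the part seen in `L' B`, what is left of `y` comes from `H A`.
      obtain ⟨f, hf⟩ := W.exists_lift_h (y - l ≫ S.L'.map ρ ≫ W.j) (by
        rw [Preadditive.sub_comp, ← hl, Category.assoc, Category.assoc, W.j_σ, S.L'.map_comp,
          sub_self])
      refine ⟨f ≫ W.inlC hP ρ + l ≫ W.inrC hP ρ, ?_⟩
      rw [Preadditive.add_comp, Category.assoc, Category.assoc, inl_πC, inr_πC, hf, sub_add_cancel]
    exact key y
  · obtain ⟨P', hP', ρ', hρ'⟩ := exists_precover_L' (S.B_L' hB)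
    -- The kernel of `P ⟶ B` maps to `X`, the kernel of `A ⟶ B`. The pushout relation then rewrites
    -- its contribution through `j` as one through `h`, which `c₀` records.
    obtain ⟨n, hn⟩ := W.exists_lift (kernel.ι (ρ ≫ W.κ) ≫ ρ)
      (by rw [Category.assoc, kernel.condition])
    obtain ⟨e₀, he₀⟩ : ∃ e₀ : S.L'.obj P' ⟶ S.L'.obj P,
      e₀ = ρ' ≫ S.L'.map (kernel.ι (ρ ≫ W.κ)) := ⟨_, rfl⟩
    obtain ⟨c₀, hc₀⟩ : ∃ c₀ : S.L'.obj P' ⟶ S.H.obj W.A,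
      c₀ = ρ' ≫ S.L'.map n ≫ trs S.adj' W.X.δ ≫ S.H.map W.ι := ⟨_, rfl⟩
    have h₀ : e₀ ≫ S.L'.map ρ ≫ W.j = c₀ ≫ W.h := by
      simp only [he₀, hc₀, Category.assoc]
      rw [← W.map_ι_j, ← S.L'.map_comp_assoc, ← S.L'.map_comp_assoc, hn]
    let t : S.L'.obj P' ⟶ (W.cover hP ρ).G := e₀ ≫ W.inrC hP ρ - c₀ ≫ W.inlC hP ρ
    have ht : t ≫ W.πC hP ρ = 0 := by
      simp only [t]
      rw [Preadditive.sub_comp, Category.assoc, Category.assoc, inl_πC, inr_πC, h₀, sub_self]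
    have ht₁ : t ≫ W.fstC hP ρ = -c₀ := by
      simp only [t]
      rw [Preadditive.sub_comp, Category.assoc, Category.assoc, inl_fstC, inr_fstC, comp_zero,
        Category.comp_id, zero_sub]
    have ht₂ : t ≫ W.sndC hP ρ = e₀ := by
      simp only [t]
      rw [Preadditive.sub_comp, Category.assoc, Category.assoc, inl_sndC, inr_sndC, comp_zero,
        Category.comp_id, sub_zero]
    refine ⟨P', hP', t, ht, fun {G} hG c hc => ?_⟩
    replace hc : c ≫ W.πC hP ρ = 0 := hc
    have hc' : (c ≫ W.sndC hP ρ) ≫ S.L'.map (ρ ≫ W.κ) = 0 := by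
      rw [Category.assoc, ← πC_σ, reassoc_of% hc, zero_comp]
    obtain ⟨d, hd⟩ : ∃ d : G ⟶ S.L'.obj (kernel (ρ ≫ W.κ)),
        d ≫ S.L'.map (kernel.ι (ρ ≫ W.κ)) = c ≫ W.sndC hP ρ :=
      ⟨hL.exact.lift _ hc', hL.exact.lift_f _ hc'⟩
    obtain ⟨e, rfl⟩ := hρ' hG d
    have he : e ≫ e₀ = c ≫ W.sndC hP ρ := by rw [← hd, he₀, Category.assoc]
    refine ⟨e, coverExt' ?_ ?_⟩
    · have := W.mono_h
      rw [← cancel_mono W.h, Category.assoc e, ht₁, Preadditive.comp_neg, Preadditive.neg_comp,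
        Category.assoc, ← h₀, reassoc_of% he, neg_eq_iff_add_eq_zero, add_comm, Category.assoc,
        ← Preadditive.comp_add, ← πC_eq, hc]
    · rw [Category.assoc, ht₂, he]

end

/-- The left mate of the inclusion of `H A` in the cover. -/
def mateC : W.A ⟶ S.L.obj (W.cover hP ρ).G :=
  (exists_mate_of_left W.memA (W.inlC hP ρ)).choose

theorem inl_un : W.inlC hP ρ ≫ un S.adj _ = S.H.map (W.mateC hP ρ) :=
  (exists_mate_of_left W.memA (W.inlC hP ρ)).choose_spec

theorem mate_fst_cu : W.mateC hP ρ ≫ S.L.map (W.fstC hP ρ) ≫ cu S.adj W.A = 𝟙 _ := by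
  refine W.map_injective ?_
  rw [S.H.map_comp, S.H.map_comp, ← inl_un, Category.assoc, reassoc_of% un_naturality S.adj (W.fstC hP ρ),
    reassoc_of% inl_fstC, un_cu, S.H.map_id]

theorem cu_mate : cu S.adj W.A ≫ W.mateC hP ρ = S.L.map (W.inlC hP ρ) := by
  rw [← trs_map, ← inl_un, trs_comp_un]

/-- The canonical link from `W` to its canonical cover. -/
def coverLink : Link W (W.cover hP ρ) where
  a := W.mateC hP ρ
  c := W.inlC hP ρ
  mate := W.inl_un hP ρ
  compat := by
    have : W.ι ≫ W.mateC hP ρ ≫ S.L.map (W.fstC hP ρ) ≫ cu S.adj W.A ≫ tr S.adj' W.j =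
        W.X.δ ≫ S.H'.map (S.H.map W.ι ≫ W.inlC hP ρ ≫ W.πC hP ρ) := by
      rw [reassoc_of% mate_fst_cu, inl_πC, W.ι_tr_j]
    rw [trs_cover]
    exact this

theorem coverLink_phi : (W.coverLink hP ρ).phi = 𝟙 W.Phi := by
  refine phi_hom_ext ?_
  have : W.inlC hP ρ ≫ W.πC hP ρ = W.h ≫ 𝟙 _ := by rw [inl_πC, Category.comp_id]
  exact (W.coverLink hP ρ).h_phi.trans this

/-- The component of the map from `Ψ` to `P`. -/
def toP : (W.cover hP ρ).Psi.X ⟶ P :=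
  haveI := S.isIso_un' (S.P_le _ hP)
  (W.cover hP ρ).b ≫ S.H'.map (W.sndC hP ρ) ≫ inv (un S.adj' P)

theorem toP_un : W.toP hP ρ ≫ un S.adj' P = (W.cover hP ρ).b ≫ S.H'.map (W.sndC hP ρ) := by
  simp [toP]

/-- The map from `Ψ` to `A` that factors through `X`. -/
def toA : (W.cover hP ρ).Psi.X ⟶ W.A :=
  (W.cover hP ρ).a ≫ S.L.map (W.fstC hP ρ) ≫ cu S.adj W.A - W.toP hP ρ ≫ ρ

/-- After the invertible unit at `B`, both terms of `toA` become `b` followed by `H'` of the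
composite of the cover with `σ`: the first by the pullback condition of `Psi`, the second by `πC_σ`.
-/
theorem toA_κ : W.toA hP ρ ≫ W.κ = 0 := by
  have := S.isIso_un' W.memB
  rw [← cancel_mono (un S.adj' W.B), zero_comp, toA, Preadditive.sub_comp, Preadditive.sub_comp,
    Category.assoc, Category.assoc, Category.assoc, Category.assoc, Category.assoc,
    ← tr_map, ← tr_map_comp S.adj' ρ, ← un_map S.adj' (S.L'.map ρ ≫ _), reassoc_of% toP_un,
    ← S.H'.map_comp, ← S.L'.map_comp, ← πC_σ, S.H'.map_comp, reassoc_of% cover_b,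
    ← tr_comp, W.j_σ, sub_self]

theorem toA_tr_j : W.toA hP ρ ≫ tr S.adj' W.j =
    (W.cover hP ρ).b ≫ S.H'.map (W.fstC hP ρ ≫ W.h) := by
  have e : W.toP hP ρ ≫ ρ ≫ tr S.adj' W.j =
      (W.cover hP ρ).b ≫ S.H'.map (W.sndC hP ρ ≫ S.L'.map ρ ≫ W.j) := by
    rw [← tr_map_comp, ← un_map, reassoc_of% toP_un, ← S.H'.map_comp]
  rw [toA, Preadditive.sub_comp, Category.assoc, Category.assoc, Category.assoc, ← cover_b, e, πC_eq,
    S.H'.map_add, Preadditive.comp_add, add_sub_cancel_right]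

theorem δ_toP : (W.cover hP ρ).Psi.δ ≫ S.H'.map (S.H.map (W.toP hP ρ)) = 0 := by
  have := S.isIso_un' (S.P_le _ hP)
  rw [toP, S.H.map_comp, S.H'.map_comp, reassoc_of% Covered.δ_b, zero_comp]

theorem δ_toA : (W.cover hP ρ).Psi.δ ≫ S.H'.map (S.H.map (W.toA hP ρ)) =
    (W.cover hP ρ).b ≫ S.H'.map (W.fstC hP ρ) := by
  rw [toA, S.H.map_sub, S.H'.map_sub, Preadditive.comp_sub, S.H.map_comp (W.toP hP ρ),
    S.H'.map_comp (S.H.map (W.toP hP ρ)), reassoc_of% δ_toP, zero_comp, sub_zero,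
    S.H.map_comp, S.H'.map_comp, reassoc_of% Covered.δ_a, S.H.map_comp, ← S.H'.map_comp,
    reassoc_of% un_naturality S.adj, un_cu, Category.comp_id]

/-- The stable inverse `Ψ ⟶ X` of the morphism of the canonical link. -/
theorem exists_retraction : ∃ r : (W.cover hP ρ).Psi ⟶ W.X,
    (W.coverLink hP ρ).psi ≫ r = 𝟙 _ ∧
    RepObj.StablyZero S.adj S.adj' S.P (𝟙 _ - r.f ≫ (W.coverLink hP ρ).psi.f) := by
  -- The retraction is `toA`, corestricted to the kernel `X` of `κ`.
  obtain ⟨r, hr⟩ := W.exists_lift _ (W.toA_κ hP ρ)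
  have hι : Mono W.ι := W.exact.mono_f
  have := W.mono_h
  have := S.adj.rightAdjoint_preservesLimits
  have := S.adj'.rightAdjoint_preservesLimits
  let r' : (W.cover hP ρ).Psi ⟶ W.X :=
    { f := r
      comm := by
        -- Right adjoints preserve monomorphisms, so compatibility may be tested after `ι` and `h`.
        -- There `toA_tr_j` computes one side and `δ_toA` the other.
        rw [← cancel_mono (S.H'.map (S.H.map W.ι)), ← cancel_mono (S.H'.map W.h), Category.assoc,
          Category.assoc, ← S.H'.map_comp, ← W.ι_tr_j, reassoc_of% hr, toA_tr_j,
          Category.assoc ((W.cover hP ρ).Psi.δ), ← S.H'.map_comp (S.H.map r), ← S.H.map_comp, hr, δ_toA, Category.assoc, ← S.H'.map_comp] }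
  -- The canonical link uses only the summand `H A` of the cover, so its morphism to `Psi` has no
  -- component in `P`.
  have hm : (W.coverLink hP ρ).psi.f ≫ W.toP hP ρ = 0 := by
    have := S.isIso_un' (S.P_le _ hP)
    rw [← cancel_mono (un S.adj' P), Category.assoc, toP_un, reassoc_of% Link.psi_b, ← S.H'.map_comp,
      Category.assoc]
    have : S.H.map W.ι ≫ W.inlC hP ρ ≫ W.sndC hP ρ = 0 := by rw [inl_sndC, comp_zero]
    exact (congrArg (fun z => W.X.δ ≫ S.H'.map z) this).trans (by simp)
  have hma : (W.coverLink hP ρ).psi.f ≫ (W.cover hP ρ).a = W.ι ≫ W.mateC hP ρ := Link.psi_a _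
  refine ⟨r', ?_, ?_⟩
  · ext
    rw [← cancel_mono W.ι, RepObj.comp_f, RepObj.id_f, Category.id_comp, Category.assoc]
    refine (congrArg _ hr).trans ?_
    rw [toA, Preadditive.comp_sub, reassoc_of% hma, reassoc_of% hm, zero_comp, sub_zero,
      mate_fst_cu, Category.comp_id]
  · have hF := S.enoughC.free_mem P hP
    have hp : un S.adj' P ≫ S.H'.map (W.inrC hP ρ ≫ W.πC hP ρ) =
        ρ ≫ W.mateC hP ρ ≫ S.L.map (W.fstC hP ρ) ≫ cu S.adj W.A ≫ tr S.adj' W.j := by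
      rw [inr_πC, un_map, tr_map_comp, reassoc_of% mate_fst_cu]
    -- The defect of `r` from being a two-sided inverse is carried by the summand `L' P` of the
    -- cover and by `P` itself, that is, by the free object on `P`. The map `p` places its
    -- generators in `Psi`.
    let p : P ⟶ (W.cover hP ρ).Psi.X := Covered.psiLift (un S.adj' P ≫ S.H'.map (W.inrC hP ρ))
      (ρ ≫ W.mateC hP ρ) (by
        rw [trs_cover]
        refine Eq.trans ?_ (hp.trans (Category.assoc _ _ _).symm)
        rw [S.H'.map_comp, Category.assoc]
        rfl)
    have hpa : p ≫ (W.cover hP ρ).a = ρ ≫ W.mateC hP ρ := Covered.lift_a _ _ _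
    have hpb : p ≫ (W.cover hP ρ).b = un S.adj' P ≫ S.H'.map (W.inrC hP ρ) := Covered.lift_b _ _ _
    let x : (W.cover hP ρ).Psi ⟶ RepObj.free S.adj S.adj' P hF := RepObj.freeLift hF (W.toP hP ρ)
      ((W.cover hP ρ).a ≫ S.L.map (W.sndC hP ρ)) (W.δ_toP hP ρ) (by
        rw [← un_map, reassoc_of% toP_un, ← S.H'.map_comp, S.H.map_comp, S.H'.map_comp (S.H.map _),
          reassoc_of% Covered.δ_a, ← S.H'.map_comp, un_naturality])
    refine ⟨P, hF, hP, x, RepObj.freeDesc hF p, ?_⟩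
    refine congrArg RepObj.Hom.f (?_ : 𝟙 _ - r' ≫ (W.coverLink hP ρ).psi = x ≫ RepObj.freeDesc hF p)
    refine Covered.psi_hom_ext ?_
    have h₁ : r ≫ (W.coverLink hP ρ).psi.f ≫ (W.cover hP ρ).a = W.toA hP ρ ≫ W.mateC hP ρ := by
      rw [hma, reassoc_of% hr]
    have h₂ : x.f ≫ (RepObj.freeDesc (adj := S.adj) (adj' := S.adj') hF p).f ≫ (W.cover hP ρ).a =
        W.toP hP ρ ≫ ρ ≫ W.mateC hP ρ +
          (W.cover hP ρ).a ≫ S.L.map (W.sndC hP ρ ≫ W.inrC hP ρ) := by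
      rw [RepObj.freeLift_f, Preadditive.add_comp, Category.assoc, Category.assoc, Category.assoc,
        reassoc_of% RepObj.freeInl_desc, reassoc_of% RepObj.freeInr_desc, hpa, ← trs_comp_map,
        ← trs_comp_map, Category.assoc, Covered.δ_a, reassoc_of% hpb, ← S.H'.map_comp, un_map,
        trs_tr, trs_comp_un, S.L.map_comp]
    rw [RepObj.sub_f, RepObj.comp_f, RepObj.id_f, RepObj.comp_f, Preadditive.sub_comp,
      Category.assoc, Category.assoc, h₂, Category.id_comp]
    refine (congrArg ((W.cover hP ρ).a - ·) h₁).trans ?_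
    have h₃ : (W.cover hP ρ).a = (W.cover hP ρ).a ≫ S.L.map (W.fstC hP ρ ≫ W.inlC hP ρ) +
        (W.cover hP ρ).a ≫ S.L.map (W.sndC hP ρ ≫ W.inrC hP ρ) := by
      rw [← Preadditive.comp_add, ← S.L.map_add, totalC, S.L.map_id, Category.comp_id]
    rw [toA, Preadditive.sub_comp, Category.assoc, Category.assoc, cu_mate, ← S.L.map_comp,
      Category.assoc]
    nth_rw 1 [h₃]
    abel

end Enveloped

end CounterSystem

end CanonicalCover

/-! ### The canonical preenvelope of `Ψ`. -/

section CanonicalEnvelope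

universe v₁ v₂ u₁ u₂

open Limits

namespace CounterSystem

variable {C : Type u₁} [Category.{v₁} C] [Abelian C] {D : Type u₂} [Category.{v₂} D] [Abelian D]
  {S : CounterSystem C D}

/-- A covered object whose covering map is a special precover, with an embedding of the cover in
an object `L' (L Q)` with `Q` projective. -/
structure Embedded (V : S.Covered) where
  K : D
  k : K ⟶ V.G
  w : k ≫ V.π = 0
  exact : (ShortComplex.mk k V.π w).ShortExact
  memK : S.K K
  Q : D
  memQ : S.Q Q
  g : V.G ⟶ S.L'.obj (S.L.obj Q)
  mono_g : Mono g

namespace Embedded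

variable {V : S.Covered} (U : Embedded V)

theorem mono_lift_g : Mono (biprod.lift V.π U.g) := by
  have := U.mono_g
  have : Mono (biprod.lift V.π U.g ≫ biprod.snd) := by rwa [biprod.lift_snd]
  exact mono_of_mono _ biprod.snd

/-- The pushout of the precover along the embedding. -/
def K₁ : D := cokernel (biprod.lift V.π U.g)

/-- The projection to the pushout. -/
def proj : V.Y.X ⊞ S.L'.obj (S.L.obj U.Q) ⟶ U.K₁ := cokernel.π (biprod.lift V.π U.g)

theorem lift_proj : biprod.lift V.π U.g ≫ U.proj = 0 := cokernel.condition _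

theorem epi_proj : Epi U.proj := inferInstanceAs (Epi (cokernel.π (biprod.lift V.π U.g)))

/-- The map from `L' (L Q)` to the pushout. -/
def q : S.L'.obj (S.L.obj U.Q) ⟶ U.K₁ := biprod.inr ≫ U.proj

/-- The map from `Y` to the pushout. -/
def y : V.Y.X ⟶ U.K₁ := -(biprod.inl ≫ U.proj)

theorem lift_proj_eq {Z : D} (u : Z ⟶ V.Y.X) (v : Z ⟶ S.L'.obj (S.L.obj U.Q)) :
    biprod.lift u v ≫ U.proj = v ≫ U.q - u ≫ U.y := by
  rw [biprod.lift_eq, Preadditive.add_comp, Category.assoc, Category.assoc, y, q,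
    Preadditive.comp_neg, sub_neg_eq_add, add_comm]

theorem π_y : V.π ≫ U.y = U.g ≫ U.q :=
  (sub_eq_zero.1 ((U.lift_proj_eq _ _).symm.trans U.lift_proj)).symm

/-- Since `g` is monic, `G` is the kernel of the projection from the biproduct to `K₁`; so the
pushout square is also a pullback. -/
theorem exists_lift {Z : D} (u : Z ⟶ V.Y.X) (v : Z ⟶ S.L'.obj (S.L.obj U.Q))
    (e : u ≫ U.y = v ≫ U.q) : ∃ f : Z ⟶ V.G, f ≫ V.π = u ∧ f ≫ U.g = v := by
  have := U.mono_lift_g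
  have hs := shortExact_cokernel (biprod.lift V.π U.g)
  have e' : biprod.lift u v ≫ U.proj = 0 := by rw [lift_proj_eq, e, sub_self]
  obtain ⟨f, hf⟩ : ∃ f : Z ⟶ V.G, f ≫ biprod.lift V.π U.g = biprod.lift u v :=
    ⟨hs.exact.lift _ e', hs.exact.lift_f _ e'⟩
  refine ⟨f, ?_, ?_⟩
  · simpa using hf =≫ biprod.fst
  · simpa using hf =≫ biprod.snd

include U in
theorem epi_π : Epi V.π := U.exact.epi_g

theorem epi_q : Epi U.q := by
  have := U.epi_π
  have := U.epi_proj
  refine Preadditive.epi_of_cancel_zero _ fun {Z} f hf => ?_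
  have hy : U.y ≫ f = 0 := by
    rw [← cancel_epi V.π, reassoc_of% U.π_y, hf, comp_zero, comp_zero]
  rw [← cancel_epi U.proj, comp_zero]
  refine biprod.hom_ext' _ _ ?_ ?_
  · rw [y, Preadditive.neg_comp, neg_eq_zero, Category.assoc] at hy
    rw [comp_zero, hy]
  · rw [q, Category.assoc] at hf
    rw [comp_zero, hf]

theorem comp_q : (U.k ≫ U.g) ≫ U.q = 0 := by
  rw [Category.assoc, ← π_y, reassoc_of% U.w, zero_comp]

/-- Pushing out the epimorphism `π` along `g` keeps its kernel `K`. As `K` and `L' L Q` lie in the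
class `K`, closed under cokernels of monomorphisms, so does the pushout. -/
theorem shortExact_q : (ShortComplex.mk (U.k ≫ U.g) U.q U.comp_q).ShortExact := by
  have := U.epi_q
  have := U.epi_π
  have := U.exact.mono_f
  have : Mono U.k := this
  have := U.mono_g
  have hm : Mono (U.k ≫ U.g) := mono_comp _ _
  refine { exact := ShortComplex.exact_of_g_is_cokernel _ (CokernelCofork.IsColimit.ofπ' _ _
    fun {Z} (f : S.L'.obj (S.L.obj U.Q) ⟶ Z) (hf : (U.k ≫ U.g) ≫ f = 0) => ?_) }
  rw [Category.assoc] at hf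
  let y' : V.Y.X ⟶ Z := U.exact.exact.desc (U.g ≫ f) hf
  have hy' : V.π ≫ y' = U.g ≫ f := U.exact.exact.g_desc _ hf
  let d : U.K₁ ⟶ Z := cokernel.desc _ (biprod.desc (-y') f) (by
    rw [biprod.lift_desc, Preadditive.comp_neg, hy', neg_add_cancel])
  have hd : U.q ≫ d = f := by
    have e : U.proj ≫ d = biprod.desc (-y') f := cokernel.π_desc _ _ _
    rw [q, Category.assoc, e, biprod.inr_desc]
  exact ⟨d, hd⟩

theorem memJ : S.K (S.L'.obj (S.L.obj U.Q)) := S.B_L' (S.Q_L U.memQ)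

theorem memK₁ : S.K U.K₁ := S.K_cokernel U.shortExact_q U.memK U.memJ

theorem epi_map_q : Epi (S.H'.map U.q) := epi_map_H' U.shortExact_q U.memK (S.K_le _ U.memK₁)

/-- The component `Ψ ⟶ L Q`. -/
def toL : V.Psi.X ⟶ S.L.obj U.Q :=
  haveI := S.isIso_un' (S.Q_L U.memQ)
  V.b ≫ S.H'.map U.g ≫ inv (un S.adj' _)

theorem toL_un : U.toL ≫ un S.adj' _ = V.b ≫ S.H'.map U.g := by
  simp [toL]

theorem δ_toL : V.Psi.δ ≫ S.H'.map (S.H.map U.toL) = 0 := by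
  rw [toL, S.H.map_comp, S.H'.map_comp, reassoc_of% V.δ_b, zero_comp]

theorem envelope_w : biprod.lift V.a U.toL ≫
    biprod.desc (-(trs S.adj (V.π ≫ V.Y.δ) ≫ S.H'.map U.y)) (un S.adj' _ ≫ S.H'.map U.q) = 0 := by
  rw [biprod.lift_desc, reassoc_of% U.toL_un, Preadditive.comp_neg, ← reassoc_of% V.b_map_π,
    ← S.H'.map_comp, ← S.H'.map_comp, U.π_y, neg_add_cancel]

/-- The unit identifies `L Q` with `H' L' L Q`, and `H'` preserves the pullback square that defines
`G`. Hence a pair in `L G` and `L Q` killed by the second map determines a component in `H' G`,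
which is all that a map to `Psi` needs. Surjectivity comes from `H' q`, an epimorphism since its
kernel datum lies in `K`. -/
theorem shortExact_envelope : (ShortComplex.mk _ _ U.envelope_w).ShortExact := by
  have := S.isIso_un' (S.Q_L U.memQ)
  have := U.epi_map_q
  have := U.mono_g
  have := S.adj'.rightAdjoint_preservesLimits
  have hm : Mono (biprod.lift V.a U.toL) := by
    refine Preadditive.mono_of_cancel_zero _ fun {Z} f hf => ?_
    have h₁ : f ≫ V.a = 0 := by simpa using hf =≫ biprod.fst
    have h₂ : f ≫ U.toL = 0 := by simpa using hf =≫ biprod.snd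
    refine Covered.psi_ext ?_ ?_
    · rw [zero_comp, ← cancel_mono (S.H'.map U.g), Category.assoc, ← toL_un, reassoc_of% h₂,
        zero_comp, zero_comp]
    · rw [zero_comp, h₁]
  have he : Epi (biprod.desc (-(trs S.adj (V.π ≫ V.Y.δ) ≫ S.H'.map U.y))
      (un S.adj' _ ≫ S.H'.map U.q)) := by
    have : Epi (biprod.inr ≫ biprod.desc (-(trs S.adj (V.π ≫ V.Y.δ) ≫ S.H'.map U.y))
      (un S.adj' _ ≫ S.H'.map U.q)) := by
      rw [biprod.inr_desc]
      exact epi_comp _ _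
    exact epi_of_epi biprod.inr _
  refine { exact := ShortComplex.exact_of_f_is_kernel _ (KernelFork.IsLimit.ofι' _ _
    fun {Z} (f : Z ⟶ S.L.obj V.G ⊞ S.L.obj U.Q) (hf : f ≫ biprod.desc
      (-(trs S.adj (V.π ≫ V.Y.δ) ≫ S.H'.map U.y)) (un S.adj' _ ≫ S.H'.map U.q) = 0) => ?_) }
  have e : (f ≫ biprod.fst) ≫ trs S.adj (V.π ≫ V.Y.δ) ≫ S.H'.map U.y =
      (f ≫ biprod.snd) ≫ un S.adj' _ ≫ S.H'.map U.q := by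
    rw [biprod.desc_eq, Preadditive.comp_add, Preadditive.comp_neg, Preadditive.comp_neg] at hf
    rw [Category.assoc, Category.assoc]
    exact (neg_add_eq_zero.1 hf)
  -- The relation `e` is transposed along `L' ⊣ H'`, where the pullback property of `G` applies
  -- directly.
  let l := U.exists_lift (trs S.adj' ((f ≫ biprod.fst) ≫ trs S.adj (V.π ≫ V.Y.δ)))
    (trs S.adj' ((f ≫ biprod.snd) ≫ un S.adj' _))
    (by rw [← trs_comp_map, ← trs_comp_map, Category.assoc (f ≫ _), Category.assoc (f ≫ _), e])
  let b' := tr S.adj' l.choose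
  have h₁ : b' ≫ S.H'.map V.π = (f ≫ biprod.fst) ≫ trs S.adj (V.π ≫ V.Y.δ) := by
    rw [← tr_comp, l.choose_spec.1, tr_trs]
  have h₂ : b' ≫ S.H'.map U.g = (f ≫ biprod.snd) ≫ un S.adj' _ := by
    rw [← tr_comp, l.choose_spec.2, tr_trs]
  let d : Z ⟶ V.Psi.X := Covered.psiLift b' (f ≫ biprod.fst) h₁
  have hd : d ≫ biprod.lift V.a U.toL = f := by
    refine biprod.hom_ext _ _ ?_ ?_
    · rw [Category.assoc, biprod.lift_fst]
      exact Covered.lift_a _ _ _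
    · rw [Category.assoc, biprod.lift_snd, ← cancel_mono (un S.adj' _), Category.assoc, toL_un, ← h₂,
        ← Category.assoc]
      exact congrArg (· ≫ _) (Covered.lift_b _ _ _)
  exact ⟨d, hd⟩

/-- The object `Ψ` with its preenvelope `L G ⊞ L Q`. -/
def env : S.Enveloped where
  X := V.Psi
  A := S.L.obj V.G ⊞ S.L.obj U.Q
  B := S.H'.obj U.K₁
  ι := _
  κ := _
  w := U.envelope_w
  exact := U.shortExact_envelope
  memA := S.A_biprod (S.G_L V.memG) (S.G_L (S.Q_le _ U.memQ))
  memB := S.K_H' U.memK₁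

/-- The inclusion of `L G` in the envelope. -/
def inlE : S.L.obj V.G ⟶ U.env.A := biprod.inl (X := S.L.obj V.G) (Y := S.L.obj U.Q)

/-- The inclusion of `L Q` in the envelope. -/
def inrE : S.L.obj U.Q ⟶ U.env.A := biprod.inr (X := S.L.obj V.G) (Y := S.L.obj U.Q)

/-- The projection of the envelope to `L G`. -/
def fstE : U.env.A ⟶ S.L.obj V.G := biprod.fst (X := S.L.obj V.G) (Y := S.L.obj U.Q)

/-- The projection of the envelope to `L Q`. -/
def sndE : U.env.A ⟶ S.L.obj U.Q := biprod.snd (X := S.L.obj V.G) (Y := S.L.obj U.Q)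

/-- The projection to `H' G`. -/
def b : U.env.X.X ⟶ S.H'.obj V.G := V.b

theorem inl_fstE : U.inlE ≫ U.fstE = 𝟙 _ := biprod.inl_fst

theorem inr_fstE : U.inrE ≫ U.fstE = 0 := biprod.inr_fst

theorem totalE : U.fstE ≫ U.inlE + U.sndE ≫ U.inrE = 𝟙 _ := biprod.total

theorem ι_snd_un : U.env.ι ≫ U.sndE ≫ un S.adj' _ = U.b ≫ S.H'.map U.g := by
  have : biprod.lift V.a U.toL ≫ biprod.snd ≫ un S.adj' _ = V.b ≫ S.H'.map U.g := by
    rw [biprod.lift_snd_assoc, toL_un]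
  exact this

theorem ι_fst_trs : (U.env.ι ≫ U.fstE) ≫ trs S.adj (V.π ≫ V.Y.δ) = U.b ≫ S.H'.map V.π := by
  have : (biprod.lift V.a U.toL ≫ biprod.fst) ≫ trs S.adj (V.π ≫ V.Y.δ) = V.b ≫ S.H'.map V.π := by
    rw [biprod.lift_fst, V.b_map_π]
  exact this

theorem δ_ι_snd : U.env.X.δ ≫ S.H'.map (S.H.map (U.env.ι ≫ U.sndE)) = 0 := by
  have : V.Psi.δ ≫ S.H'.map (S.H.map (biprod.lift V.a U.toL ≫ biprod.snd)) = 0 := by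
    rw [biprod.lift_snd, δ_toL]
  exact this

theorem δ_ι_fst : U.env.X.δ ≫ S.H'.map (S.H.map (U.env.ι ≫ U.fstE)) =
    U.b ≫ S.H'.map (un S.adj V.G) := by
  have : V.Psi.δ ≫ S.H'.map (S.H.map (biprod.lift V.a U.toL ≫ biprod.fst)) =
      V.b ≫ S.H'.map (un S.adj V.G) := by
    rw [biprod.lift_fst, V.δ_a]
  exact this

/-- This projection is a pullback of `H' π`, which is epi because the kernel of `π` lies in `K`. -/
theorem epi_ι_fst : Epi (U.env.ι ≫ U.fstE) := by
  have : Epi (S.H'.map V.π) := epi_map_H' U.exact U.memK V.Y.mem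
  have h : Epi V.a :=
    inferInstanceAs (Epi (pullback.snd (S.H'.map V.π) (trs S.adj (V.π ≫ V.Y.δ))))
  have h' : Epi (biprod.lift V.a U.toL ≫ biprod.fst) := by rwa [biprod.lift_fst]
  exact h'

theorem ι_total : U.env.ι = (U.env.ι ≫ U.fstE) ≫ U.inlE + (U.env.ι ≫ U.sndE) ≫ U.inrE := by
  rw [Category.assoc, Category.assoc, ← Preadditive.comp_add, totalE, Category.comp_id]

theorem δ_ι : U.env.X.δ ≫ S.H'.map (S.H.map U.env.ι) =
    U.b ≫ S.H'.map (un S.adj V.G ≫ S.H.map U.inlE) := by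
  rw [U.ι_total, S.H.map_add, S.H'.map_add, S.H.map_comp _ U.inlE, S.H.map_comp _ U.inrE,
    S.H'.map_comp _ (S.H.map U.inlE), S.H'.map_comp _ (S.H.map U.inrE), Preadditive.comp_add,
    reassoc_of% δ_ι_fst, reassoc_of% δ_ι_snd, zero_comp, add_zero, S.H'.map_comp]

/-- The right mate of the projection of the envelope to `L G`. -/
def mateE : S.H.obj U.env.A ⟶ V.G :=
  haveI := S.isIso_un V.memG
  S.H.map U.fstE ≫ inv (un S.adj V.G)

theorem mateE_un : U.mateE ≫ un S.adj V.G = S.H.map U.fstE := by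
  simp [mateE]

theorem un_inl_mateE : un S.adj V.G ≫ S.H.map U.inlE ≫ U.mateE = 𝟙 _ := by
  have := S.isIso_un V.memG
  rw [← cancel_mono (un S.adj V.G), Category.assoc, Category.assoc, mateE_un, ← S.H.map_comp,
    inl_fstE, S.H.map_id, Category.comp_id, Category.id_comp]

theorem δ_ι_mateE {Z : D} (z : V.G ⟶ Z) :
    U.env.X.δ ≫ S.H'.map (S.H.map U.env.ι ≫ U.mateE ≫ z) = U.b ≫ S.H'.map z := by
  rw [S.H'.map_comp, reassoc_of% δ_ι, ← S.H'.map_comp, Category.assoc, reassoc_of% un_inl_mateE]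

/-- The canonical link from the envelope. -/
def envLink : Link U.env V where
  a := U.fstE
  c := U.mateE
  mate := U.mateE_un
  compat := by rw [δ_ι_mateE, ← Category.assoc, ι_fst_trs]

/-- The map `G ⟶ Φ` that factors through `Y`. -/
def toPhi : V.G ⟶ U.env.Phi.X :=
  un S.adj V.G ≫ S.H.map U.inlE ≫ U.env.h - U.g ≫ S.L'.map U.inrE ≫ U.env.j

/-- The counit identifies `K` with `L' H' K`. The map `H' K ⟶ Psi` with components `H' k` and `0`,
composed with the pushout relation of `Phi`, shows that the two terms of `toPhi` agree on `K`. -/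
theorem k_toPhi : U.k ≫ U.toPhi = 0 := by
  have := S.isIso_cu' U.memK
  have := S.isIso_un' (S.Q_L U.memQ)
  obtain ⟨z, hza, hzb⟩ : ∃ z : S.H'.obj U.K ⟶ U.env.X.X, z ≫ U.env.ι ≫ U.fstE = 0 ∧
      z ≫ U.b = S.H'.map U.k := by
    let z : S.H'.obj U.K ⟶ V.Psi.X := Covered.psiLift (S.H'.map U.k) 0
      (by rw [← S.H'.map_comp, U.w, zero_comp, S.H'.map_zero])
    have ha : z ≫ biprod.lift V.a U.toL ≫ biprod.fst = 0 := by
      rw [biprod.lift_fst]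
      exact Covered.lift_a _ _ _
    exact ⟨z, ha, Covered.lift_b _ _ _⟩
  have h₁ : z ≫ U.env.ι = (S.H'.map (U.k ≫ U.g) ≫ inv (un S.adj' _)) ≫ U.inrE := by
    rw [U.ι_total, Preadditive.comp_add, ← Category.assoc z (_ ≫ U.fstE), hza, zero_comp, zero_add,
      ← Category.assoc]
    congr 1
    rw [← cancel_mono (un S.adj' _), Category.assoc, Category.assoc, ι_snd_un, reassoc_of% hzb,
      Category.assoc, IsIso.inv_hom_id, Category.comp_id, S.H'.map_comp]
  have h₂ : S.L'.map (S.H'.map (U.k ≫ U.g) ≫ inv (un S.adj' _)) =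
      cu S.adj' U.K ≫ U.k ≫ U.g := by
    rw [← trs_comp_un S.adj', Category.assoc, IsIso.inv_hom_id, Category.comp_id, trs_map]
  have h₃ : cu S.adj' U.K ≫ U.k ≫ U.g ≫ S.L'.map U.inrE ≫ U.env.j =
      cu S.adj' U.K ≫ U.k ≫ un S.adj V.G ≫ S.H.map U.inlE ≫ U.env.h := by
    have e : S.L'.map z ≫ S.L'.map U.env.ι ≫ U.env.j =
        S.L'.map z ≫ trs S.adj' U.env.X.δ ≫ S.H.map U.env.ι ≫ U.env.h := by rw [U.env.map_ι_j]
    rw [← S.L'.map_comp_assoc, h₁, S.L'.map_comp, h₂, ← Category.assoc (trs S.adj' _),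
      ← trs_comp_map, δ_ι, ← Category.assoc (S.L'.map z), ← trs_comp, reassoc_of% hzb,
      ← S.H'.map_comp, trs_map] at e
    simpa only [Category.assoc] using e
  rw [← cancel_epi (cu S.adj' U.K), comp_zero, toPhi, Preadditive.comp_sub, Preadditive.comp_sub, h₃,
    sub_self]

/-- This is the transposed pushout relation `ι_tr_j`, with `ι` split into its two components; the
one in `L Q` is what the second term of `toPhi` subtracts. -/
theorem b_toPhi : U.b ≫ S.H'.map U.toPhi = (U.env.ι ≫ U.fstE) ≫ U.inlE ≫ tr S.adj' U.env.j := by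
  have e := U.env.ι_tr_j
  rw [S.H'.map_comp, reassoc_of% δ_ι, ← S.H'.map_comp] at e
  nth_rw 1 [U.ι_total] at e
  have e' : (U.env.ι ≫ U.sndE) ≫ U.inrE ≫ tr S.adj' U.env.j =
      U.b ≫ S.H'.map (U.g ≫ S.L'.map U.inrE ≫ U.env.j) := by
    rw [← tr_map_comp, ← un_map, Category.assoc, reassoc_of% ι_snd_un, ← S.H'.map_comp]
  rw [Preadditive.add_comp, Category.assoc, Category.assoc (U.env.ι ≫ U.sndE), e',
    Category.assoc (un _ _)] at e
  rw [toPhi, S.H'.map_sub, Preadditive.comp_sub, ← e, add_sub_cancel_right]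

/-- The stable inverse `Y ⟶ Φ` of the morphism of the canonical link. -/
theorem exists_section : ∃ r : V.Y ⟶ U.env.Phi,
    r ≫ U.envLink.phi = 𝟙 _ ∧
    RepObj.StablyZero S.adj' S.adj S.Q (𝟙 _ - U.envLink.phi.f ≫ r.f) := by
  have hπ := U.epi_π
  have hQ := S.isIso_un (S.Q_le _ U.memQ)
  -- The section is `toPhi`, which descends to `Y` because it kills the kernel of `π`.
  obtain ⟨r, hr⟩ : ∃ r : V.Y.X ⟶ U.env.Phi.X, V.π ≫ r = U.toPhi :=
    ⟨U.exact.exact.desc _ U.k_toPhi, U.exact.exact.g_desc _ U.k_toPhi⟩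
  -- Tested on the epimorphism `Psi ⟶ L G`; this is what makes `r` compatible with the structure
  -- maps.
  have hr' : trs S.adj (V.π ≫ V.Y.δ) ≫ S.H'.map r = U.inlE ≫ tr S.adj' U.env.j := by
    have := U.epi_ι_fst
    rw [← cancel_epi (U.env.ι ≫ U.fstE), ← b_toPhi, ← Category.assoc, ι_fst_trs, Category.assoc,
      ← S.H'.map_comp, hr]
  let r' : V.Y ⟶ U.env.Phi :=
    { f := r
      comm := by
        have e : V.π ≫ V.Y.δ = un S.adj V.G ≫ S.H.map (trs S.adj (V.π ≫ V.Y.δ)) := by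
          rw [un_map, tr_trs]
        rw [← cancel_epi V.π, reassoc_of% hr, reassoc_of% e, ← S.H.map_comp, hr', toPhi,
          Preadditive.sub_comp, Category.assoc, Category.assoc, Category.assoc, Category.assoc,
          U.env.h_δ, U.env.j_δ, comp_zero, comp_zero, sub_zero, S.H.map_comp] }
  have hh : U.env.h ≫ U.envLink.phi.f = U.mateE ≫ V.π := U.envLink.h_phi
  have hj : U.env.j ≫ U.envLink.phi.f = trs S.adj' (U.fstE ≫ trs S.adj (V.π ≫ V.Y.δ)) :=
    U.envLink.j_phi
  refine ⟨r', ?_, ?_⟩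
  · ext
    rw [← cancel_epi V.π]
    have : V.π ≫ r ≫ U.envLink.phi.f = V.π := by
      rw [reassoc_of% hr, toPhi, Preadditive.sub_comp, Category.assoc, Category.assoc,
        Category.assoc, Category.assoc, hh, hj, ← trs_comp, reassoc_of% inr_fstE, zero_comp,
        trs_zero, comp_zero, sub_zero, reassoc_of% un_inl_mateE]
    exact this.trans (Category.comp_id _).symm
  · have hF := S.enoughD.free_mem U.Q U.memQ
    let x₀ : U.env.Phi.X ⟶ U.Q := Enveloped.phiDesc 0 (S.H.map U.sndE ≫ inv (un S.adj U.Q)) (by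
      rw [comp_zero, ← S.H.map_comp_assoc, ← Category.assoc, ← trs_comp_map, δ_ι_snd, trs_zero,
        zero_comp])
    let x₁ : U.env.Phi.X ⟶ S.L'.obj (S.L.obj U.Q) :=
      Enveloped.phiDesc (S.L'.map U.sndE) (U.mateE ≫ U.g) (by
        refine tr_injective S.adj' ?_
        rw [← S.L'.map_comp, tr_map, Category.assoc, ι_snd_un, tr_comp, tr_trs, δ_ι_mateE])
    have hj₀ : U.env.j ≫ x₀ = 0 := Enveloped.j_desc _ _ _
    have hh₀ : U.env.h ≫ x₀ = S.H.map U.sndE ≫ inv (un S.adj U.Q) := Enveloped.h_desc _ _ _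
    have hj₁ : U.env.j ≫ x₁ = S.L'.map U.sndE := Enveloped.j_desc _ _ _
    have hh₁ : U.env.h ≫ x₁ = U.mateE ≫ U.g := Enveloped.h_desc _ _ _
    let n : U.env.Phi ⟶ RepObj.free S.adj' S.adj U.Q hF := RepObj.freeLift hF x₀ x₁
      (by
        refine Enveloped.phi_ext ?_ ?_
        · rw [reassoc_of% U.env.j_δ, zero_comp, comp_zero]
        · rw [reassoc_of% U.env.h_δ, ← S.H.map_comp, ← tr_comp, hj₀, tr_zero, S.H.map_zero,
            comp_zero])
      (by
        refine Enveloped.phi_ext ?_ ?_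
        · rw [reassoc_of% U.env.j_δ, zero_comp, reassoc_of% hj₀, zero_comp]
        · rw [reassoc_of% U.env.h_δ, ← S.H.map_comp, ← tr_comp, hj₁, tr_map, reassoc_of% hh₀,
            ← un_map, IsIso.inv_hom_id_assoc, S.H.map_comp])
    -- The defect of `r` from being a two-sided inverse comes from the summand `L Q` of the
    -- envelope, and passes through the free object on `Q`.
    let p : U.Q ⟶ U.env.Phi.X := un S.adj U.Q ≫ S.H.map U.inrE ≫ U.env.h
    have hp : trs S.adj' (trs S.adj (p ≫ U.env.Phi.δ)) = S.L'.map U.inrE ≫ U.env.j := by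
      rw [Category.assoc, Category.assoc, U.env.h_δ, ← S.H.map_comp, un_map, trs_tr, ← tr_map_comp,
        trs_tr]
    refine ⟨U.Q, hF, U.memQ, n, RepObj.freeDesc hF p, ?_⟩
    refine congrArg RepObj.Hom.f (?_ : 𝟙 _ - U.envLink.phi ≫ r' = n ≫ RepObj.freeDesc hF p)
    refine Enveloped.phi_hom_ext ?_
    have h₁ : U.env.h ≫ U.envLink.phi.f ≫ r = U.mateE ≫ U.toPhi := by
      rw [reassoc_of% hh, hr]
    have h₂ : U.env.h ≫ n.f ≫ (RepObj.freeDesc (adj := S.adj') (adj' := S.adj) hF p).f =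
        S.H.map (U.sndE ≫ U.inrE) ≫ U.env.h + U.mateE ≫ U.g ≫ S.L'.map U.inrE ≫ U.env.j := by
      rw [RepObj.freeLift_f, Preadditive.add_comp, Preadditive.comp_add, Category.assoc,
        Category.assoc, RepObj.freeInl_desc, RepObj.freeInr_desc, hp, reassoc_of% hh₀,
        reassoc_of% hh₁, IsIso.inv_hom_id_assoc, S.H.map_comp, Category.assoc]
    rw [RepObj.sub_f, RepObj.comp_f, RepObj.id_f, RepObj.comp_f, Preadditive.comp_sub, h₂,
      Category.comp_id]
    refine (congrArg (U.env.h - ·) h₁).trans ?_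
    have h₃ : U.env.h = S.H.map (U.fstE ≫ U.inlE) ≫ U.env.h +
        S.H.map (U.sndE ≫ U.inrE) ≫ U.env.h := by
      rw [← Preadditive.add_comp, ← S.H.map_add, totalE, S.H.map_id, Category.id_comp]
    rw [toPhi, Preadditive.comp_sub, reassoc_of% mateE_un, ← S.H.map_comp_assoc]
    nth_rw 1 [h₃]
    abel

end Embedded

variable (S) in
theorem exists_embedded (Y : S.RepD) : ∃ (V : S.Covered) (_ : V.Y = Y), Nonempty (Embedded V) := by
  obtain ⟨K, G, k, π, w, hs, hK, hG⟩ := S.precover Y.mem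
  obtain ⟨Q, hQ, g, hg⟩ := S.Q_embedding (S.G_le _ hG)
  exact ⟨⟨Y, G, π, hG⟩, rfl, ⟨⟨K, k, w, hs, hK, Q, hQ, g, hg⟩⟩⟩

end CounterSystem

end CanonicalEnvelope

/-! ### Categories obtained as quotients of a common source. -/

section Quotients

open Limits

universe w₁ w₂ w₃ x₁ x₂ x₃

variable {W : Type x₁} [Category.{w₁} W] {X : Type x₂} [Category.{w₂} X] {Y : Type x₃}
  [Category.{w₃} Y]

/-- A full and essentially surjective functor identifies its target with the quotient of its source
by the induced relation on morphisms. -/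
theorem isEquivalence_lift (p : W ⥤ X) [p.Full] [p.EssSurj] {r : HomRel W}
    (h : ∀ (a b : W) (f g : a ⟶ b), r f g ↔ p.map f = p.map g) :
    (CategoryTheory.Quotient.lift r p fun a b f g e => (h a b f g).1 e).IsEquivalence where
  faithful := ⟨by
    rintro ⟨a⟩ ⟨b⟩ ⟨f⟩ ⟨g⟩ e
    exact CategoryTheory.Quotient.sound r ((h a b f g).2 e)⟩
  full := ⟨by
    rintro ⟨a⟩ ⟨b⟩ f
    exact ⟨(CategoryTheory.Quotient.functor r).map (p.preimage f), p.map_preimage f⟩⟩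
  essSurj := ⟨fun x => ⟨⟨p.objPreimage x⟩, ⟨p.objObjPreimageIso x⟩⟩⟩

/-- Two full and essentially surjective functors that identify the same morphisms have equivalent
targets. -/
theorem exists_equivalence_of_map_eq_iff (p : W ⥤ X) (q : W ⥤ Y) [p.Full] [p.EssSurj] [q.Full]
    [q.EssSurj] (h : ∀ {a b : W} (f g : a ⟶ b), p.map f = p.map g ↔ q.map f = q.map g) :
    ∃ F : X ≌ Y, Nonempty (p ⋙ F.functor ≅ q) := by
  have hp := isEquivalence_lift p (r := p.homRel) fun _ _ _ _ => Iff.rfl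
  have hq := isEquivalence_lift q (r := p.homRel) fun _ _ f g => h f g
  let P := (CategoryTheory.Quotient.lift p.homRel p fun _ _ _ _ e => e).asEquivalence
  let Q := (CategoryTheory.Quotient.lift p.homRel q fun _ _ f g e => (h f g).1 e).asEquivalence
  refine ⟨P.symm.trans Q, ⟨?_⟩⟩
  exact (Functor.isoWhiskerRight (CategoryTheory.Quotient.lift.isLift p.homRel p fun _ _ _ _ e => e).symm _) ≪≫
    Functor.associator _ _ _ ≪≫
    Functor.isoWhiskerLeft (CategoryTheory.Quotient.functor p.homRel)
      ((Functor.associator _ _ _).symm ≪≫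
        Functor.isoWhiskerRight P.unitIso.symm Q.functor ≪≫ Functor.leftUnitor _) ≪≫
    CategoryTheory.Quotient.lift.isLift p.homRel q fun _ _ f g e => (h f g).1 e

end Quotients

/-! ### The stable equivalence of a counter system. -/

section StableEquivalence

universe v₁ v₂ u₁ u₂

open Limits

namespace CounterSystem

variable {C : Type u₁} [Category.{v₁} C] [Abelian C] {D : Type u₂} [Category.{v₂} D] [Abelian D]
  {S : CounterSystem C D}

namespace Enveloped

/-- A morphism of objects with preenvelopes. -/
@[ext]
structure Hom (W W' : S.Enveloped) where
  f : W.X ⟶ W'.X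
  α : W.A ⟶ W'.A
  comm : W.ι ≫ α = f.f ≫ W'.ι

instance : Category S.Enveloped where
  Hom := Hom
  id W := { f := 𝟙 _, α := 𝟙 _, comm := by simp }
  comp w w' :=
    { f := w.f ≫ w'.f
      α := w.α ≫ w'.α
      comm := by rw [reassoc_of% w.comm, w'.comm, RepObj.comp_f, Category.assoc] }

theorem comp_α {W W' W'' : S.Enveloped} (w : W ⟶ W') (w' : W' ⟶ W'') :
    (w ≫ w').α = w.α ≫ w'.α := rfl

theorem δ_ι_comm {W W' : S.Enveloped} (w : W ⟶ W') {Z : D} (z : S.H.obj W'.A ⟶ Z) :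
    W.X.δ ≫ S.H'.map (S.H.map W.ι ≫ S.H.map w.α ≫ z) =
      w.f.f ≫ W'.X.δ ≫ S.H'.map (S.H.map W'.ι ≫ z) := by
  rw [reassoc_of% RepObj.hom_comm w.f, ← S.H'.map_comp, ← S.H.map_comp_assoc,
    ← S.H.map_comp_assoc, w.comm]

/-- The morphism `Φ ⟶ Φ'` induced by a morphism of objects with preenvelopes. -/
def phiMap {W W' : S.Enveloped} (w : W ⟶ W') : W.Phi ⟶ W'.Phi :=
  phiHom (S.L'.map w.α ≫ W'.j) (S.H.map w.α ≫ W'.h)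
    (by
      refine tr_injective S.adj' ?_
      rw [tr_map_comp, tr_map_comp, reassoc_of% w.comm, W'.ι_tr_j, tr_comp, tr_trs, δ_ι_comm])
    (by rw [Category.assoc, W'.j_δ, comp_zero])
    (by rw [Category.assoc, W'.h_δ, tr_map_comp, S.H.map_comp])

theorem h_phiMap {W W' : S.Enveloped} (w : W ⟶ W') :
    W.h ≫ (phiMap w).f = S.H.map w.α ≫ W'.h := h_phiHom _ _ _ _ _

variable (S) in
/-- The functor that forgets the preenvelope. -/
def forget : S.Enveloped ⥤ S.RepC where
  obj W := W.X
  map w := w.f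

variable (S) in
/-- The functor `Φ`. -/
def phiFunctor : S.Enveloped ⥤ S.RepD where
  obj W := W.Phi
  map w := phiMap w
  map_id W := by
    refine phi_hom_ext ?_
    rw [h_phiMap, RepObj.id_f, Category.comp_id]
    exact (congrArg (· ≫ W.h) (S.H.map_id _)).trans (Category.id_comp _)
  map_comp w w' := by
    refine phi_hom_ext ?_
    rw [h_phiMap, RepObj.comp_f, reassoc_of% h_phiMap, h_phiMap, comp_α, S.H.map_comp,
      Category.assoc]

theorem exists_hom {W W' : S.Enveloped} (f : W.X ⟶ W'.X) : ∃ w : W ⟶ W', w.f = f := by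
  obtain ⟨α, hα⟩ := W.exists_ext W'.memA (f.f ≫ W'.ι)
  exact ⟨⟨f, α, hα⟩, rfl⟩

variable (S) in
theorem exists_enveloped (X : S.RepC) : ∃ W : S.Enveloped, W.X = X := by
  obtain ⟨A, B, ι, κ, w, hs, hA, hB⟩ := S.preenvelope X.mem
  exact ⟨⟨X, A, B, ι, κ, w, hs, hA, hB⟩, rfl⟩

end Enveloped

namespace Link

variable {W W' : S.Enveloped} {V : S.Covered}

/-- A link precomposed with a morphism of objects with preenvelopes. -/
def precomp (w : W ⟶ W') (m : Link W' V) : Link W V where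
  a := w.α ≫ m.a
  c := S.H.map w.α ≫ m.c
  mate := by rw [Category.assoc, m.mate, S.H.map_comp]
  compat := by
    rw [Category.assoc, reassoc_of% w.comm, m.compat, Category.assoc, Enveloped.δ_ι_comm]

theorem precomp_phi (w : W ⟶ W') (m : Link W' V) :
    (m.precomp w).phi = Enveloped.phiMap w ≫ m.phi := by
  refine Enveloped.phi_hom_ext ?_
  rw [h_phi, RepObj.comp_f, reassoc_of% Enveloped.h_phiMap, h_phi]
  exact Category.assoc _ _ _

theorem precomp_psi (w : W ⟶ W') (m : Link W' V) : (m.precomp w).psi = w.f ≫ m.psi := by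
  refine Covered.psi_hom_ext ?_
  rw [psi_a, RepObj.comp_f, Category.assoc, psi_a, ← reassoc_of% w.comm]
  rfl

end Link

theorem exists_coverLink (W : S.Enveloped) : ∃ (V : S.Covered) (m : Link W V) (s : V.Y ⟶ W.Phi)
    (r : V.Psi ⟶ W.X), V.IsGood ∧ m.phi ≫ s = 𝟙 _ ∧ s ≫ m.phi = 𝟙 _ ∧ m.psi ≫ r = 𝟙 _ ∧
    RepObj.StablyZero S.adj S.adj' S.P (𝟙 _ - r.f ≫ m.psi.f) := by
  obtain ⟨P, hP, ρ, hρ⟩ := S.P_cover (S.A_le _ W.memA)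
  obtain ⟨r, hr, hr'⟩ := W.exists_retraction hP ρ
  refine ⟨W.cover hP ρ, W.coverLink hP ρ, 𝟙 W.Phi, r, W.isGood_cover hP ρ, ?_, ?_, hr, hr'⟩
  · exact (Category.comp_id _).trans (W.coverLink_phi hP ρ)
  · exact (Category.id_comp _).trans (W.coverLink_phi hP ρ)

namespace Enveloped

/-- Precompose the canonical link of `W'` with `w` and with `w'` and subtract. The two morphisms of
the resulting link are the two differences in question, up to the canonical morphisms, which have
one-sided inverses. -/
theorem stablyZero_iff {W W' : S.Enveloped} (w w' : W ⟶ W') :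
    RepObj.StablyZero S.adj S.adj' S.P (w.f - w'.f).f ↔
      RepObj.StablyZero S.adj' S.adj S.Q (phiMap w - phiMap w').f := by
  obtain ⟨V, m, s, r, hV, hms, -, hr, -⟩ := exists_coverLink W'
  let n := (m.precomp w).sub (m.precomp w')
  have h₁ : n.phi.f = (phiMap w - phiMap w').f ≫ m.phi.f := by
    rw [Link.phi_sub, Link.precomp_phi, Link.precomp_phi, RepObj.sub_f, RepObj.sub_f, RepObj.comp_f,
      RepObj.comp_f, Preadditive.sub_comp]
  have h₂ : n.psi.f = (w.f - w'.f).f ≫ m.psi.f := by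
    rw [Link.psi_sub, Link.precomp_psi, Link.precomp_psi, RepObj.sub_f, RepObj.sub_f, RepObj.comp_f,
      RepObj.comp_f, Preadditive.sub_comp]
  replace hms := congrArg RepObj.Hom.f hms
  replace hr := congrArg RepObj.Hom.f hr
  rw [RepObj.comp_f, RepObj.id_f] at hms hr
  constructor
  · intro h
    have := (n.stablyZero_phi (h₂ ▸ h.comp m.psi)).comp s
    rwa [h₁, Category.assoc, hms, Category.comp_id] at this
  · intro h
    have := (n.stablyZero_psi hV (h₁ ▸ h.comp m.phi)).comp r
    rwa [h₂, Category.assoc, hr, Category.comp_id] at this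

/-- Represent `y` by a link `n` to the canonical cover of `Φ(W')`. Its other morphism, followed by
the retraction onto `X'`, gives `w`. The link `n` and the canonical link precomposed with `w` have
stably equal `ψ`, hence stably equal `φ`. -/
theorem exists_stablyZero_sub {W W' : S.Enveloped} (y : W.Phi ⟶ W'.Phi) :
    ∃ w : W ⟶ W', RepObj.StablyZero S.adj' S.adj S.Q (phiMap w - y).f := by
  obtain ⟨V, m, s, r, hV, hms, hsm, hr, hr'⟩ := exists_coverLink W'
  obtain ⟨n, hn⟩ := Link.exists_phi_eq hV (y ≫ m.phi)
  obtain ⟨w, hw⟩ := exists_hom (n.psi ≫ r)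
  have h : RepObj.StablyZero S.adj S.adj' S.P (n.sub (m.precomp w)).psi.f := by
    have := hr'.precomp n.psi
    rwa [Preadditive.comp_sub, Category.comp_id, ← Category.assoc, ← RepObj.comp_f, ← RepObj.comp_f,
      ← hw, ← Link.precomp_psi, ← RepObj.sub_f, ← Link.psi_sub] at this
  refine ⟨w, ?_⟩
  -- Subtracting twice negates the map, which puts the difference in the order `phiMap w - y`.
  have h' := (S.enoughD.sub (S.enoughD.sub (Link.stablyZero_phi _ h) (Link.stablyZero_phi _ h))
    (Link.stablyZero_phi _ h)).comp s
  rw [sub_self, zero_sub, Link.phi_sub, RepObj.sub_f, neg_sub, hn, Link.precomp_phi,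
    RepObj.comp_f, RepObj.comp_f, ← Preadditive.sub_comp, Category.assoc, ← RepObj.comp_f, hms,
    RepObj.id_f, Category.comp_id] at h'
  exact h'

variable (S) in
theorem exists_stable_inverse (Y : S.RepD) : ∃ (W : S.Enveloped) (f : W.Phi ⟶ Y) (g : Y ⟶ W.Phi),
    g ≫ f = 𝟙 _ ∧ RepObj.StablyZero S.adj' S.adj S.Q (𝟙 _ - f ≫ g : W.Phi ⟶ W.Phi).f := by
  obtain ⟨V, rfl, ⟨U⟩⟩ := S.exists_embedded Y
  obtain ⟨r, hr, hr'⟩ := U.exists_section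
  exact ⟨U.env, U.envLink.phi, r, hr, hr'⟩

end Enveloped

universe w₁ w₂ x₁ x₂

/-- The stable categories of `RepC` and `RepD` are equivalent. -/
theorem exists_stable_equivalence {X : Type x₁} [Category.{w₁} X] {Y : Type x₂} [Category.{w₂} Y]
    (p : S.RepC ⥤ X) (q : S.RepD ⥤ Y) [p.Full] [p.EssSurj] [q.Full] [q.EssSurj]
    (hp : ∀ {a b : S.RepC} (f g : a ⟶ b), p.map f = p.map g ↔
      RepObj.StablyZero S.adj S.adj' S.P (f - g).f)
    (hq : ∀ {a b : S.RepD} (f g : a ⟶ b), q.map f = q.map g ↔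
      RepObj.StablyZero S.adj' S.adj S.Q (f - g).f) :
    ∃ F : X ≌ Y, Nonempty ((Enveloped.forget S ⋙ p) ⋙ F.functor ≅
      Enveloped.phiFunctor S ⋙ q) := by
  have : (Enveloped.forget S ⋙ p).Full := ⟨fun f => by
    obtain ⟨f, rfl⟩ := p.map_surjective f
    obtain ⟨w, hw⟩ := Enveloped.exists_hom f
    exact ⟨w, congrArg p.map hw⟩⟩
  have : (Enveloped.forget S ⋙ p).EssSurj := ⟨fun x => by
    obtain ⟨W, hW⟩ := Enveloped.exists_enveloped S (p.objPreimage x)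
    exact ⟨W, ⟨eqToIso (congrArg p.obj hW) ≪≫ p.objObjPreimageIso x⟩⟩⟩
  have : (Enveloped.phiFunctor S ⋙ q).Full := ⟨fun f => by
    obtain ⟨f, rfl⟩ := q.map_surjective f
    obtain ⟨w, hw⟩ := Enveloped.exists_stablyZero_sub f
    exact ⟨w, (hq _ _).2 hw⟩⟩
  have : (Enveloped.phiFunctor S ⋙ q).EssSurj := ⟨fun y => by
    obtain ⟨W, f, g, h₁, h₂⟩ := Enveloped.exists_stable_inverse S (q.objPreimage y)
    refine ⟨W, ⟨Iso.trans ⟨q.map f, q.map g, ?_, ?_⟩ (q.objObjPreimageIso y)⟩⟩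
    · exact (q.map_comp f g).symm.trans (((hq _ _).2 h₂).symm.trans (q.map_id _))
    · exact (q.map_comp g f).symm.trans ((congrArg q.map h₁).trans (q.map_id _))⟩
  exact exists_equivalence_of_map_eq_iff _ _ fun f g =>
    (hp _ _).trans ((Enveloped.stablyZero_iff f g).trans (hq _ _).symm)

end CounterSystem

end StableEquivalence

/-! ## The adjunction between tensor product and homomorphisms -/

section TensorHom

variable (S R : Type u) [Ring S] [Ring R]

namespace TensorOver

variable {S R} {X V : Type u} [AddCommGroup X] [Module Sᵐᵒᵖ X] [AddCommGroup V] [Module S V]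

theorem add_tmul (x y : X) (v : V) :
    (tmul (x + y) v : TensorOver S X V) = tmul x v + tmul y v := by
  rw [tmul, TensorProduct.add_tmul, map_add]
  rfl

/-- Additive maps out of `X ⊗_S V`. -/
def liftAdd {N : Type u} [AddCommGroup N] (f : X →+ V →+ N)
    (hf : ∀ x (s : S) v, f (op s • x) v = f x (s • v)) : TensorOver S X V →+ N :=
  QuotientAddGroup.lift (balancing S X V)
    (TensorProduct.liftAddHom (R := ℤ) f fun n x v => by rw [map_zsmul, map_zsmul]; rfl) (by
      refine (AddSubgroup.closure_le _).2 ?_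
      rintro _ ⟨x, s, v, rfl⟩
      change _ = _
      rw [map_sub, sub_eq_zero]
      exact hf x s v)

/-- The elements `x ⊗ v` generate `X ⊗_S V`. -/
theorem induction_on {p : TensorOver S X V → Prop} (z : TensorOver S X V) (h₀ : p 0)
    (h₁ : ∀ x v, p (tmul x v)) (h₂ : ∀ a b, p a → p b → p (a + b)) : p z := by
  obtain ⟨w, rfl⟩ := QuotientAddGroup.mk'_surjective (balancing S X V) z
  induction w with
  | zero => exact h₀
  | tmul x v => exact h₁ x v
  | add a b ha hb => exact h₂ _ _ ha hb

end TensorOver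

variable {S R} {V : Type u} [AddCommGroup V] [Module S V] [Module Rᵐᵒᵖ V] [SMulCommClass S Rᵐᵒᵖ V]

/-- The class `x ⊗ v` as an element of the value of the functor `- ⊗_S V`. -/
def tm {X : ModuleCat.{u} Sᵐᵒᵖ} (x : X) (v : V) : (tensorFunctor S R V).obj X :=
  TensorOver.tmul x v

theorem tm_add_left {X : ModuleCat.{u} Sᵐᵒᵖ} (x y : X) (v : V) :
    (tm (x + y) v : (tensorFunctor S R V).obj X) = tm x v + tm y v := TensorOver.add_tmul x y v

theorem tm_add_right {X : ModuleCat.{u} Sᵐᵒᵖ} (x : X) (v w : V) :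
    (tm x (v + w) : (tensorFunctor S R V).obj X) = tm x v + tm x w := TensorOver.tmul_add x v w

theorem tm_smul_left {X : ModuleCat.{u} Sᵐᵒᵖ} (x : X) (s : S) (v : V) :
    (tm (op s • x) v : (tensorFunctor S R V).obj X) = tm x (s • v) := TensorOver.smul_tmul x s v

theorem tm_smul_right {X : ModuleCat.{u} Sᵐᵒᵖ} (x : X) (r : Rᵐᵒᵖ) (v : V) :
    (tm x (r • v) : (tensorFunctor S R V).obj X) = r • tm x v := rfl

theorem tensor_induction {X : ModuleCat.{u} Sᵐᵒᵖ} {p : (tensorFunctor S R V).obj X → Prop}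
    (z : (tensorFunctor S R V).obj X) (h₀ : p 0) (h₁ : ∀ x v, p (tm x v))
    (h₂ : ∀ a b, p a → p b → p (a + b)) : p z :=
  TensorOver.induction_on (S := S) (X := X) (V := V) z h₀ h₁ h₂

theorem tensor_hom_ext {X : ModuleCat.{u} Sᵐᵒᵖ} {M : ModuleCat.{u} Rᵐᵒᵖ}
    {f g : (tensorFunctor S R V).obj X ⟶ M} (h : ∀ x v, f (tm x v) = g (tm x v)) : f = g := by
  ext z
  change f z = g z
  refine tensor_induction (p := fun z => f z = g z) z (by rw [map_zero, map_zero]) h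
    fun a b ha hb => ?_
  rw [map_add, map_add, ha, hb]

/-- The value of an element of `Hom_R(V, M)`. -/
def hv {M : ModuleCat.{u} Rᵐᵒᵖ} (g : (homFunctor S R V).obj M) (v : V) : M :=
  (show HomRight R V M from g) v

/-- An element of `Hom_R(V, M)`. -/
def homMk {M : ModuleCat.{u} Rᵐᵒᵖ} (f : V →ₗ[Rᵐᵒᵖ] M) : (homFunctor S R V).obj M := f

section

variable {M N : ModuleCat.{u} Rᵐᵒᵖ}

theorem hv_ext {f g : (homFunctor S R V).obj M} (h : ∀ v, hv f v = hv g v) : f = g :=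
  HomRight.ext h

@[simp]
theorem hv_zero_left (v : V) : hv (0 : (homFunctor S R V).obj M) v = 0 := rfl

@[simp]
theorem hv_add_left (f g : (homFunctor S R V).obj M) (v : V) : hv (f + g) v = hv f v + hv g v := rfl

@[simp]
theorem hv_zero_right (f : (homFunctor S R V).obj M) : hv f 0 = 0 :=
  map_zero (show V →ₗ[Rᵐᵒᵖ] M from f)

@[simp]
theorem hv_add_right (f : (homFunctor S R V).obj M) (v w : V) : hv f (v + w) = hv f v + hv f w :=
  map_add (show V →ₗ[Rᵐᵒᵖ] M from f) v w

theorem hv_smul_right (f : (homFunctor S R V).obj M) (r : Rᵐᵒᵖ) (v : V) :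
    hv f (r • v) = r • hv f v := map_smul (show V →ₗ[Rᵐᵒᵖ] M from f) r v

theorem hv_op_smul (s : S) (f : (homFunctor S R V).obj M) (v : V) :
    hv (op s • f) v = hv f (s • v) := rfl

end

/-- The additive map `X ⊗_S V → M` attached to a linear map `X ⟶ Hom_R(V, M)`. -/
def tensorDescAdd {X : ModuleCat.{u} Sᵐᵒᵖ} {M : ModuleCat.{u} Rᵐᵒᵖ}
    (g : X ⟶ (homFunctor S R V).obj M) : (tensorFunctor S R V).obj X →+ M :=
  show TensorOver S X V →+ M from TensorOver.liftAdd
    { toFun := fun x =>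
        { toFun := fun v => hv (g x) v
          map_zero' := hv_zero_right _
          map_add' := hv_add_right _ }
      map_zero' := by
        ext v
        change hv (g 0) v = 0
        rw [map_zero, hv_zero_left]
      map_add' := fun x y => by
        ext v
        change hv (g (x + y)) v = hv (g x) v + hv (g y) v
        rw [map_add, hv_add_left] }
    fun x s v => by
      change hv (g (op s • x)) v = hv (g x) (s • v)
      rw [map_smul, hv_op_smul]

/-- The linear map `X ⊗_S V ⟶ M` attached to a linear map `X ⟶ Hom_R(V, M)`. -/
def tensorDesc {X : ModuleCat.{u} Sᵐᵒᵖ} {M : ModuleCat.{u} Rᵐᵒᵖ}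
    (g : X ⟶ (homFunctor S R V).obj M) : (tensorFunctor S R V).obj X ⟶ M :=
  ModuleCat.ofHom (X := ((tensorFunctor S R V).obj X : ModuleCat.{u} Rᵐᵒᵖ))
    { toFun := tensorDescAdd g
      map_add' := map_add _
      map_smul' := fun r z => by
        rw [RingHom.id_apply]
        refine tensor_induction (p := fun z => tensorDescAdd g (r • z) = r • tensorDescAdd g z) z ?_
          (fun x v => ?_) fun a b ha hb => ?_
        · rw [smul_zero, map_zero, smul_zero]
        · exact hv_smul_right (g x) r v
        · rw [smul_add, map_add, ha, hb, map_add, smul_add] }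

/-- The linear map `X ⟶ Hom_R(V, M)` attached to a linear map `X ⊗_S V ⟶ M`. -/
def tensorCurry {X : ModuleCat.{u} Sᵐᵒᵖ} {M : ModuleCat.{u} Rᵐᵒᵖ}
    (f : (tensorFunctor S R V).obj X ⟶ M) : X ⟶ (homFunctor S R V).obj M :=
  ModuleCat.ofHom
    { toFun := fun x => homMk (S := S)
        { toFun := fun v => f (tm x v)
          map_add' := fun v w => by rw [tm_add_right, map_add]
          map_smul' := fun r v => by rw [tm_smul_right, map_smul, RingHom.id_apply] }
      map_add' := fun x y => hv_ext fun v => by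
        change f (tm (x + y) v) = f (tm x v) + f (tm y v)
        rw [tm_add_left, map_add]
      map_smul' := fun s x => hv_ext fun v => by
        change f (tm (op (unop s) • x) v) = f (tm x (unop s • v))
        rw [tm_smul_left] }

variable (S R V) in
/-- The functor `- ⊗_S V` is left adjoint to `Hom_R(V, -)`. -/
def tensorHomAdjunction : tensorFunctor S R V ⊣ homFunctor S R V :=
  Adjunction.mkOfHomEquiv
    { homEquiv := fun X M =>
        { toFun := tensorCurry
          invFun := tensorDesc
          left_inv := fun f => tensor_hom_ext fun x v => rfl
          right_inv := fun g => by
            ext x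
            exact hv_ext fun v => rfl }
      homEquiv_naturality_left_symm := fun f g => tensor_hom_ext fun x v => rfl
      homEquiv_naturality_right := fun f g => by
        ext x
        exact hv_ext fun v => rfl }

instance : (homFunctor S R V).Additive where
  map_add {M N f g} := by
    ext x
    exact hv_ext fun v => rfl

instance : (tensorFunctor S R V).Additive := (tensorHomAdjunction S R V).left_adjoint_additive

/-- The tensor product of finitely generated modules is finitely generated. -/
theorem finite_tensor [Module.Finite Rᵐᵒᵖ V] (X : ModuleCat.{u} Sᵐᵒᵖ) [Module.Finite Sᵐᵒᵖ X] :
    Module.Finite Rᵐᵒᵖ ((tensorFunctor S R V).obj X) := by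
  obtain ⟨n, x, hx⟩ := Module.Finite.exists_fin (R := Sᵐᵒᵖ) (M := X)
  -- A power of `V` maps onto the tensor product, since scalars from `S` can be moved from the
  -- generators of `X` to `V`.
  let l : (Fin n → V) →ₗ[Rᵐᵒᵖ] (tensorFunctor S R V).obj X :=
    { toFun := fun v => ∑ i, tm (x i) (v i)
      map_add' := fun v w => by
        simp only [Pi.add_apply, tm_add_right, Finset.sum_add_distrib]
      map_smul' := fun r v => by
        simp only [Pi.smul_apply, tm_smul_right, Finset.smul_sum, RingHom.id_apply] }
  refine Module.Finite.of_surjective l fun z => LinearMap.mem_range.1 ?_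
  refine tensor_induction z (Submodule.zero_mem _) (fun y v => ?_) fun a b ha hb =>
    Submodule.add_mem _ ha hb
  have hy : y ∈ Submodule.span Sᵐᵒᵖ (Set.range x) := hx ▸ Submodule.mem_top
  obtain ⟨c, rfl⟩ := (Submodule.mem_span_range_iff_exists_fun Sᵐᵒᵖ).1 hy
  refine ⟨fun i => unop (c i) • v, ?_⟩
  let t : X →+ (tensorFunctor S R V).obj X :=
    { toFun := fun y => tm y v
      map_zero' := by
        have := tm_add_left (R := R) (0 : X) 0 v
        rwa [add_zero, left_eq_add] at this
      map_add' := fun y z => tm_add_left y z v }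
  change ∑ i, tm (x i) (unop (c i) • v) = t (∑ i, c i • x i)
  rw [map_sum]
  exact Finset.sum_congr rfl fun i _ => (tm_smul_left (x i) (unop (c i)) v).symm

section Finite

variable (k : Type u) [CommRing k] [IsNoetherianRing k] [Algebra k R] [Algebra k S] [Module.Finite k R]

/-- Modules of homomorphisms between finitely generated modules are finitely generated. -/
theorem finite_hom [Module.Finite Rᵐᵒᵖ V]
    (hV : ∀ (c : k) (v : V), algebraMap k S c • v = op (algebraMap k R c) • v)
    (M : ModuleCat.{u} Rᵐᵒᵖ) [Module.Finite Rᵐᵒᵖ M] :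
    Module.Finite Sᵐᵒᵖ ((homFunctor S R V).obj M) := by
  let : Module k M := Module.compHom M (algebraMap k Rᵐᵒᵖ)
  have : IsScalarTower k Rᵐᵒᵖ M := IsScalarTower.of_algebraMap_smul fun _ _ => rfl
  let : Module k ((homFunctor S R V).obj M) := Module.compHom _ (algebraMap k Sᵐᵒᵖ)
  have : IsScalarTower k Sᵐᵒᵖ ((homFunctor S R V).obj M) :=
    IsScalarTower.of_algebraMap_smul fun _ _ => rfl
  have : Module.Finite k Rᵐᵒᵖ := Module.Finite.equiv (opLinearEquiv k : R ≃ₗ[k] Rᵐᵒᵖ)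
  have : Module.Finite k M := Module.Finite.trans Rᵐᵒᵖ M
  obtain ⟨n, v, hv'⟩ := Module.Finite.exists_fin (R := Rᵐᵒᵖ) (M := V)
  -- Evaluation at generators of `V` is injective. It is `k`-linear because `k` acts on `V` in the
  -- same way through `S` and through `R`.
  let l : (homFunctor S R V).obj M →ₗ[k] (Fin n → M) :=
    { toFun := fun f i => hv f (v i)
      map_add' := fun f g => rfl
      map_smul' := fun c f => by
        ext i
        change hv f (algebraMap k S c • v i) = op (algebraMap k R c) • hv f (v i)
        rw [hV, hv_smul_right] }
  have hl : Function.Injective l := by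
    intro f g h
    have : (show V →ₗ[Rᵐᵒᵖ] M from f) = g :=
      LinearMap.ext_on_range (v := v) hv' fun i => congrFun h i
    exact this
  have : Module.Finite k ((homFunctor S R V).obj M) := Module.Finite.of_injective l hl
  exact Module.Finite.of_restrictScalars_finite k _ _

end Finite

end TensorHom

/-! ## Duality over a commutative artinian ring -/

section Matlis

variable {k E : Type u} [CommRing k] [IsArtinianRing k] [AddCommGroup E] [Module k E]

theorem isSemisimpleModule_quotient_jacobson : IsSemisimpleModule k (k ⧸ Ring.jacobson k) :=
  (IsArtinian.isSemisimpleModule_iff_jacobson k _).2 (Module.jacobson_quotient_jacobson k k)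

/-- The map `k / rad k → N` given by an element of a simple module. -/
def quotientJacobsonMap {N : Type u} [AddCommGroup N] [Module k N] [IsSimpleModule k N] (n : N) :
    (k ⧸ Ring.jacobson k) →ₗ[k] N :=
  (Ring.jacobson k).liftQ (LinearMap.toSpanSingleton k N n)
    (IsSemisimpleModule.jacobson_le_ker k k k N _)

theorem quotientJacobsonMap_mk {N : Type u} [AddCommGroup N] [Module k N] [IsSimpleModule k N]
    (n : N) (x : k) : quotientJacobsonMap n (Submodule.Quotient.mk x) = x • n := rfl

variable (hE : IsInjectiveEnvelope k (k ⧸ Ring.jacobson k) E)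
include hE

/-- Every map `N → E` lands in the essential submodule `k / rad k`. It then suffices to embed the
dual `k`-linearly into `N`, which has length one. -/
theorem length_dual_of_isSimpleModule (N : Type u) [AddCommGroup N] [Module k N]
    [IsSimpleModule k N] : Module.length k (N →ₗ[k] E) ≤ 1 := by
  obtain ⟨-, j, hj, hess⟩ := hE
  have := IsSimpleModule.nontrivial k N
  obtain ⟨n, hn⟩ := exists_ne (0 : N)
  have hspan := IsSimpleModule.toSpanSingleton_surjective k hn
  -- Otherwise simplicity makes the image of `f` meet `range j` trivially, and essentiality forces
  -- `f = 0`.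
  have hrange : ∀ f : N →ₗ[k] E, f n ∈ LinearMap.range j := by
    intro f
    by_contra hf
    have h₀ : LinearMap.range f ⊓ LinearMap.range j = ⊥ := by
      rw [eq_bot_iff]
      rintro _ ⟨⟨m, rfl⟩, hm⟩
      rw [Submodule.mem_bot]
      by_contra hm₀
      have hm₁ : m ≠ 0 := fun h => hm₀ (by rw [h, map_zero])
      obtain ⟨c, hc⟩ := IsSimpleModule.toSpanSingleton_surjective k hm₁ n
      rw [LinearMap.toSpanSingleton_apply] at hc
      apply hf
      rw [← hc, map_smul]
      exact Submodule.smul_mem _ _ hm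
    have h₁ : f n ∈ (⊥ : Submodule k E) := hess _ h₀ ▸ LinearMap.mem_range_self f n
    rw [Submodule.mem_bot] at h₁
    exact hf (h₁ ▸ Submodule.zero_mem _)
  let e := LinearEquiv.ofInjective j hj
  let v : (N →ₗ[k] E) →ₗ[k] LinearMap.range j :=
    (LinearMap.applyₗ n).codRestrict (LinearMap.range j) hrange
  -- If `f n` is the image under `j` of the class of `x`, then `c f = x • n`.
  let c : (N →ₗ[k] E) →ₗ[k] N := quotientJacobsonMap n ∘ₗ e.symm.toLinearMap ∘ₗ v
  have hc : Function.Injective c := by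
    rw [injective_iff_map_eq_zero]
    intro f hf
    obtain ⟨x, hx⟩ := Submodule.Quotient.mk_surjective _ (e.symm (v f))
    have hfn : f n = j (Submodule.Quotient.mk x) := by
      rw [hx]
      exact congrArg Subtype.val (e.apply_symm_apply (v f)).symm
    have hxn : x • n = 0 := by
      rw [← quotientJacobsonMap_mk, hx]
      exact hf
    have hxx : x • (Submodule.Quotient.mk x : k ⧸ Ring.jacobson k) = 0 := by
      apply hj
      rw [map_smul, ← hfn, ← map_smul, hxn, map_zero, map_zero]
    -- From `x • n = 0` one gets that `x ^ 2` kills `k / rad k`; the annihilator of a semisimple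
    -- module is a radical ideal, so `x` does too.
    have hrad : x ∈ Module.annihilator k (k ⧸ Ring.jacobson k) := by
      have := isSemisimpleModule_quotient_jacobson (k := k)
      refine IsSemisimpleModule.annihilator_isRadical (k ⧸ Ring.jacobson k) k ⟨2, ?_⟩
      rw [Module.mem_annihilator]
      intro y
      obtain ⟨y, rfl⟩ := Submodule.Quotient.mk_surjective _ y
      have : (Submodule.Quotient.mk y : k ⧸ Ring.jacobson k) = y • Submodule.Quotient.mk 1 := by
        rw [← Submodule.Quotient.mk_smul, smul_eq_mul, mul_one]
      have hx' : (Submodule.Quotient.mk x : k ⧸ Ring.jacobson k) = x • Submodule.Quotient.mk 1 := by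
        rw [← Submodule.Quotient.mk_smul, smul_eq_mul, mul_one]
      rw [this, smul_comm, pow_two, mul_smul, ← hx', hxx, smul_zero]
    have hx₀ : (Submodule.Quotient.mk x : k ⧸ Ring.jacobson k) = 0 := by
      have := Module.mem_annihilator.1 hrad (Submodule.Quotient.mk 1)
      rwa [← Submodule.Quotient.mk_smul, smul_eq_mul, mul_one] at this
    rw [hx₀, map_zero] at hfn
    ext m
    obtain ⟨y, rfl⟩ := hspan m
    rw [LinearMap.toSpanSingleton_apply, map_smul, hfn, smul_zero, LinearMap.zero_apply]
  exact (Module.length_le_of_injective c hc).trans (Module.length_eq_one k N).le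

/-- Induction along a composition series: injectivity of `E` makes dualization exact, and each
simple factor contributes at most one. -/
theorem length_dual_le {M : Type u} [AddCommGroup M] [Module k M] (hM : IsFiniteLength k M) :
    Module.length k (M →ₗ[k] E) ≤ Module.length k M := by
  have := hE.1
  induction hM with
  | of_subsingleton => rw [Module.length_eq_zero]; exact bot_le
  | @of_simple_quotient M _ _ N _ _ ih =>
    have h₁ := Module.length_eq_add_of_exact N.subtype N.mkQ N.injective_subtype N.mkQ_surjective
      (LinearMap.exact_subtype_mkQ N)
    have h₂ := Module.length_eq_add_of_exact (LinearMap.lcomp k E N.mkQ)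
      (LinearMap.lcomp k E N.subtype)
      (fun f g h => by
        ext x
        exact DFunLike.congr_fun h x)
      (fun f => by
        obtain ⟨g, hg⟩ := Module.Injective.out N.subtype N.injective_subtype f
        exact ⟨g, LinearMap.ext hg⟩)
      (fun f => by
        constructor
        · intro h
          refine ⟨N.liftQ f fun x hx => DFunLike.congr_fun h (⟨x, hx⟩ : N), ?_⟩
          ext x
          rfl
        · rintro ⟨g, rfl⟩
          ext x
          change g (N.mkQ x) = 0
          rw [Submodule.mkQ_apply, (Submodule.Quotient.mk_eq_zero N).2 x.2, map_zero])
    rw [h₁, h₂, add_comm]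
    refine add_le_add ih ?_
    exact (length_dual_of_isSimpleModule hE (M ⧸ N)).trans (Module.length_eq_one k (M ⧸ N)).ge

/-- `E` is a cogenerator. The cyclic module generated by `m` has a simple quotient in which `m`
survives; that quotient splits off the semisimple module `k / rad k`, which embeds into `E`, and
injectivity extends the map to `M`. -/
theorem exists_dual_ne_zero {M : Type u} [AddCommGroup M] [Module k M] {m : M} (hm : m ≠ 0) :
    ∃ f : M →ₗ[k] E, f m ≠ 0 := by
  obtain ⟨hinj, j, hj, -⟩ := hE
  let M' := Submodule.span k {m}
  let m' : M' := ⟨m, Submodule.mem_span_singleton_self m⟩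
  have hm' : m' ≠ 0 := fun h => hm (congrArg Subtype.val h)
  have : Nontrivial M' := ⟨m', 0, hm'⟩
  obtain ⟨N, hN⟩ := IsCoatomic.exists_coatom (Submodule k M')
  have : IsSimpleModule k (M' ⧸ N) := isSimpleModule_iff_isCoatom.2 hN
  have hn : N.mkQ m' ≠ 0 := by
    intro h
    rw [Submodule.mkQ_apply, Submodule.Quotient.mk_eq_zero] at h
    refine hN.1 (eq_top_iff.2 fun x _ => ?_)
    obtain ⟨c, hc⟩ := Submodule.mem_span_singleton.1 x.2
    have : x = c • m' := Subtype.ext hc.symm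
    rw [this]
    exact N.smul_mem c h
  have := isSemisimpleModule_quotient_jacobson (k := k)
  have hsurj : Function.Surjective (quotientJacobsonMap (N.mkQ m')) := fun y => by
    obtain ⟨c, rfl⟩ := IsSimpleModule.toSpanSingleton_surjective k hn y
    exact ⟨Submodule.Quotient.mk c, rfl⟩
  obtain ⟨s, hs⟩ := IsSemisimpleModule.lifting_property _ hsurj LinearMap.id
  obtain ⟨f, hf⟩ := hinj.out M'.subtype M'.injective_subtype (j ∘ₗ s ∘ₗ N.mkQ)
  refine ⟨f, fun h => hn ?_⟩
  have h₁ : j (s (N.mkQ m')) = 0 := (hf m').symm.trans h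
  have h₂ : s (N.mkQ m') = 0 := hj (h₁.trans (map_zero j).symm)
  have h₃ := DFunLike.congr_fun hs (N.mkQ m')
  rw [LinearMap.comp_apply, h₂, map_zero] at h₃
  exact h₃.symm

omit hE

namespace KDual

variable {M : Type u} [AddCommGroup M] [Module k M]

instance baseModule {k E M : Type u} [CommRing k] [AddCommGroup E] [Module k E] [AddCommGroup M]
    [Module k M] : Module k (KDual k E M) := inferInstanceAs (Module k (M →ₗ[k] E))

theorem base_smul_apply (c : k) (f : KDual k E M) (m : M) : (c • f) m = c • f m := rfl

theorem apply_smul (f : KDual k E M) (c : k) (m : M) : f (c • m) = c • f m :=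
  map_smul (show M →ₗ[k] E from f) c m

/-- A linear map to `E` as an element of the dual. -/
def mk (f : M →ₗ[k] E) : KDual k E M := f

include hE

theorem finite [Module.Finite k M] : Module.Finite k (KDual k E M) := by
  have hM : IsFiniteLength k M := isFiniteLength_iff_isNoetherian_isArtinian.2
    ⟨inferInstance, inferInstance⟩
  have h : Module.length k (M →ₗ[k] E) ≠ ⊤ :=
    ((length_dual_le hE hM).trans_lt (Module.length_ne_top_iff.2 hM).lt_top).ne
  have := (isFiniteLength_iff_isNoetherian_isArtinian.1 (Module.length_ne_top_iff.1 h)).1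
  exact inferInstanceAs (Module.Finite k (M →ₗ[k] E))

theorem eq_of_forall_apply_eq {m m' : M} (h : ∀ f : KDual k E M, f m = f m') : m = m' := by
  by_contra hm
  obtain ⟨f, hf⟩ := exists_dual_ne_zero hE (sub_ne_zero.2 hm)
  refine hf ?_
  rw [map_sub, sub_eq_zero]
  exact h (mk f)

/-- Biduality is injective as `E` is a cogenerator, and the bidual is no longer than `M`, so the
cokernel of biduality has length zero. -/
theorem exists_apply_eq [Module.Finite k M] (l : KDual k E M →ₗ[k] E) :
    ∃ m, ∀ f : KDual k E M, l f = f m := by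
  let ev : M →ₗ[k] (M →ₗ[k] E) →ₗ[k] E := LinearMap.applyₗ
  have hev : Function.Injective ev := fun m m' h =>
    eq_of_forall_apply_eq hE fun f => DFunLike.congr_fun h f
  have hM : IsFiniteLength k M := isFiniteLength_iff_isNoetherian_isArtinian.2
    ⟨inferInstance, inferInstance⟩
  have hDM : IsFiniteLength k (M →ₗ[k] E) := Module.length_ne_top_iff.1
    ((length_dual_le hE hM).trans_lt (Module.length_ne_top_iff.2 hM).lt_top).ne
  have h := (length_dual_le hE hDM).trans (length_dual_le hE hM)
  have hex := Module.length_eq_add_of_exact ev (LinearMap.range ev).mkQ hev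
    (Submodule.mkQ_surjective _) (LinearMap.exact_map_mkQ_range ev)
  rw [hex] at h
  have h₀ : Module.length k (((M →ₗ[k] E) →ₗ[k] E) ⧸ LinearMap.range ev) = 0 := by
    have h' : Module.length k M + _ ≤ Module.length k M + 0 := h.trans (add_zero _).ge
    exact nonpos_iff_eq_zero.1 ((ENat.add_le_add_iff_left (Module.length_ne_top_iff.2 hM)).1 h')
  have := Module.length_eq_zero_iff.1 h₀
  have htop : LinearMap.range ev = ⊤ := Submodule.Quotient.subsingleton_iff.1 this
  let l' : (M →ₗ[k] E) →ₗ[k] E := l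
  obtain ⟨m, hm⟩ : l' ∈ LinearMap.range ev := htop ▸ Submodule.mem_top
  exact ⟨m, fun f => (DFunLike.congr_fun hm f).symm⟩

omit hE

section Algebra

variable {A : Type u} [Ring A] [Algebra k A]

instance rightTower [Module A M] [IsScalarTower k A M] :
    IsScalarTower k Aᵐᵒᵖ (KDual k E M) where
  smul_assoc c a f := by
    ext m
    change f (unop (c • a) • m) = c • f (unop a • m)
    rw [unop_smul, smul_assoc, apply_smul]

/-- The dual of an algebra is an injective right module. -/
theorem injective_algebra [Module.Injective k E] : Module.Injective Aᵐᵒᵖ (KDual k E A) where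
  out X Y _ _ _ _ f hf g := by
    let _ : Module k X := Module.compHom X (algebraMap k Aᵐᵒᵖ)
    have : IsScalarTower k Aᵐᵒᵖ X := IsScalarTower.of_algebraMap_smul fun _ _ => rfl
    let _ : Module k Y := Module.compHom Y (algebraMap k Aᵐᵒᵖ)
    have : IsScalarTower k Aᵐᵒᵖ Y := IsScalarTower.of_algebraMap_smul fun _ _ => rfl
    -- Coinduction: right-linear maps to the dual of `A` correspond, by evaluation at `1`, to
    -- `k`-linear maps to `E`, and these extend.
    let g₁ : X →ₗ[k] E :=
      { toFun := fun x => g x 1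
        map_add' := fun x y => by rw [map_add, add_apply]
        map_smul' := fun c x => by
          rw [← algebraMap_smul Aᵐᵒᵖ c x, map_smul, algebraMap_smul, base_smul_apply,
            RingHom.id_apply] }
    obtain ⟨h, hh⟩ := Module.Injective.out (f.restrictScalars k) hf g₁
    refine ⟨{ toFun := fun y => mk
                { toFun := fun a => h (op a • y)
                  map_add' := fun a b => by rw [MulOpposite.op_add, add_smul, map_add]
                  map_smul' := fun c a => by rw [MulOpposite.op_smul, smul_assoc, map_smul, RingHom.id_apply] }
              map_add' := fun y z => by
                ext a
                change h (op a • (y + z)) = h (op a • y) + h (op a • z)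
                rw [smul_add, map_add]
              map_smul' := fun b y => by
                ext a
                change h (op a • b • y) = h (op (unop b * a) • y)
                rw [MulOpposite.op_mul, op_unop, mul_smul] }, fun x => ?_⟩
    ext a
    change h (op a • f x) = g x a
    rw [← map_smul]
    refine (hh (op a • x)).trans ?_
    change g (op a • x) 1 = g x a
    rw [map_smul, op_smul_apply, smul_eq_mul, mul_one]

end Algebra

end KDual

end Matlis

/-! ## The Nakayama functors through a faithfully balanced bimodule -/

section Balanced

/-- The `S`-`R`-bimodule `T` is faithfully balanced: each of the two rings is the endomorphism ring
of `T` over the other. -/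
structure IsFaithfullyBalanced (S R T : Type u) [Ring S] [Ring R] [AddCommGroup T] [Module S T]
    [Module Rᵐᵒᵖ T] : Prop where
  exists_right : ∀ f : T → T, (∀ x y, f (x + y) = f x + f y) → (∀ (s : S) x, f (s • x) = s • f x) →
    ∃ r : R, ∀ x, f x = op r • x
  eq_right : ∀ r r' : R, (∀ x : T, op r • x = op r' • x) → r = r'
  exists_left : ∀ f : T → T, (∀ x y, f (x + y) = f x + f y) →
    (∀ (r : R) x, f (op r • x) = op r • f x) → ∃ s : S, ∀ x, f x = s • x
  eq_left : ∀ s s' : S, (∀ x : T, s • x = s' • x) → s = s'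

variable {k E S R T : Type u} [CommRing k] [IsArtinianRing k] [AddCommGroup E] [Module k E]
  [Ring S] [Ring R] [Algebra k S] [Algebra k R]
  [AddCommGroup T] [Module k T] [Module S T] [Module Rᵐᵒᵖ T] [SMulCommClass S Rᵐᵒᵖ T]
  [IsScalarTower k S T] [IsScalarTower k Rᵐᵒᵖ T]

theorem algebraMap_smul_right (c : k) (t : T) : op (algebraMap k R c) • t = c • t :=
  algebraMap_smul Rᵐᵒᵖ c t

/-- The functional `r ↦ φ (t r)` on `R`. -/
def orbRight (φ : KDual k E T) (t : T) : KDual k E R := KDual.mk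
  { toFun := fun r => φ (op r • t)
    map_add' := fun r r' => by rw [MulOpposite.op_add, add_smul, map_add]
    map_smul' := fun c r => by
      rw [MulOpposite.op_smul, smul_assoc, KDual.apply_smul, RingHom.id_apply] }

/-- The functional `s ↦ φ (s t)` on `S`. -/
def orbLeft (φ : KDual k E T) (t : T) : KDual k E S := KDual.mk
  { toFun := fun s => φ (s • t)
    map_add' := fun r r' => by rw [add_smul, map_add]
    map_smul' := fun c r => by rw [smul_assoc, KDual.apply_smul, RingHom.id_apply] }

theorem orbRight_apply (φ : KDual k E T) (t : T) (r : R) : orbRight φ t r = φ (op r • t) := rfl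

theorem orbLeft_apply (φ : KDual k E T) (t : T) (s : S) : orbLeft φ t s = φ (s • t) := rfl

theorem orbRight_add_left (φ φ' : KDual k E T) (t : T) :
    (orbRight (φ + φ') t : KDual k E R) = orbRight φ t + orbRight φ' t := rfl

theorem orbRight_add_right (φ : KDual k E T) (t t' : T) :
    (orbRight φ (t + t') : KDual k E R) = orbRight φ t + orbRight φ t' := by
  ext r
  rw [orbRight_apply, smul_add, map_add]
  rfl

theorem orbRight_smul_right (φ : KDual k E T) (r : Rᵐᵒᵖ) (t : T) :
    (orbRight φ (r • t) : KDual k E R) = r • orbRight φ t := by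
  ext r'
  change φ (op r' • r • t) = φ (op (unop r * r') • t)
  rw [MulOpposite.op_mul, op_unop, mul_smul]

theorem orbRight_op_smul (φ : KDual k E T) (s : S) (t : T) :
    (orbRight (op s • φ) t : KDual k E R) = orbRight φ (s • t) := by
  ext r
  change φ (s • op r • t) = φ (op r • s • t)
  rw [smul_comm]

theorem orbRight_smul_left (φ : KDual k E T) (r : R) (t : T) :
    (orbRight (r • φ) t : KDual k E R) = r • orbRight φ t := by
  ext r'
  change φ (op r • op r' • t) = φ (op (r' * r) • t)
  rw [MulOpposite.op_mul, mul_smul]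

theorem orbLeft_add_left (φ φ' : KDual k E T) (t : T) :
    (orbLeft (φ + φ') t : KDual k E S) = orbLeft φ t + orbLeft φ' t := rfl

theorem orbLeft_add_right (φ : KDual k E T) (t t' : T) :
    (orbLeft φ (t + t') : KDual k E S) = orbLeft φ t + orbLeft φ t' := by
  ext r
  rw [orbLeft_apply, smul_add, map_add]
  rfl

theorem orbLeft_smul_right (φ : KDual k E T) (r : R) (t : T) :
    (orbLeft φ (op r • t) : KDual k E S) = orbLeft (r • φ) t := by
  ext s
  change φ (s • op r • t) = φ (op r • s • t)
  rw [smul_comm]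

theorem orbLeft_op_smul (φ : KDual k E T) (s : Sᵐᵒᵖ) (t : T) :
    (orbLeft (s • φ) t : KDual k E S) = s • orbLeft φ t := by
  ext s'
  change φ (unop s • s' • t) = φ ((unop s * s') • t)
  rw [mul_smul]

theorem orbLeft_smul_left (φ : KDual k E T) (s : S) (t : T) :
    (orbLeft φ (s • t) : KDual k E S) = s • orbLeft φ t := by
  ext s'
  change φ (s' • s • t) = φ ((s' * s) • t)
  rw [mul_smul]

variable (k E S R T)

variable {k E S R T} in
/-- The map `T → M`, `t ↦ f (r ↦ φ (t r))`. -/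
def nakayamaRightInner {M : ModuleCat.{u} Rᵐᵒᵖ} (f : (homDual k R E).obj M) (φ : KDual k E T) :
    (homFunctor S R T).obj M :=
  homMk (S := S)
    { toFun := fun t => hv f (orbRight φ t)
      map_add' := fun t t' => by rw [orbRight_add_right, hv_add_right]
      map_smul' := fun r t => by rw [orbRight_smul_right, hv_smul_right, RingHom.id_apply] }

variable {k E S R T} in
theorem hv_nakayamaRightInner {M : ModuleCat.{u} Rᵐᵒᵖ} (f : (homDual k R E).obj M)
    (φ : KDual k E T) (t : T) : hv (nakayamaRightInner (S := S) f φ) t = hv f (orbRight φ t) := rfl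

variable {k E S R T} in
/-- The map `DT → Hom_R(T, M)`, `φ ↦ t ↦ f (r ↦ φ (t r))`. -/
def nakayamaRightFun {M : ModuleCat.{u} Rᵐᵒᵖ} (f : (homDual k R E).obj M) :
    (homFunctor R S (KDual k E T)).obj ((homFunctor S R T).obj M) :=
  homMk (S := R)
    { toFun := nakayamaRightInner f
      map_add' := fun φ φ' => hv_ext fun t => by
        rw [hv_add_left, hv_nakayamaRightInner, hv_nakayamaRightInner, hv_nakayamaRightInner,
          orbRight_add_left, hv_add_right]
      map_smul' := fun s φ => hv_ext fun t => by
        rw [RingHom.id_apply, ← op_unop s, hv_op_smul, hv_nakayamaRightInner,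
          hv_nakayamaRightInner, orbRight_op_smul] }

variable {k E S R T} in
theorem hv_nakayamaRightFun {M : ModuleCat.{u} Rᵐᵒᵖ} (f : (homDual k R E).obj M)
    (φ : KDual k E T) : hv (nakayamaRightFun (S := S) f) φ = nakayamaRightInner f φ := rfl

variable {k E S R T} in
theorem nakayamaRightFun_op_smul {M : ModuleCat.{u} Rᵐᵒᵖ} (r : R) (f : (homDual k R E).obj M) :
    (nakayamaRightFun (op r • f) : (homFunctor R S (KDual k E T)).obj ((homFunctor S R T).obj M)) =
      op r • nakayamaRightFun f :=
  hv_ext fun φ => hv_ext fun t => by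
    rw [hv_op_smul, hv_nakayamaRightFun, hv_nakayamaRightFun, hv_nakayamaRightInner,
      hv_nakayamaRightInner, hv_op_smul, orbRight_smul_left]

/-- The canonical map `Hom_R(DR, M) ⟶ Hom_S(DT, Hom_R(T, M))`. -/
def nakayamaRight : homDual k R E ⟶ homFunctor S R T ⋙ homFunctor R S (KDual k E T) where
  app M := ModuleCat.ofHom (X := ((homDual k R E).obj M : ModuleCat.{u} Rᵐᵒᵖ))
    (Y := (homFunctor R S (KDual k E T)).obj ((homFunctor S R T).obj M))
    { toFun := nakayamaRightFun
      map_add' := fun f g => hv_ext fun φ => hv_ext fun t => rfl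
      map_smul' := fun r f => nakayamaRightFun_op_smul (unop r) f }
  naturality M N f := by
    ext x
    exact hv_ext fun φ => hv_ext fun t => rfl

variable {k E S R T} in
/-- The map `DT → Y`, `φ ↦ f (s ↦ φ (s t))`. -/
def nakayamaLeftInner {Y : ModuleCat.{u} Sᵐᵒᵖ} (f : (homDual k S E).obj Y) (t : T) :
    (homFunctor R S (KDual k E T)).obj Y :=
  homMk (S := R)
    { toFun := fun φ => hv f (orbLeft φ t)
      map_add' := fun t t' => by rw [orbLeft_add_left, hv_add_right]
      map_smul' := fun s φ => by rw [orbLeft_op_smul, hv_smul_right, RingHom.id_apply] }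

variable {k E S R T} in
theorem hv_nakayamaLeftInner {Y : ModuleCat.{u} Sᵐᵒᵖ} (f : (homDual k S E).obj Y)
    (φ : KDual k E T) (t : T) : hv (nakayamaLeftInner (R := R) f t) φ = hv f (orbLeft φ t) := rfl

variable {k E S R T} in
/-- The map `T → Hom_S(DT, Y)`, `t ↦ φ ↦ f (s ↦ φ (s t))`. -/
def nakayamaLeftFun {Y : ModuleCat.{u} Sᵐᵒᵖ} (f : (homDual k S E).obj Y) :
    (homFunctor S R T).obj ((homFunctor R S (KDual k E T)).obj Y) :=
  homMk (S := S)
    { toFun := nakayamaLeftInner f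
      map_add' := fun t t' => hv_ext fun φ => by
        rw [hv_add_left, hv_nakayamaLeftInner, hv_nakayamaLeftInner, hv_nakayamaLeftInner,
          orbLeft_add_right, hv_add_right]
      map_smul' := fun r t => hv_ext fun φ => by
        rw [RingHom.id_apply, ← op_unop r, hv_op_smul, hv_nakayamaLeftInner,
          hv_nakayamaLeftInner, orbLeft_smul_right] }

variable {k E S R T} in
theorem hv_nakayamaLeftFun {Y : ModuleCat.{u} Sᵐᵒᵖ} (f : (homDual k S E).obj Y) (t : T) :
    hv (nakayamaLeftFun (R := R) f) t = nakayamaLeftInner f t := rfl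

variable {k E S R T} in
theorem nakayamaLeftFun_op_smul {Y : ModuleCat.{u} Sᵐᵒᵖ} (s : S) (f : (homDual k S E).obj Y) :
    (nakayamaLeftFun (op s • f) : (homFunctor S R T).obj ((homFunctor R S (KDual k E T)).obj Y)) =
      op s • nakayamaLeftFun f :=
  hv_ext fun t => hv_ext fun φ => by
    rw [hv_op_smul, hv_nakayamaLeftFun, hv_nakayamaLeftFun, hv_nakayamaLeftInner,
      hv_nakayamaLeftInner, hv_op_smul, orbLeft_smul_left]

/-- The canonical map `Hom_S(DS, Y) ⟶ Hom_R(T, Hom_S(DT, Y))`. -/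
def nakayamaLeft : homDual k S E ⟶ homFunctor R S (KDual k E T) ⋙ homFunctor S R T where
  app Y := ModuleCat.ofHom (X := ((homDual k S E).obj Y : ModuleCat.{u} Sᵐᵒᵖ))
    (Y := (homFunctor S R T).obj ((homFunctor R S (KDual k E T)).obj Y))
    { toFun := nakayamaLeftFun
      map_add' := fun f g => hv_ext fun φ => hv_ext fun t => rfl
      map_smul' := fun s f => nakayamaLeftFun_op_smul (unop s) f }
  naturality M N f := by
    ext x
    exact hv_ext fun φ => hv_ext fun t => rfl

variable {k E S R T}

theorem hv_nakayamaRight {M : ModuleCat.{u} Rᵐᵒᵖ} (f : (homDual k R E).obj M) (φ : KDual k E T)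
    (t : T) : hv (M := M) (hv ((nakayamaRight k E S R T).app M f) φ) t = hv f (orbRight φ t) := rfl

theorem hv_nakayamaLeft {Y : ModuleCat.{u} Sᵐᵒᵖ} (f : (homDual k S E).obj Y) (φ : KDual k E T)
    (t : T) : hv (M := Y) (hv ((nakayamaLeft k E S R T).app Y f) t) φ = hv f (orbLeft φ t) := rfl

variable (hE : IsInjectiveEnvelope k (k ⧸ Ring.jacobson k) E) (hT : IsFaithfullyBalanced S R T)
  [Module.Finite k T]
include hE hT

/-- Functionals `χ` on `M` turn both sides into data that reflexivity evaluates. A map `DR → M`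
composed with `χ` is evaluation at some `r : R`; a map `DT → Hom_R(T, M)` composed with `χ` is an
`S`-endomorphism of `T`, hence again given by some `r`. Faithfulness of `T` makes `r` unique. -/
theorem isIso_nakayamaRight [Module.Finite k R] (M : ModuleCat.{u} Rᵐᵒᵖ) [Module.Finite Rᵐᵒᵖ M] :
    IsIso ((nakayamaRight k E S R T).app M) := by
  let _ : Module k M := Module.compHom M (algebraMap k Rᵐᵒᵖ)
  have : IsScalarTower k Rᵐᵒᵖ M := IsScalarTower.of_algebraMap_smul fun _ _ => rfl
  have : Module.Finite k Rᵐᵒᵖ := Module.Finite.equiv (opLinearEquiv k : R ≃ₗ[k] Rᵐᵒᵖ)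
  have : Module.Finite k M := Module.Finite.trans Rᵐᵒᵖ M
  have huniq : ∀ r r' : R, (∀ (φ : KDual k E T) t, φ (op r • t) = φ (op r' • t)) → r = r' :=
    fun r r' h => hT.eq_right r r' fun t => KDual.eq_of_forall_apply_eq hE fun φ => h φ t
  rw [ConcreteCategory.isIso_iff_bijective]
  constructor
  · rw [injective_iff_map_eq_zero]
    intro f hf
    refine hv_ext fun ψ => KDual.eq_of_forall_apply_eq hE fun χ => ?_
    let l : KDual k E R →ₗ[k] E :=
      { toFun := fun ψ => χ (hv f ψ)
        map_add' := fun ψ ψ' => by rw [hv_add_right, map_add]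
        map_smul' := fun c ψ => by
          rw [← algebraMap_smul Rᵐᵒᵖ c ψ, hv_smul_right, algebraMap_smul, KDual.apply_smul,
            RingHom.id_apply] }
    obtain ⟨r, hr⟩ := KDual.exists_apply_eq hE l
    have h₀ : r = 0 := huniq _ _ fun φ t => by
      have h₁ : χ (hv f (orbRight φ t)) = φ (op r • t) := hr (orbRight φ t)
      rw [← h₁, ← hv_nakayamaRight (S := S), hf, MulOpposite.op_zero, zero_smul, map_zero]
      exact map_zero χ
    refine (hr ψ).trans ?_
    rw [h₀, map_zero, hv_zero_left, map_zero]
  · intro g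
    -- For fixed `χ` and `t`, reflexivity of `T` turns the functional of `φ` into evaluation at some
    -- `u t`. Then `u` is `S`-linear, so it is right multiplication by an element of `R`.
    have key : ∀ χ : KDual k E M, ∃ r : R, ∀ (φ : KDual k E T) t,
        χ (hv (M := M) (hv g φ) t) = φ (op r • t) := by
      intro χ
      have hu : ∀ t : T, ∃ t' : T, ∀ φ : KDual k E T, χ (hv (M := M) (hv g φ) t) = φ t' := by
        intro t
        let l : KDual k E T →ₗ[k] E :=
          { toFun := fun φ => χ (hv (M := M) (hv g φ) t)
            map_add' := fun φ φ' => by rw [hv_add_right, hv_add_left, map_add]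
            map_smul' := fun c φ => by
              have h₁ : c • φ = op (algebraMap k S c) • φ := (algebraMap_smul Sᵐᵒᵖ c φ).symm
              rw [h₁, hv_smul_right, hv_op_smul, algebraMap_smul, ← algebraMap_smul Rᵐᵒᵖ c t,
                hv_smul_right, algebraMap_smul, KDual.apply_smul, RingHom.id_apply] }
        exact KDual.exists_apply_eq hE l
      choose u hu using hu
      obtain ⟨r, hr⟩ := hT.exists_right u
        (fun x y => KDual.eq_of_forall_apply_eq hE fun φ => by
          rw [← hu, map_add, ← hu, ← hu, hv_add_right, map_add])
        (fun s x => KDual.eq_of_forall_apply_eq hE fun φ => by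
          rw [← hu, ← KDual.op_smul_apply, ← hu, hv_smul_right, hv_op_smul])
      exact ⟨r, fun φ t => by rw [hu, hr]⟩
    choose ρ hρ using key
    -- The assignment `χ ↦ ρ χ` is `k`-linear by uniqueness, so `ψ ∘ ρ` lies in the bidual of `M`;
    -- its representing element is the value at `ψ` of the preimage.
    have hf : ∀ ψ : KDual k E R, ∃ m : M, ∀ χ : KDual k E M, ψ (ρ χ) = χ m := by
      intro ψ
      let l : KDual k E M →ₗ[k] E :=
        { toFun := fun χ => ψ (ρ χ)
          map_add' := fun χ χ' => by
            rw [← map_add]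
            congr 1
            refine huniq _ _ fun φ t => ?_
            rw [← hρ, MulOpposite.op_add, add_smul, map_add, ← hρ, ← hρ, KDual.add_apply]
          map_smul' := fun c χ => by
            rw [RingHom.id_apply, ← KDual.apply_smul]
            congr 1
            refine huniq _ _ fun φ t => ?_
            rw [← hρ, MulOpposite.op_smul, smul_assoc, KDual.apply_smul, ← hρ, KDual.base_smul_apply] }
      exact KDual.exists_apply_eq hE l
    choose f hf using hf
    refine ⟨homMk (S := R)
      { toFun := f
        map_add' := fun ψ ψ' => KDual.eq_of_forall_apply_eq hE fun χ => by
          rw [← hf, map_add, ← hf, ← hf, KDual.add_apply]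
        map_smul' := fun a ψ => KDual.eq_of_forall_apply_eq hE fun χ => by
          have h₁ : ρ (unop a • χ) = unop a * ρ χ := huniq _ _ fun φ t => by
            rw [← hρ, KDual.smul_apply, ← hv_smul_right, hρ, MulOpposite.op_mul, mul_smul]
          have h₂ : χ (a • f ψ) = (unop a • χ) (f ψ) := rfl
          have h₃ : (a • ψ) (ρ χ) = ψ (unop a * ρ χ) := rfl
          rw [RingHom.id_apply, ← hf, h₂, ← hf, h₁, h₃] }, ?_⟩
    refine hv_ext fun φ => hv_ext fun t => KDual.eq_of_forall_apply_eq hE fun χ => ?_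
    rw [hρ]
    exact (hf (orbRight φ t) χ).symm

/-- The argument of `isIso_nakayamaRight` with the rings exchanged: the endomorphism of `T` obtained
from a functional is now `R`-linear, hence given by an element of `S`. -/
theorem isIso_nakayamaLeft [Module.Finite k S] (Y : ModuleCat.{u} Sᵐᵒᵖ) [Module.Finite Sᵐᵒᵖ Y] :
    IsIso ((nakayamaLeft k E S R T).app Y) := by
  let _ : Module k Y := Module.compHom Y (algebraMap k Sᵐᵒᵖ)
  have : IsScalarTower k Sᵐᵒᵖ Y := IsScalarTower.of_algebraMap_smul fun _ _ => rfl
  have : Module.Finite k Sᵐᵒᵖ := Module.Finite.equiv (opLinearEquiv k : S ≃ₗ[k] Sᵐᵒᵖ)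
  have : Module.Finite k Y := Module.Finite.trans Sᵐᵒᵖ Y
  have huniq : ∀ s s' : S, (∀ (φ : KDual k E T) t, φ (s • t) = φ (s' • t)) → s = s' :=
    fun r r' h => hT.eq_left r r' fun t => KDual.eq_of_forall_apply_eq hE fun φ => h φ t
  rw [ConcreteCategory.isIso_iff_bijective]
  constructor
  · rw [injective_iff_map_eq_zero]
    intro f hf
    refine hv_ext fun ψ => KDual.eq_of_forall_apply_eq hE fun χ => ?_
    let l : KDual k E S →ₗ[k] E :=
      { toFun := fun ψ => χ (hv f ψ)
        map_add' := fun ψ ψ' => by rw [hv_add_right, map_add]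
        map_smul' := fun c ψ => by
          rw [← algebraMap_smul Sᵐᵒᵖ c ψ, hv_smul_right, algebraMap_smul, KDual.apply_smul,
            RingHom.id_apply] }
    obtain ⟨r, hr⟩ := KDual.exists_apply_eq hE l
    have h₀ : r = 0 := huniq _ _ fun φ t => by
      have h₁ : χ (hv f (orbLeft φ t)) = φ (r • t) := hr (orbLeft φ t)
      rw [← h₁, ← hv_nakayamaLeft (R := R), hf, zero_smul, map_zero]
      exact map_zero χ
    refine (hr ψ).trans ?_
    rw [h₀, map_zero, hv_zero_left, map_zero]
  · intro g
    have key : ∀ χ : KDual k E Y, ∃ s : S, ∀ (φ : KDual k E T) t,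
        χ (hv (M := Y) (hv g t) φ) = φ (s • t) := by
      intro χ
      have hu : ∀ t : T, ∃ t' : T, ∀ φ : KDual k E T, χ (hv (M := Y) (hv g t) φ) = φ t' := by
        intro t
        let l : KDual k E T →ₗ[k] E :=
          { toFun := fun φ => χ (hv (M := Y) (hv g t) φ)
            map_add' := fun φ φ' => by rw [hv_add_right, map_add]
            map_smul' := fun c φ => by
              rw [← algebraMap_smul Sᵐᵒᵖ c φ, hv_smul_right, algebraMap_smul, KDual.apply_smul,
                RingHom.id_apply] }
        exact KDual.exists_apply_eq hE l
      choose u hu using hu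
      obtain ⟨s, hs⟩ := hT.exists_left u
        (fun x y => KDual.eq_of_forall_apply_eq hE fun φ => by
          rw [← hu, map_add, ← hu, ← hu, hv_add_right, hv_add_left, map_add])
        (fun r x => KDual.eq_of_forall_apply_eq hE fun φ => by
          rw [← hu, ← KDual.smul_apply, ← hu, hv_smul_right, hv_op_smul])
      exact ⟨s, fun φ t => by rw [hu, hs]⟩
    choose ρ hρ using key
    have hf : ∀ ψ : KDual k E S, ∃ m : Y, ∀ χ : KDual k E Y, ψ (ρ χ) = χ m := by
      intro ψ
      let l : KDual k E Y →ₗ[k] E :=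
        { toFun := fun χ => ψ (ρ χ)
          map_add' := fun χ χ' => by
            rw [← map_add]
            congr 1
            refine huniq _ _ fun φ t => ?_
            rw [← hρ, add_smul, map_add, ← hρ, ← hρ, KDual.add_apply]
          map_smul' := fun c χ => by
            rw [RingHom.id_apply, ← KDual.apply_smul]
            congr 1
            refine huniq _ _ fun φ t => ?_
            rw [← hρ, smul_assoc, KDual.apply_smul, ← hρ, KDual.base_smul_apply] }
      exact KDual.exists_apply_eq hE l
    choose f hf using hf
    refine ⟨homMk (S := S)
      { toFun := f
        map_add' := fun ψ ψ' => KDual.eq_of_forall_apply_eq hE fun χ => by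
          rw [← hf, map_add, ← hf, ← hf, KDual.add_apply]
        map_smul' := fun a ψ => KDual.eq_of_forall_apply_eq hE fun χ => by
          have h₁ : ρ (unop a • χ) = unop a * ρ χ := huniq _ _ fun φ t => by
            rw [← hρ, KDual.smul_apply, ← hv_smul_right, hρ, mul_smul]
            rfl
          have h₂ : χ (a • f ψ) = (unop a • χ) (f ψ) := rfl
          have h₃ : (a • ψ) (ρ χ) = ψ (unop a * ρ χ) := rfl
          rw [RingHom.id_apply, ← hf, h₂, ← hf, h₁, h₃] }, ?_⟩
    refine hv_ext fun t => hv_ext fun φ => KDual.eq_of_forall_apply_eq hE fun χ => ?_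
    rw [hρ]
    exact (hf (orbLeft φ t) χ).symm

end Balanced

/-! ## Cotorsion pairs of finitely generated modules -/

section CotorsionLemmas

open Limits Abelian

variable {Λ : Type u} [Ring Λ]

theorem ExtOneVanishes.exists_extension {s : ShortComplex (ModuleCat.{u} Λ)} (hs : s.ShortExact)
    {Y : ModuleCat.{u} Λ} (h : ExtOneVanishes s.X₃ Y) (f : s.X₁ ⟶ Y) :
    ∃ g : s.X₂ ⟶ Y, s.f ≫ g = f := by
  have : Subsingleton (Ext s.X₃ Y 1) := h
  obtain ⟨x, hx⟩ := Ext.contravariant_sequence_exact₁ hs Y (Ext.mk₀ f) (add_zero 1)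
    (Subsingleton.elim _ _)
  obtain ⟨g, rfl⟩ := (Ext.mk₀_bijective _ _).2 x
  rw [Ext.mk₀_comp_mk₀] at hx
  exact ⟨g, (Ext.mk₀_bijective _ _).1 hx⟩

theorem ExtOneVanishes.exists_lift {s : ShortComplex (ModuleCat.{u} Λ)} (hs : s.ShortExact)
    {Y : ModuleCat.{u} Λ} (h : ExtOneVanishes Y s.X₁) (f : Y ⟶ s.X₃) :
    ∃ g : Y ⟶ s.X₂, g ≫ s.g = f := by
  have : Subsingleton (Ext Y s.X₁ 1) := h
  obtain ⟨x, hx⟩ := Ext.covariant_sequence_exact₃ Y hs (Ext.mk₀ f) (zero_add 1)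
    (Subsingleton.elim _ _)
  obtain ⟨g, rfl⟩ := (Ext.mk₀_bijective _ _).2 x
  rw [Ext.mk₀_comp_mk₀] at hx
  exact ⟨g, (Ext.mk₀_bijective _ _).1 hx⟩

theorem ExtOneVanishes.middle_right {s : ShortComplex (ModuleCat.{u} Λ)} (hs : s.ShortExact)
    {X : ModuleCat.{u} Λ} (h₁ : ExtOneVanishes X s.X₁) (h₃ : ExtOneVanishes X s.X₃) :
    ExtOneVanishes X s.X₂ := by
  have : Subsingleton (Ext X s.X₁ 1) := h₁
  have : Subsingleton (Ext X s.X₃ 1) := h₃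
  refine subsingleton_of_forall_eq 0 fun x => ?_
  obtain ⟨y, rfl⟩ := Ext.covariant_sequence_exact₂ X hs x (Subsingleton.elim _ _)
  rw [Subsingleton.elim y 0, Ext.zero_comp]

/-- A cover by a finitely generated projective module. -/
theorem exists_projective_cover (X : ModuleCat.{u} Λ) (hX : Module.Finite Λ X) :
    ∃ (P : ModuleCat.{u} Λ) (_ : Module.Finite Λ P ∧ Module.Projective Λ P) (f : P ⟶ X),
      Epi f := by
  obtain ⟨n, f, hf⟩ := Module.Finite.exists_fin' Λ X
  exact ⟨ModuleCat.of Λ (Fin n → Λ), ⟨inferInstanceAs (Module.Finite Λ (Fin n → Λ)),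
    inferInstanceAs (Module.Projective Λ (Fin n → Λ))⟩, ModuleCat.ofHom f,
    (ModuleCat.epi_iff_surjective _).2 hf⟩

theorem shortExact_kernel {X Y : ModuleCat.{u} Λ} (f : X ⟶ Y) [Epi f] :
    (ShortComplex.mk (kernel.ι f) f (kernel.condition f)).ShortExact where
  exact := ShortComplex.exact_kernel f

theorem shortExact_biprod (X Y : ModuleCat.{u} Λ) :
    (ShortComplex.mk (biprod.inl : X ⟶ X ⊞ Y) (biprod.snd : X ⊞ Y ⟶ Y) biprod.inl_snd).ShortExact :=
  ShortComplex.Splitting.shortExact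
    { r := biprod.fst
      s := biprod.inr }

namespace IsCompleteHereditaryCotorsionPair

variable {B A : ObjectProperty (ModuleCat.{u} Λ)} (h : IsCompleteHereditaryCotorsionPair B A)
include h

theorem extOneVanishes {X Y : ModuleCat.{u} Λ} (hX : B X) (hY : A Y) : ExtOneVanishes X Y :=
  ((h.left_iff X).1 hX).2 Y hY

theorem right_biprod {X Y : ModuleCat.{u} Λ} (hX : A X) (hY : A Y) : A (X ⊞ Y) := by
  have := h.right_le X hX
  have := h.right_le Y hY
  rw [ModuleCat.isFG_iff] at *
  refine (h.right_iff _).2 ⟨Module.Finite.equiv (ModuleCat.biprodIsoProd X Y).symm.toLinearEquiv,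
    fun Z hZ => ?_⟩
  exact (h.extOneVanishes hZ hX).middle_right (shortExact_biprod X Y) (h.extOneVanishes hZ hY)

theorem left_biprod {X Y : ModuleCat.{u} Λ} (hX : B X) (hY : B Y) : B (X ⊞ Y) :=
  h.resolving.extensions _ (shortExact_biprod X Y) hX hY

/-- Dimension shifting. For `X` in `B`, the kernel of a projective cover of `X` is again in `B`
because `B` is resolving, so `Ext²(X, s.X₁) = 0`, and the long exact sequence gives `Ext¹(X, s.X₃) =
0`. -/
theorem right_cokernel {s : ShortComplex (ModuleCat.{u} Λ)} (hs : s.ShortExact) (h₁ : A s.X₁)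
    (h₂ : A s.X₂) : A s.X₃ := by
  have := h.right_le _ h₂
  rw [ModuleCat.isFG_iff] at this
  have := hs.epi_g
  refine (h.right_iff _).2 ⟨Module.Finite.of_surjective s.g.hom
    ((ModuleCat.epi_iff_surjective _).1 this), fun X hX => ?_⟩
  obtain ⟨P, ⟨hP, hP'⟩, f, hf⟩ := exists_projective_cover X (h.left_le X hX)
  have hK : B (kernel f) :=
    h.resolving.kernels _ (shortExact_kernel f) (h.resolving.projective_mem P hP hP') hX
  have hproj : Projective P := (IsProjective.iff_projective (R := Λ) P).1 hP'
  have hE₁ : Subsingleton (Ext (kernel f) s.X₁ 1) := h.extOneVanishes hK h₁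
  have hE₂ : Subsingleton (Ext X s.X₂ 1) := h.extOneVanishes hX h₂
  have hE₃ : Subsingleton (Ext P s.X₁ 2) := Ext.subsingleton_of_projective P s.X₁ 1
  have hE₄ : ∀ y : Ext X s.X₁ 2, y = 0 := fun y => by
    obtain ⟨x, rfl⟩ := Ext.contravariant_sequence_exact₃ (shortExact_kernel f) s.X₁ y
      (hE₃.elim _ _) (show 1 + 1 = 2 from rfl)
    rw [hE₁.elim x 0, Ext.comp_zero]
  refine subsingleton_of_forall_eq 0 fun x => ?_
  obtain ⟨y, rfl⟩ := Ext.covariant_sequence_exact₃ X hs x (show 1 + 1 = 2 from rfl) (hE₄ _)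
  rw [hE₂.elim y 0, Ext.zero_comp]

theorem left_of_iso {X Y : ModuleCat.{u} Λ} (e : X ≅ Y) (hX : B X) : B Y :=
  h.resolving.summands Y X (Retract.ofIso e.symm) hX

theorem right_of_iso {X Y : ModuleCat.{u} Λ} (e : X ≅ Y) (hX : A X) : A Y := by
  refine (h.right_iff _).2 ⟨?_, fun Z hZ => ?_⟩
  · have : Module.Finite Λ X := h.right_le _ hX
    exact Module.Finite.equiv e.toLinearEquiv
  · have : Subsingleton (Ext Z X 1) := h.extOneVanishes hZ hX
    refine subsingleton_of_forall_eq 0 fun x => ?_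
    have h₁ : (x.comp (Ext.mk₀ e.inv) (add_zero 1)).comp (Ext.mk₀ e.hom) (add_zero 1) = x := by
      rw [Ext.comp_assoc_of_third_deg_zero, Ext.mk₀_comp_mk₀, e.inv_hom_id, Ext.comp_mk₀_id]
    rw [← h₁, Subsingleton.elim (x.comp (Ext.mk₀ e.inv) (add_zero 1)) 0, Ext.zero_comp]

theorem right_of_injective (Y : ModuleCat.{u} Λ) (hY : Module.Finite Λ Y) [Injective Y] : A Y :=
  (h.right_iff _).2 ⟨hY, fun X _ => Ext.subsingleton_of_injective X Y 0⟩

theorem left_of_isZero {X : ModuleCat.{u} Λ} (hX : IsZero X) : B X := by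
  have := ModuleCat.subsingleton_of_isZero hX
  exact h.resolving.projective_mem X inferInstance (Module.Projective.of_free (R := Λ))

theorem right_of_isZero {X : ModuleCat.{u} Λ} (hX : IsZero X) : A X := by
  have := ModuleCat.subsingleton_of_isZero hX
  have := hX.injective
  exact h.right_of_injective X inferInstance

end IsCompleteHereditaryCotorsionPair

theorem exists_retract_of_projective (X : ModuleCat.{u} Λ) (hX : Module.Finite Λ X)
    (hX' : Module.Projective Λ X) :
    ∃ n : ℕ, Nonempty (Retract X (ModuleCat.of Λ (Fin n → Λ))) := by
  obtain ⟨n, f, hf⟩ := Module.Finite.exists_fin' Λ X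
  obtain ⟨g, hg⟩ := Module.projective_lifting_property f LinearMap.id hf
  exact ⟨n, ⟨{ i := ModuleCat.ofHom g, r := ModuleCat.ofHom f, retract := ModuleCat.hom_ext hg }⟩⟩

/-- A power with `n + 1` factors as a biproduct. -/
def powSuccIso (M : ModuleCat.{u} Λ) (n : ℕ) :
    ModuleCat.of Λ (Fin (n + 1) → M) ≅ M ⊞ ModuleCat.of Λ (Fin n → M) :=
  (Fin.consLinearEquiv Λ fun _ => M).symm.toModuleIso ≪≫
    (ModuleCat.biprodIsoProd M (ModuleCat.of Λ (Fin n → M))).symm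

/-- Additive functors commute with finite powers. -/
theorem nonempty_pow_iso (F : ModuleCat.{u} Λ ⥤ ModuleCat.{u} Λ) [F.Additive]
    {M N : ModuleCat.{u} Λ} (e : M ≅ F.obj N) (n : ℕ) :
    Nonempty (ModuleCat.of Λ (Fin n → M) ≅ F.obj (ModuleCat.of Λ (Fin n → N))) := by
  induction n with
  | zero =>
    exact ⟨(ModuleCat.isZero_of_subsingleton _).iso
      (F.map_isZero (ModuleCat.isZero_of_subsingleton _))⟩
  | succ n ih =>
    obtain ⟨i⟩ := ih
    have := preservesBinaryBiproduct_of_preservesBiproduct F N (ModuleCat.of Λ (Fin n → N))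
    exact ⟨powSuccIso M n ≪≫ biprod.mapIso e i ≪≫
      (F.mapBiprod N (ModuleCat.of Λ (Fin n → N))).symm ≪≫ F.mapIso (powSuccIso N n).symm⟩

/-- A class of modules closed under retracts and biproducts that contains the regular module contains
all finitely generated projective modules. -/
theorem mem_of_projective (W : ObjectProperty (ModuleCat.{u} Λ)) (hΛ : W (ModuleCat.of Λ Λ))
    (hr : ∀ {X Y : ModuleCat.{u} Λ}, Retract X Y → W Y → W X) (hz : ∀ {X}, IsZero X → W X)
    (hb : ∀ {X Y : ModuleCat.{u} Λ}, W X → W Y → W (X ⊞ Y)) (X : ModuleCat.{u} Λ)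
    (hX : Module.Finite Λ X) (hX' : Module.Projective Λ X) : W X := by
  obtain ⟨n, ⟨r⟩⟩ := exists_retract_of_projective X hX hX'
  refine hr r ?_
  clear r
  induction n with
  | zero => exact hz (ModuleCat.isZero_of_subsingleton _)
  | succ n ih => exact hr (Retract.ofIso (powSuccIso (ModuleCat.of Λ Λ) n)) (hb hΛ ih)

end CotorsionLemmas

/-! ### Adjunctions that restrict to equivalences of subcategories. -/

section RestrictedAdjunction

universe v₁ v₂ u₁ u₂

variable {C : Type u₁} [Category.{v₁} C] {D : Type u₂} [Category.{v₂} D] {L : D ⥤ C} {H : C ⥤ D}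
  (adj : L ⊣ H) {A : ObjectProperty C} {G : ObjectProperty D} (hH : ∀ X, A X → G (H.obj X))
  (hL : ∀ Y, G Y → A (L.obj Y))
include hH hL

/-- The equivalence is not assumed to be compatible with the adjunction. Full faithfulness of the
restricted `H` is enough: the unit at `H X` is `H` of some `g`, and the triangle identities make `g`
inverse to the counit. -/
theorem isIso_cu_of_isEquivalence_lift
    (h : (G.lift (A.ι ⋙ H) fun X => hH X.obj X.property).IsEquivalence) {X : C} (hX : A X) :
    IsIso (cu adj X) := by
  have hfull : ∀ {Y Z : C}, A Y → A Z → ∀ f : H.obj Y ⟶ H.obj Z, ∃ g, H.map g = f := by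
    intro Y Z hY hZ f
    let Y' : A.FullSubcategory := ⟨Y, hY⟩
    let Z' : A.FullSubcategory := ⟨Z, hZ⟩
    obtain ⟨g, hg⟩ := (G.lift (A.ι ⋙ H) fun X => hH X.obj X.property).map_surjective
      (X := Y') (Y := Z') (ObjectProperty.homMk f)
    exact ⟨g.hom, G.ι.congr_map hg⟩
  have hfaithful : ∀ {Y Z : C}, A Y → A Z → ∀ f g : Y ⟶ Z, H.map f = H.map g → f = g := by
    intro Y Z hY hZ f g e
    let Y' : A.FullSubcategory := ⟨Y, hY⟩
    let Z' : A.FullSubcategory := ⟨Z, hZ⟩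
    let f' : Y' ⟶ Z' := ObjectProperty.homMk f
    let g' : Y' ⟶ Z' := ObjectProperty.homMk g
    have : f' = g' := (G.lift (A.ι ⋙ H) fun X => hH X.obj X.property).map_injective
      (ObjectProperty.hom_ext _ e)
    exact congrArg InducedCategory.Hom.hom this
  have hLH : A (L.obj (H.obj X)) := hL _ (hH _ hX)
  obtain ⟨g, hg⟩ := hfull hX hLH (un adj (H.obj X))
  have h₁ : cu adj X ≫ g = 𝟙 _ := by
    rw [← trs_map, hg, ← tr_id, trs_tr]
  refine ⟨g, h₁, hfaithful hX hX _ _ ?_⟩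
  rw [H.map_comp, hg, un_cu, H.map_id]

/-- Dually, the counit at `L Y` is `L` of a map that is inverse to the unit. -/
theorem isIso_un_of_isEquivalence_lift
    (h : (A.lift (G.ι ⋙ L) fun Y => hL Y.obj Y.property).IsEquivalence) {Y : D} (hY : G Y) :
    IsIso (un adj Y) := by
  have hfull : ∀ {X Z : D}, G X → G Z → ∀ f : L.obj X ⟶ L.obj Z, ∃ g, L.map g = f := by
    intro Y Z hY hZ f
    let Y' : G.FullSubcategory := ⟨Y, hY⟩
    let Z' : G.FullSubcategory := ⟨Z, hZ⟩
    obtain ⟨g, hg⟩ := (A.lift (G.ι ⋙ L) fun Y => hL Y.obj Y.property).map_surjective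
      (X := Y') (Y := Z') (ObjectProperty.homMk f)
    exact ⟨g.hom, A.ι.congr_map hg⟩
  have hfaithful : ∀ {X Z : D}, G X → G Z → ∀ f g : X ⟶ Z, L.map f = L.map g → f = g := by
    intro Y Z hY hZ f g e
    let Y' : G.FullSubcategory := ⟨Y, hY⟩
    let Z' : G.FullSubcategory := ⟨Z, hZ⟩
    let f' : Y' ⟶ Z' := ObjectProperty.homMk f
    let g' : Y' ⟶ Z' := ObjectProperty.homMk g
    have : f' = g' := (A.lift (G.ι ⋙ L) fun Y => hL Y.obj Y.property).map_injective
      (ObjectProperty.hom_ext _ e)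
    exact congrArg InducedCategory.Hom.hom this
  have hHL : G (H.obj (L.obj Y)) := hH _ (hL _ hY)
  obtain ⟨g, hg⟩ := hfull hHL hY (cu adj (L.obj Y))
  have h₁ : g ≫ un adj Y = 𝟙 _ := by
    rw [← tr_map, hg, ← trs_id, tr_trs]
  refine ⟨g, hfaithful hY hY _ _ ?_, h₁⟩
  rw [L.map_comp, hg, map_un_cu, L.map_id]

end RestrictedAdjunction

/-! ### Invertible units and counits for a representing bimodule. -/

section Equivalence

variable {S R V : Type u} [Ring S] [Ring R] [AddCommGroup V] [Module S V] [Module Rᵐᵒᵖ V]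
  [SMulCommClass S Rᵐᵒᵖ V]
  {A : ObjectProperty (ModuleCat.{u} Rᵐᵒᵖ)} {G : ObjectProperty (ModuleCat.{u} Sᵐᵒᵖ)}

namespace RepresentsEquivalence

variable (h : RepresentsEquivalence S R V A G)
include h

theorem isEquivalence_restrictedHom : h.restrictedHom.IsEquivalence := by
  obtain ⟨e, ⟨i⟩, -⟩ := h.exists_equivalence
  exact Functor.isEquivalence_of_iso i

theorem isEquivalence_restrictedTensor : h.restrictedTensor.IsEquivalence := by
  obtain ⟨e, -, ⟨i⟩⟩ := h.exists_equivalence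
  exact Functor.isEquivalence_of_iso i

theorem isIso_cu {X : ModuleCat.{u} Rᵐᵒᵖ} (hX : A X) :
    IsIso (cu (tensorHomAdjunction S R V) X) := by
  have := h.isEquivalence_restrictedHom
  exact isIso_cu_of_isEquivalence_lift (tensorHomAdjunction S R V)
    (fun M hM => h.hom_mem M hM) (fun N hN => h.tensor_mem N hN) this hX

theorem isIso_un {Y : ModuleCat.{u} Sᵐᵒᵖ} (hY : G Y) :
    IsIso (un (tensorHomAdjunction S R V) Y) := by
  have := h.isEquivalence_restrictedTensor
  exact isIso_un_of_isEquivalence_lift (tensorHomAdjunction S R V)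
    (fun M hM => h.hom_mem M hM) (fun N hN => h.tensor_mem N hN) this hY

end RepresentsEquivalence

end Equivalence

/-! ## The counter system of a faithfully balanced bimodule -/

section ModuleSystem

open Limits

/-- The tensor product with the regular module. -/
def tensorUnitIso (S R V : Type u) [Ring S] [Ring R] [AddCommGroup V] [Module S V] [Module Rᵐᵒᵖ V]
    [SMulCommClass S Rᵐᵒᵖ V] :
    (tensorFunctor S R V).obj (ModuleCat.of Sᵐᵒᵖ Sᵐᵒᵖ) ≅ ModuleCat.of Rᵐᵒᵖ V where
  hom := tensorDesc (X := ModuleCat.of Sᵐᵒᵖ Sᵐᵒᵖ) (M := ModuleCat.of Rᵐᵒᵖ V) (ModuleCat.ofHom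
    (Y := (homFunctor S R V).obj (ModuleCat.of Rᵐᵒᵖ V))
    { toFun := fun s => homMk (S := S) (M := ModuleCat.of Rᵐᵒᵖ V)
        { toFun := fun v => unop s • v
          map_add' := smul_add _
          map_smul' := fun r v => smul_comm _ _ _ }
      map_add' := fun s s' => hv_ext fun v => add_smul (unop s) (unop s') v
      map_smul' := fun s s' => hv_ext fun v => mul_smul (unop s') (unop s) v })
  inv := ModuleCat.ofHom (Y := (tensorFunctor S R V).obj (ModuleCat.of Sᵐᵒᵖ Sᵐᵒᵖ))
    { toFun := fun v => tm (X := ModuleCat.of Sᵐᵒᵖ Sᵐᵒᵖ) (1 : Sᵐᵒᵖ) v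
      map_add' := fun v w => tm_add_right _ v w
      map_smul' := fun r v => tm_smul_right _ r v }
  hom_inv_id := tensor_hom_ext fun x v => by
    have h := tm_smul_left (R := R) (X := ModuleCat.of Sᵐᵒᵖ Sᵐᵒᵖ) (1 : Sᵐᵒᵖ) (unop x) v
    refine h.symm.trans ?_
    have h' : (op (unop x) • (1 : Sᵐᵒᵖ) : Sᵐᵒᵖ) = x := mul_one x
    exact congrArg (fun y => tm (X := ModuleCat.of Sᵐᵒᵖ Sᵐᵒᵖ) y v) h'
  inv_hom_id := by
    ext v
    exact one_smul S v

variable {k E S R T : Type u} [CommRing k] [IsArtinianRing k] [AddCommGroup E] [Module k E]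
  [Ring S] [Ring R] [Algebra k S] [Algebra k R]
  [AddCommGroup T] [Module k T] [Module S T] [Module Rᵐᵒᵖ T] [SMulCommClass S Rᵐᵒᵖ T]
  [IsScalarTower k S T] [IsScalarTower k Rᵐᵒᵖ T]

variable (k E S R T) in
/-- The canonical map `T ⟶ Hom_S(DT, DS)`. -/
def toHomDualLeft : ModuleCat.of Rᵐᵒᵖ T ⟶
    (homFunctor R S (KDual k E T)).obj (ModuleCat.of Sᵐᵒᵖ (KDual k E S)) :=
  ModuleCat.ofHom (Y := (homFunctor R S (KDual k E T)).obj (ModuleCat.of Sᵐᵒᵖ (KDual k E S)))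
    { toFun := fun t => homMk (S := R) (M := ModuleCat.of Sᵐᵒᵖ (KDual k E S))
        { toFun := fun φ => orbLeft φ t
          map_add' := fun φ φ' => orbLeft_add_left φ φ' t
          map_smul' := fun s φ => orbLeft_op_smul φ s t }
      map_add' := fun t t' => hv_ext fun φ => orbLeft_add_right φ t t'
      map_smul' := fun r t => hv_ext fun φ => orbLeft_smul_right φ (unop r) t }

theorem hv_toHomDualLeft (t : T) (φ : KDual k E T) :
    hv (toHomDualLeft k E S R T t) φ = (orbLeft φ t : KDual k E S) := rfl

variable (k E S R T) in
/-- The canonical map `DT ⟶ Hom_R(T, DR)`. -/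
def toHomDualRight : ModuleCat.of Sᵐᵒᵖ (KDual k E T) ⟶
    (homFunctor S R T).obj (ModuleCat.of Rᵐᵒᵖ (KDual k E R)) :=
  ModuleCat.ofHom (Y := (homFunctor S R T).obj (ModuleCat.of Rᵐᵒᵖ (KDual k E R)))
    { toFun := fun φ => homMk (S := S) (M := ModuleCat.of Rᵐᵒᵖ (KDual k E R))
        { toFun := fun t => orbRight φ t
          map_add' := fun t t' => orbRight_add_right φ t t'
          map_smul' := fun r t => orbRight_smul_right φ r t }
      map_add' := fun φ φ' => hv_ext fun t => orbRight_add_left φ φ' t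
      map_smul' := fun s φ => hv_ext fun t => orbRight_op_smul φ (unop s) t }

theorem hv_toHomDualRight (t : T) (φ : KDual k E T) :
    hv (toHomDualRight k E S R T φ) t = (orbRight φ t : KDual k E R) := rfl

/-- Coinduction again: an `R`-linear map from `T` to `DR` is recovered from its values at `1`. -/
theorem isIso_toHomDualRight : IsIso (toHomDualRight k E S R T) := by
  rw [ConcreteCategory.isIso_iff_bijective]
  constructor
  · intro φ φ' h
    refine KDual.ext fun t => ?_
    have h₁ : (orbRight φ t : KDual k E R) = orbRight φ' t := by
      rw [← hv_toHomDualRight (S := S), ← hv_toHomDualRight (S := S), h]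
    have h₂ := DFunLike.congr_fun h₁ (1 : R)
    rwa [orbRight_apply, orbRight_apply, op_one, one_smul] at h₂
  · intro g
    let ψ : T → KDual k E R := fun t => hv g t
    have hadd : ∀ t t', ψ (t + t') = ψ t + ψ t' := fun t t' => hv_add_right g t t'
    have hsmul : ∀ (r : R) t (r' : R), ψ (op r • t) r' = ψ t (r * r') := fun r t r' =>
      DFunLike.congr_fun (show ψ (op r • t) = op r • ψ t from hv_smul_right g (op r) t) r'
    refine ⟨KDual.mk
      { toFun := fun t => ψ t 1
        map_add' := fun t t' => by rw [hadd, KDual.add_apply]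
        map_smul' := fun c t => by
          rw [← algebraMap_smul_right (R := R), hsmul, mul_one, RingHom.id_apply,
            Algebra.algebraMap_eq_smul_one, KDual.apply_smul] }, ?_⟩
    refine hv_ext fun t => KDual.ext fun r => ?_
    change ψ (op r • t) 1 = ψ t r
    rw [hsmul, mul_one]

section

variable (hE : IsInjectiveEnvelope k (k ⧸ Ring.jacobson k) E)
include hE

/-- By evaluation at `1`, maps from `DT` to `DS` are functionals on `DT`, and these are elements of
`T` by reflexivity. -/
theorem isIso_toHomDualLeft [Module.Finite k T] : IsIso (toHomDualLeft k E S R T) := by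
  rw [ConcreteCategory.isIso_iff_bijective]
  constructor
  · intro t t' h
    refine KDual.eq_of_forall_apply_eq hE fun φ => ?_
    have h₁ : (orbLeft φ t : KDual k E S) = orbLeft φ t' := by
      rw [← hv_toHomDualLeft (R := R), ← hv_toHomDualLeft (R := R), h]
    have h₂ := DFunLike.congr_fun h₁ (1 : S)
    rwa [orbLeft_apply, orbLeft_apply, one_smul, one_smul] at h₂
  · intro g
    let ψ : KDual k E T → KDual k E S := fun φ => hv g φ
    have hadd : ∀ φ φ', ψ (φ + φ') = ψ φ + ψ φ' := fun φ φ' => hv_add_right g φ φ'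
    have hsmul : ∀ (s : S) φ (s' : S), ψ (op s • φ) s' = ψ φ (s * s') := fun s φ s' =>
      DFunLike.congr_fun (show ψ (op s • φ) = op s • ψ φ from hv_smul_right g (op s) φ) s'
    let l : KDual k E T →ₗ[k] E :=
      { toFun := fun φ => ψ φ 1
        map_add' := fun t t' => by rw [hadd, KDual.add_apply]
        map_smul' := fun c φ => by
          have h₁ : c • φ = op (algebraMap k S c) • φ := (algebraMap_smul Sᵐᵒᵖ c φ).symm
          rw [h₁, hsmul, mul_one, RingHom.id_apply,
            Algebra.algebraMap_eq_smul_one, KDual.apply_smul] }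
    obtain ⟨t, ht⟩ := KDual.exists_apply_eq hE l
    refine ⟨t, hv_ext fun φ => KDual.ext fun s => ?_⟩
    refine (ht (op s • φ)).symm.trans ?_
    change ψ (op s • φ) 1 = ψ φ s
    rw [hsmul, mul_one]

/-- Every finitely generated module over an artin algebra `R` embeds into a power of `DR`. -/
theorem exists_mono_pow_dual [Module.Finite k R] (X : ModuleCat.{u} Rᵐᵒᵖ)
    (hX : Module.Finite Rᵐᵒᵖ X) :
    ∃ (n : ℕ) (f : X ⟶ ModuleCat.of Rᵐᵒᵖ (Fin n → ModuleCat.of Rᵐᵒᵖ (KDual k E R))), Mono f := by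
  let _ : Module k X := Module.compHom X (algebraMap k Rᵐᵒᵖ)
  have : IsScalarTower k Rᵐᵒᵖ X := IsScalarTower.of_algebraMap_smul fun _ _ => rfl
  have : Module.Finite k Rᵐᵒᵖ := Module.Finite.equiv (opLinearEquiv k : R ≃ₗ[k] Rᵐᵒᵖ)
  have : Module.Finite k X := Module.Finite.trans Rᵐᵒᵖ X
  have := KDual.finite (M := X) hE
  obtain ⟨n, χ, hχ⟩ := Module.Finite.exists_fin (R := k) (M := KDual k E X)
  let l : X →ₗ[Rᵐᵒᵖ] (Fin n → KDual k E R) :=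
    { toFun := fun x i => orbRight (χ i) x
      map_add' := fun x y => funext fun i => orbRight_add_right (χ i) x y
      map_smul' := fun r x => funext fun i => orbRight_smul_right (χ i) r x }
  refine ⟨n, ModuleCat.ofHom l, (ModuleCat.mono_iff_injective _).2 ?_⟩
  intro x y h
  have h₁ : ∀ i, χ i x = χ i y := fun i => by
    have h₂ : (orbRight (χ i) x : KDual k E R) = orbRight (χ i) y := congrFun h i
    have h₃ := DFunLike.congr_fun h₂ (1 : R)
    rwa [orbRight_apply, orbRight_apply, op_one, one_smul, one_smul] at h₃
  refine KDual.eq_of_forall_apply_eq hE fun φ => ?_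
  have hφ : φ ∈ Submodule.span k (Set.range χ) := hχ ▸ Submodule.mem_top
  induction hφ using Submodule.span_induction with
  | mem φ h => obtain ⟨i, rfl⟩ := h; exact h₁ i
  | zero => rfl
  | add φ φ' _ _ h h' => rw [KDual.add_apply, KDual.add_apply, h, h']
  | smul c φ _ h => rw [KDual.base_smul_apply, KDual.base_smul_apply, h]

/-- An additive functor that maps the regular module to `DR` maps finite free modules to powers of
`DR`, which receive embeddings from all finitely generated modules. -/
theorem exists_mono_of_iso_dual [Module.Finite k R] (F : ModuleCat.{u} Rᵐᵒᵖ ⥤ ModuleCat.{u} Rᵐᵒᵖ)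
    [F.Additive]
    (e : ModuleCat.of Rᵐᵒᵖ (KDual k E R) ≅ F.obj (ModuleCat.of Rᵐᵒᵖ Rᵐᵒᵖ))
    (X : ModuleCat.{u} Rᵐᵒᵖ) (hX : Module.Finite Rᵐᵒᵖ X) :
    ∃ (Y : ModuleCat.{u} Rᵐᵒᵖ) (_ : Module.Finite Rᵐᵒᵖ Y ∧ Module.Projective Rᵐᵒᵖ Y)
      (f : X ⟶ F.obj Y), Mono f := by
  obtain ⟨n, f, hf⟩ := exists_mono_pow_dual hE X hX
  obtain ⟨i⟩ := nonempty_pow_iso F e n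
  exact ⟨ModuleCat.of Rᵐᵒᵖ (Fin n → Rᵐᵒᵖ), ⟨inferInstanceAs (Module.Finite Rᵐᵒᵖ (Fin n → Rᵐᵒᵖ)),
    inferInstanceAs (Module.Projective Rᵐᵒᵖ (Fin n → Rᵐᵒᵖ))⟩, f ≫ i.hom, inferInstance⟩

end

theorem isNoetherianRing_op (k R : Type u) [CommRing k] [IsArtinianRing k] [Ring R] [Algebra k R]
    [Module.Finite k R] : IsNoetherianRing Rᵐᵒᵖ :=
  have : Module.Finite k Rᵐᵒᵖ := Module.Finite.equiv (opLinearEquiv k : R ≃ₗ[k] Rᵐᵒᵖ)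
  IsNoetherianRing.of_finite k Rᵐᵒᵖ

theorem finite_dual_of_finite (hE : IsInjectiveEnvelope k (k ⧸ Ring.jacobson k) E)
    [Module.Finite k T] : Module.Finite Sᵐᵒᵖ (KDual k E T) :=
  have := KDual.finite (M := T) hE
  Module.Finite.of_restrictScalars_finite k _ _

theorem isFG_of_epi {Λ : Type u} [Ring Λ] {X Y : ModuleCat.{u} Λ} (f : X ⟶ Y) [Epi f]
    (hX : ModuleCat.isFG Λ X) : ModuleCat.isFG Λ Y := by
  rw [ModuleCat.isFG_iff] at *
  exact Module.Finite.of_surjective f.hom ((ModuleCat.epi_iff_surjective f).1 inferInstance)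

theorem isFG_of_mono {Λ : Type u} [Ring Λ] [IsNoetherianRing Λ] {X Y : ModuleCat.{u} Λ} (f : X ⟶ Y)
    [Mono f] (hY : ModuleCat.isFG Λ Y) : ModuleCat.isFG Λ X := by
  rw [ModuleCat.isFG_iff] at *
  exact Module.Finite.of_injective f.hom ((ModuleCat.mono_iff_injective f).1 inferInstance)

theorem isFG_biprod {Λ : Type u} [Ring Λ] {X Y : ModuleCat.{u} Λ} (hX : ModuleCat.isFG Λ X)
    (hY : ModuleCat.isFG Λ Y) : ModuleCat.isFG Λ (X ⊞ Y) := by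
  rw [ModuleCat.isFG_iff] at *
  exact Module.Finite.equiv (ModuleCat.biprodIsoProd X Y).symm.toLinearEquiv

/-- Finitely generated projective modules. -/
def isFGProjective (Λ : Type u) [Ring Λ] : ObjectProperty (ModuleCat.{u} Λ) := fun X =>
  Module.Finite Λ X ∧ Module.Projective Λ X

/-- An additive functor that maps the regular module into a class of a cotorsion pair maps all
finitely generated projective modules into it. -/
theorem map_mem_of_projective {Λ Γ : Type u} [Ring Λ] [Ring Γ]
    {B A : ObjectProperty (ModuleCat.{u} Γ)} (h : IsCompleteHereditaryCotorsionPair B A)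
    (F : ModuleCat.{u} Λ ⥤ ModuleCat.{u} Γ) [F.Additive] (hF : B (F.obj (ModuleCat.of Λ Λ)))
    {X : ModuleCat.{u} Λ} (hX : isFGProjective Λ X) : B (F.obj X) :=
  mem_of_projective (fun X => B (F.obj X)) hF
    (fun r hY => h.resolving.summands _ _ (r.map F) hY)
    (fun hX => h.left_of_isZero (F.map_isZero hX))
    (fun {X Y} hX hY =>
      have := preservesBinaryBiproduct_of_preservesBiproduct F X Y
      h.left_of_iso (F.mapBiprod X Y).symm (h.left_biprod hX hY)) X hX.1 hX.2

section

variable [Module.Finite k S] [Module.Finite k R] [Module.Finite k T]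
  (hE : IsInjectiveEnvelope k (k ⧸ Ring.jacobson k) E)
  {B A : ObjectProperty (ModuleCat.{u} Rᵐᵒᵖ)} {G K : ObjectProperty (ModuleCat.{u} Sᵐᵒᵖ)}
  (hBA : IsCompleteHereditaryCotorsionPair B A) (hGK : IsCompleteHereditaryCotorsionPair G K)
  (hAG : RepresentsEquivalence S R T A G) (hKB : RepresentsEquivalence R S (KDual k E T) K B)

include hE in
theorem right_mem_dual (h : IsCompleteHereditaryCotorsionPair B A) :
    A (ModuleCat.of Rᵐᵒᵖ (KDual k E R)) := by
  have := hE.1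
  have h₁ : Module.Injective Rᵐᵒᵖ (KDual k E R) := KDual.injective_algebra
  have : Injective (ModuleCat.of Rᵐᵒᵖ (KDual k E R)) :=
    (Module.injective_iff_injective_object Rᵐᵒᵖ (KDual k E R)).1 h₁
  exact h.right_of_injective _ (finite_dual_of_finite hE)

-- The module is `DT`, which is `Hom_R(T, DR)`; the injective module `DR` lies in `A`, and `Hom_R(T,
-- -)` maps `A` to `G`.
include hE hBA hAG hGK in
theorem left_mem_tensor_dual :
    G ((tensorFunctor R S (KDual k E T)).obj (ModuleCat.of Rᵐᵒᵖ Rᵐᵒᵖ)) := by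
  have := isIso_toHomDualRight (k := k) (E := E) (S := S) (R := R) (T := T)
  exact hGK.left_of_iso ((tensorUnitIso R S (KDual k E T)).trans
    (asIso (toHomDualRight k E S R T))).symm (hAG.hom_mem _ (right_mem_dual hE hBA))

-- The module is `T`, which is `Hom_S(DT, DS)`; the injective module `DS` lies in `K`, and
-- `Hom_S(DT, -)` maps `K` to `B`.
include hE hBA hGK hKB in
theorem left_mem_tensor :
    B ((tensorFunctor S R T).obj (ModuleCat.of Sᵐᵒᵖ Sᵐᵒᵖ)) := by
  have := isIso_toHomDualLeft (S := S) (R := R) (T := T) hE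
  exact hBA.left_of_iso ((tensorUnitIso S R T).trans
    (asIso (toHomDualLeft k E S R T))).symm (hKB.hom_mem _ (right_mem_dual hE hGK))

-- The counit at `DR`, an object of `A`, is invertible, and `Hom_R(T, DR) ≅ DT`; so `DR ≅ DT ⊗_S T`.
-- This is the source of the embeddings in the counter system.
include hE hBA hAG in
theorem nonempty_dual_iso_right : Nonempty (ModuleCat.of Rᵐᵒᵖ (KDual k E R) ≅
    (tensorFunctor R S (KDual k E T) ⋙ tensorFunctor S R T).obj (ModuleCat.of Rᵐᵒᵖ Rᵐᵒᵖ)) := by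
  have := isIso_toHomDualRight (k := k) (E := E) (S := S) (R := R) (T := T)
  have := hAG.isIso_cu (right_mem_dual hE hBA)
  exact ⟨(asIso (cu (tensorHomAdjunction S R T) (ModuleCat.of Rᵐᵒᵖ (KDual k E R)))).symm ≪≫
    (tensorFunctor S R T).mapIso ((asIso (toHomDualRight k E S R T)).symm ≪≫
      (tensorUnitIso R S (KDual k E T)).symm)⟩

include hE hGK hKB in
theorem nonempty_dual_iso_left : Nonempty (ModuleCat.of Sᵐᵒᵖ (KDual k E S) ≅
    (tensorFunctor S R T ⋙ tensorFunctor R S (KDual k E T)).obj (ModuleCat.of Sᵐᵒᵖ Sᵐᵒᵖ)) := by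
  have := isIso_toHomDualLeft (S := S) (R := R) (T := T) hE
  have := hKB.isIso_cu (right_mem_dual hE hGK)
  exact ⟨(asIso (cu (tensorHomAdjunction R S (KDual k E T))
      (ModuleCat.of Sᵐᵒᵖ (KDual k E S)))).symm ≪≫
    (tensorFunctor R S (KDual k E T)).mapIso ((asIso (toHomDualLeft k E S R T)).symm ≪≫
      (tensorUnitIso S R T).symm)⟩

/-- The counter system of the functors `Hom_R(T, -)`, `- ⊗_S T`, `Hom_S(DT, -)` and `- ⊗_R DT`. -/
def moduleSystem : CounterSystem (ModuleCat.{u} Rᵐᵒᵖ) (ModuleCat.{u} Sᵐᵒᵖ) :=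
  have := isNoetherianRing_op k R
  have := isNoetherianRing_op k S
  have : Module.Finite Rᵐᵒᵖ T := Module.Finite.of_restrictScalars_finite k _ _
  have : Module.Finite Sᵐᵒᵖ (KDual k E T) := finite_dual_of_finite hE
  { L := tensorFunctor S R T
    H := homFunctor S R T
    L' := tensorFunctor R S (KDual k E T)
    H' := homFunctor R S (KDual k E T)
    adj := tensorHomAdjunction S R T
    adj' := tensorHomAdjunction R S (KDual k E T)
    additiveL := inferInstance
    additiveH := inferInstance
    additiveL' := inferInstance
    additiveH' := inferInstance
    FC := ModuleCat.isFG Rᵐᵒᵖ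
    A := A
    B := B
    P := isFGProjective Rᵐᵒᵖ
    FD := ModuleCat.isFG Sᵐᵒᵖ
    G := G
    K := K
    Q := isFGProjective Sᵐᵒᵖ
    FC_epi := fun f _ h => isFG_of_epi f h
    FC_mono := fun f _ h => isFG_of_mono f h
    FC_biprod := isFG_biprod
    FD_epi := fun f _ h => isFG_of_epi f h
    FD_mono := fun f _ h => isFG_of_mono f h
    FD_biprod := isFG_biprod
    FC_L := fun {Y} (h : Module.Finite Sᵐᵒᵖ Y) => finite_tensor Y
    FD_H := fun {X} (h : Module.Finite Rᵐᵒᵖ X) => finite_hom k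
      (fun c t => by rw [algebraMap_smul, algebraMap_smul_right]) X
    FD_L' := fun {X} (h : Module.Finite Rᵐᵒᵖ X) => finite_tensor X
    FC_H' := fun {Y} (h : Module.Finite Sᵐᵒᵖ Y) => finite_hom k
      (fun c φ => KDual.ext fun t => by
        rw [KDual.smul_apply, KDual.op_smul_apply, algebraMap_smul, algebraMap_smul_right]) Y
    A_le := hBA.right_le
    B_le := hBA.left_le
    G_le := hGK.left_le
    K_le := hGK.right_le
    A_biprod := hBA.right_biprod
    G_biprod := hGK.left_biprod
    extC := fun hs hB _ hY f => (hBA.extOneVanishes hB hY).exists_extension hs f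
    liftC := fun hs hA _ hY f => (hBA.extOneVanishes hY hA).exists_lift hs f
    extD := fun hs hB _ hY f => (hGK.extOneVanishes hB hY).exists_extension hs f
    liftD := fun hs hA _ hY f => (hGK.extOneVanishes hY hA).exists_lift hs f
    B_kernel := fun hs => hBA.resolving.kernels _ hs
    G_kernel := fun hs => hGK.resolving.kernels _ hs
    K_cokernel := fun hs => hGK.right_cokernel hs
    preenvelope := fun {X} h => hBA.preenvelope X h
    precover := fun {X} h => hGK.precover X h
    P_projective := fun {X} h => (IsProjective.iff_projective (R := Rᵐᵒᵖ) X).1 h.2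
    P_le := fun X h => hBA.resolving.projective_mem X h.1 h.2
    P_cover := fun {X} h => exists_projective_cover X h
    Q_projective := fun {X} h => (IsProjective.iff_projective (R := Sᵐᵒᵖ) X).1 h.2
    Q_le := fun X h => hGK.resolving.projective_mem X h.1 h.2
    Q_cover := fun {X} h => exists_projective_cover X h
    A_H := fun {X} h => hAG.hom_mem X h
    G_L := fun {X} h => hAG.tensor_mem X h
    B_L' := fun {X} h => hKB.tensor_mem X h
    K_H' := fun {X} h => hKB.hom_mem X h
    isIso_cu := hAG.isIso_cu
    isIso_un := hAG.isIso_un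
    isIso_cu' := hKB.isIso_cu
    isIso_un' := hKB.isIso_un
    Q_L := map_mem_of_projective hBA _ (left_mem_tensor hE hBA hGK hKB)
    P_L' := map_mem_of_projective hGK _ (left_mem_tensor_dual hE hBA hGK hAG)
    P_embedding := fun {X} h =>
      (nonempty_dual_iso_right hE hBA hAG).elim fun e => exists_mono_of_iso_dual hE _ e X h
    Q_embedding := fun {X} h =>
      (nonempty_dual_iso_left hE hGK hKB).elim fun e => exists_mono_of_iso_dual hE _ e X h }

end

end ModuleSystem

/-! ## Graded objects -/

section Graded

universe v₁ v₂ u₁ u₂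

open Limits

section

variable {C : Type u₁} [Category.{v₁} C] [Abelian C] {D : Type u₂} [Category.{v₂} D] [Abelian D]

/-- Graded objects with components in `W`, almost all of them zero. -/
def graded (W : ObjectProperty C) : ObjectProperty (Discrete ℤ ⥤ C) := fun X =>
  (∀ i, W (X.obj i)) ∧ {i : Discrete ℤ | ¬ IsZero (X.obj i)}.Finite

/-- A graded object with given components. -/
abbrev gradedObj (X : Discrete ℤ → C) : Discrete ℤ ⥤ C := Discrete.functor fun i => X ⟨i⟩

/-- A map of graded objects with given components. -/
abbrev gradedHom {X Y : Discrete ℤ ⥤ C} (f : ∀ i, X.obj i ⟶ Y.obj i) : X ⟶ Y :=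
  Discrete.natTrans f

theorem graded_mono {W W' : ObjectProperty C} (h : W ≤ W') : graded W ≤ graded W' :=
  fun _ hX => ⟨fun i => h _ (hX.1 i), hX.2⟩

theorem graded_of_isZero {W W' : ObjectProperty C} {X Y : Discrete ℤ ⥤ C} (hX : graded W X)
    (h : ∀ i, W' (Y.obj i)) (h' : ∀ i, IsZero (X.obj i) → IsZero (Y.obj i)) : graded W' Y :=
  ⟨h, hX.2.subset fun i hi hX => hi (h' i hX)⟩

theorem graded_map {W : ObjectProperty C} {W' : ObjectProperty D} (F : C ⥤ D) [F.Additive]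
    (h : ∀ {X}, W X → W' (F.obj X)) {X : Discrete ℤ ⥤ C} (hX : graded W X) :
    graded W' (((Functor.whiskeringRight (Discrete ℤ) C D).obj F).obj X) :=
  ⟨fun i => h (hX.1 i), hX.2.subset fun _ hi hX => hi (F.map_isZero hX)⟩

theorem graded_reindex {W : ObjectProperty C} (e : Discrete ℤ ≌ Discrete ℤ) {X : Discrete ℤ ⥤ C}
    (hX : graded W X) : graded W (((Functor.whiskeringLeft _ _ C).obj e.functor).obj X) := by
  refine ⟨fun i => hX.1 _, ?_⟩
  refine Set.Finite.of_finite_image (f := e.functor.obj) (hX.2.subset ?_) ?_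
  · rintro _ ⟨i, hi, rfl⟩
    exact hi
  · intro i _ j _ hij
    have h₁ : e.inverse.obj (e.functor.obj i) = e.inverse.obj (e.functor.obj j) := by
      rw [show e.functor.obj i = e.functor.obj j from hij]
    have h₂ : ∀ i, e.inverse.obj (e.functor.obj i) = i := fun i =>
      Discrete.ext (Discrete.eq_of_hom (e.unitInv.app i))
    rw [← h₂ i, ← h₂ j, h₁]

theorem graded_biprod {W : ObjectProperty C} (hW : ∀ {X Y}, W X → W Y → W (X ⊞ Y))
    (hi : ∀ {X Y}, (X ≅ Y) → W X → W Y) {X Y : Discrete ℤ ⥤ C} (hX : graded W X)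
    (hY : graded W Y) : graded W (X ⊞ Y) := by
  have e : ∀ i, X.obj i ⊞ Y.obj i ≅ (X ⊞ Y).obj i := fun i =>
    have := preservesBinaryBiproduct_of_preservesBiproduct ((evaluation (Discrete ℤ) C).obj i) X Y
    (((evaluation (Discrete ℤ) C).obj i).mapBiprod X Y).symm
  refine ⟨fun i => hi (e i) (hW (hX.1 i) (hY.1 i)), (hX.2.union hY.2).subset fun i hi => ?_⟩
  by_contra hn
  rw [Set.mem_union, not_or] at hn
  have h₁ : IsZero (X.obj i) := not_not.1 hn.1
  have h₂ : IsZero (Y.obj i) := not_not.1 hn.2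
  exact hi (((biprod_isZero_iff _ _).2 ⟨h₁, h₂⟩).of_iso (e i).symm)

theorem shortExact_app {s : ShortComplex (Discrete ℤ ⥤ C)} (hs : s.ShortExact) (i : Discrete ℤ) :
    (s.map ((evaluation (Discrete ℤ) C).obj i)).ShortExact :=
  hs.map_of_exact _

theorem shortExact_of_app {X Y Z : Discrete ℤ ⥤ C} (f : X ⟶ Y) (g : Y ⟶ Z) (w : f ≫ g = 0)
    (w' : ∀ i, f.app i ≫ g.app i = 0)
    (h : ∀ i, (ShortComplex.mk (f.app i) (g.app i) (w' i)).ShortExact) :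
    (ShortComplex.mk f g w).ShortExact := by
  have : ∀ i, Mono (f.app i) := fun i => (h i).mono_f
  have : ∀ i, Epi (g.app i) := fun i => (h i).epi_g
  refine ShortComplex.ShortExact.mk' ?_ (NatTrans.mono_of_mono_app f) (NatTrans.epi_of_epi_app g)
  have : Mono f := NatTrans.mono_of_mono_app f
  refine ShortComplex.exact_of_f_is_kernel _ (KernelFork.IsLimit.ofι' f w fun {W} k hk =>
    ⟨gradedHom fun i => (h i).exact.lift (k.app i) (NatTrans.congr_app hk i), ?_⟩)
  ext i
  exact (h i).exact.lift_f (k.app i) _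

/-- The shift of the index set. -/
def shiftIndex : Discrete ℤ ≌ Discrete ℤ :=
  Discrete.equivalence ⟨fun i => i - 1, fun i => i + 1, fun i => sub_add_cancel i 1,
    fun i => add_sub_cancel_right i 1⟩

/-- Degreewise application of a functor. -/
abbrev degreewise (F : C ⥤ D) : (Discrete ℤ ⥤ C) ⥤ (Discrete ℤ ⥤ D) :=
  (Functor.whiskeringRight (Discrete ℤ) C D).obj F

variable (C) in
/-- The shift `(X⟨-1⟩) i = X (i - 1)`. -/
abbrev shiftDown : (Discrete ℤ ⥤ C) ⥤ (Discrete ℤ ⥤ C) :=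
  (Functor.whiskeringLeft (Discrete ℤ) (Discrete ℤ) C).obj shiftIndex.functor

variable (C) in
/-- The shift `(X⟨1⟩) i = X (i + 1)`. -/
abbrev shiftUp : (Discrete ℤ ⥤ C) ⥤ (Discrete ℤ ⥤ C) :=
  (Functor.whiskeringLeft (Discrete ℤ) (Discrete ℤ) C).obj shiftIndex.inverse

theorem graded_shiftDown {W : ObjectProperty C} {X : Discrete ℤ ⥤ C} (hX : graded W X) :
    graded W ((shiftDown C).obj X) := graded_reindex shiftIndex hX

theorem graded_shiftUp {W : ObjectProperty C} {X : Discrete ℤ ⥤ C} (hX : graded W X) :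
    graded W ((shiftUp C).obj X) := graded_reindex shiftIndex.symm hX

variable (C) in
/-- The two shifts form an equivalence. -/
abbrev shiftEquivalence : (Discrete ℤ ⥤ C) ≌ (Discrete ℤ ⥤ C) := shiftIndex.congrLeft

instance additive_degreewise (F : C ⥤ D) [F.Additive] : (degreewise F).Additive where
  map_add {X Y f g} := by
    ext i
    exact F.map_add

instance additive_shiftDown : (shiftDown C).Additive where
  map_add := rfl

instance additive_shiftUp : (shiftUp C).Additive where
  map_add := rfl

variable {L : D ⥤ C} {H : C ⥤ D} (adj : L ⊣ H)

/-- The degreewise adjunction. -/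
abbrev gradedAdj : degreewise L ⊣ degreewise H := adj.whiskerRight (Discrete ℤ)

/-- The degreewise adjunction, shifted. -/
abbrev shiftedAdj : shiftUp D ⋙ degreewise L ⊣ degreewise H ⋙ shiftDown D :=
  (shiftEquivalence D).toAdjunction.comp (gradedAdj adj)

theorem un_gradedAdj_app (Y : Discrete ℤ ⥤ D) (i : Discrete ℤ) :
    (un (gradedAdj adj) Y).app i = un adj (Y.obj i) := by
  simp [un]

theorem cu_gradedAdj_app (X : Discrete ℤ ⥤ C) (i : Discrete ℤ) :
    (cu (gradedAdj adj) X).app i = cu adj (X.obj i) := by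
  simp [cu]

theorem isIso_un_gradedAdj {Y : Discrete ℤ ⥤ D} (h : ∀ i, IsIso (un adj (Y.obj i))) :
    IsIso (un (gradedAdj adj) Y) := by
  have : ∀ i, IsIso ((un (gradedAdj adj) Y).app i) := fun i => by
    rw [un_gradedAdj_app]
    exact h i
  exact NatIso.isIso_of_isIso_app _

theorem isIso_cu_gradedAdj {X : Discrete ℤ ⥤ C} (h : ∀ i, IsIso (cu adj (X.obj i))) :
    IsIso (cu (gradedAdj adj) X) := by
  have : ∀ i, IsIso ((cu (gradedAdj adj) X).app i) := fun i => by
    rw [cu_gradedAdj_app]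
    exact h i
  exact NatIso.isIso_of_isIso_app _

theorem isIso_un_shiftedAdj {Y : Discrete ℤ ⥤ D} (h : ∀ i, IsIso (un adj (Y.obj i))) :
    IsIso (un (shiftedAdj adj) Y) := by
  have h₁ : IsIso (un (gradedAdj adj) ((shiftUp D).obj Y)) := isIso_un_gradedAdj adj fun i => h _
  have h₂ : un (shiftedAdj adj) Y = (shiftEquivalence D).unit.app Y ≫
      (shiftDown D).map (un (gradedAdj adj) ((shiftUp D).obj Y)) :=
    Adjunction.comp_unit_app _ _ _
  have h₃ : IsIso ((shiftEquivalence D).unit.app Y) :=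
    inferInstanceAs (IsIso ((shiftEquivalence D).unitIso.hom.app Y))
  have h₄ := (shiftDown D).map_isIso (un (gradedAdj adj) ((shiftUp D).obj Y))
  rw [h₂]
  exact IsIso.comp_isIso' h₃ h₄

theorem isIso_cu_shiftedAdj {X : Discrete ℤ ⥤ C} (h : ∀ i, IsIso (cu adj (X.obj i))) :
    IsIso (cu (shiftedAdj adj) X) := by
  have h₁ : IsIso (cu (gradedAdj adj) X) := isIso_cu_gradedAdj adj fun i => h _
  have h₂ : cu (shiftedAdj adj) X =
      (degreewise L).map ((shiftEquivalence D).counit.app ((degreewise H).obj X)) ≫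
        cu (gradedAdj adj) X := Adjunction.comp_counit_app _ _ _
  have h₃ : IsIso ((shiftEquivalence D).counit.app ((degreewise H).obj X)) :=
    inferInstanceAs (IsIso ((shiftEquivalence D).counitIso.hom.app _))
  have h₄ := (degreewise L).map_isIso ((shiftEquivalence D).counit.app ((degreewise H).obj X))
  rw [h₂]
  exact IsIso.comp_isIso' h₄ h₁

end

/-! ### Degreewise covers, embeddings, preenvelopes and lifts. -/

section

variable {C : Type u₁} [Category.{v₁} C] [Abelian C]

theorem shortExact_of_isZero {X : C} (hX : IsZero X) :
    (ShortComplex.mk (𝟙 X) (0 : X ⟶ X) comp_zero).ShortExact where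
  exact := ShortComplex.exact_of_isZero_X₂ _ hX
  mono_f := inferInstanceAs (Mono (𝟙 X))
  epi_g := ⟨fun _ _ _ => hX.eq_of_src _ _⟩

theorem projective_graded {W : ObjectProperty C} (hW : ∀ {X}, W X → Projective X)
    {X : Discrete ℤ ⥤ C} (hX : graded W X) : Projective X where
  factors {Y Z} f e he := by
    have : ∀ i, Projective (X.obj i) := fun i => hW (hX.1 i)
    refine ⟨gradedHom fun i => Projective.factorThru (f.app i) (e.app i), ?_⟩
    ext i
    exact Projective.factorThru_comp _ _

variable {FC P A B : ObjectProperty C}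

theorem exists_graded_cover (hz : ∀ {X}, IsZero X → P X)
    (h : ∀ {X : C}, FC X → ∃ (Y : C) (_ : P Y) (f : Y ⟶ X), Epi f) {X : Discrete ℤ ⥤ C}
    (hX : graded FC X) : ∃ (Y : Discrete ℤ ⥤ C) (_ : graded P Y) (f : Y ⟶ X), Epi f := by
  have : ∀ i, ∃ (Y : C) (_ : P Y) (f : Y ⟶ X.obj i), Epi f ∧ (IsZero (X.obj i) → IsZero Y) := by
    intro i
    -- Where a component vanishes the trivial choice is made, so that the result keeps finite
    -- support.
    by_cases hi : IsZero (X.obj i)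
    · exact ⟨X.obj i, hz hi, 𝟙 _, inferInstance, id⟩
    · obtain ⟨Y, hY, f, hf⟩ := h (hX.1 i)
      exact ⟨Y, hY, f, hf, fun h => (hi h).elim⟩
  choose Y hY f hf hz' using this
  refine ⟨gradedObj Y, graded_of_isZero hX hY hz', gradedHom f, ?_⟩
  have : ∀ i, Epi ((gradedHom f : gradedObj Y ⟶ X).app i) := hf
  exact NatTrans.epi_of_epi_app _

theorem exists_graded_embedding (hz : ∀ {X}, IsZero X → P X) (F : C ⥤ C)
    (h : ∀ {X : C}, FC X → ∃ (Y : C) (_ : P Y) (f : X ⟶ F.obj Y), Mono f) {X : Discrete ℤ ⥤ C}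
    (hX : graded FC X) :
    ∃ (Y : Discrete ℤ ⥤ C) (_ : graded P Y) (f : X ⟶ (degreewise F).obj Y), Mono f := by
  have : ∀ i, ∃ (Y : C) (_ : P Y) (f : X.obj i ⟶ F.obj Y), Mono f ∧
      (IsZero (X.obj i) → IsZero Y) := by
    intro i
    by_cases hi : IsZero (X.obj i)
    · exact ⟨X.obj i, hz hi, 0, ⟨fun _ _ _ => hi.eq_of_tgt _ _⟩, id⟩
    · obtain ⟨Y, hY, f, hf⟩ := h (hX.1 i)
      exact ⟨Y, hY, f, hf, fun h => (hi h).elim⟩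
  choose Y hY f hf hz' using this
  let g : X ⟶ (degreewise F).obj (gradedObj Y) := gradedHom f
  have : ∀ i, Mono (g.app i) := hf
  exact ⟨gradedObj Y, graded_of_isZero hX hY hz', g, NatTrans.mono_of_mono_app _⟩

/-- The generator is shifted down in advance, to cancel the upward shift that the second adjunction
introduces. -/
theorem exists_graded_shifted_embedding (hz : ∀ {X}, IsZero X → P X) (F : C ⥤ C)
    (h : ∀ {X : C}, FC X → ∃ (Y : C) (_ : P Y) (f : X ⟶ F.obj Y), Mono f) {X : Discrete ℤ ⥤ C}
    (hX : graded FC X) :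
    ∃ (Y : Discrete ℤ ⥤ C) (_ : graded P Y) (f : X ⟶ (degreewise F).obj ((shiftUp C).obj Y)),
      Mono f := by
  obtain ⟨Y, hY, f, hf⟩ := exists_graded_embedding hz F h hX
  have h₃ : IsIso ((shiftEquivalence C).counitInv.app Y) :=
    inferInstanceAs (IsIso ((shiftEquivalence C).counitIso.inv.app Y))
  have h₄ := (degreewise F).map_isIso ((shiftEquivalence C).counitInv.app Y)
  have h₅ : Mono ((degreewise F).map ((shiftEquivalence C).counitInv.app Y)) :=
    IsIso.mono_of_iso _
  exact ⟨(shiftDown C).obj Y, graded_shiftDown hY,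
    f ≫ (degreewise F).map ((shiftEquivalence C).counitInv.app Y), mono_comp' hf h₅⟩

theorem exists_graded_preenvelope (hA : ∀ {X}, IsZero X → A X) (hB : ∀ {X}, IsZero X → B X)
    (h : ∀ {X : C}, FC X → ∃ (Y Z : C) (f : X ⟶ Y) (g : Y ⟶ Z) (w : f ≫ g = 0),
      (ShortComplex.mk f g w).ShortExact ∧ A Y ∧ B Z) {X : Discrete ℤ ⥤ C} (hX : graded FC X) :
    ∃ (Y Z : Discrete ℤ ⥤ C) (f : X ⟶ Y) (g : Y ⟶ Z) (w : f ≫ g = 0),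
      (ShortComplex.mk f g w).ShortExact ∧ graded A Y ∧ graded B Z := by
  have : ∀ i, ∃ (Y Z : C) (f : X.obj i ⟶ Y) (g : Y ⟶ Z) (w : f ≫ g = 0),
      (ShortComplex.mk f g w).ShortExact ∧ A Y ∧ B Z ∧
        (IsZero (X.obj i) → IsZero Y) ∧ (IsZero (X.obj i) → IsZero Z) := by
    intro i
    by_cases hi : IsZero (X.obj i)
    · exact ⟨_, _, _, _, _, shortExact_of_isZero hi, hA hi, hB hi, id, id⟩
    · obtain ⟨Y, Z, f, g, w, hs, hY, hZ⟩ := h (hX.1 i)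
      exact ⟨Y, Z, f, g, w, hs, hY, hZ, fun h => (hi h).elim, fun h => (hi h).elim⟩
  choose Y Z f g w hs hY hZ hYz hZz using this
  let f' : X ⟶ gradedObj Y := gradedHom f
  let g' : gradedObj Y ⟶ gradedObj Z := gradedHom g
  have w' : f' ≫ g' = 0 := by
    ext i
    exact w i
  exact ⟨gradedObj Y, gradedObj Z, f', g', w', shortExact_of_app f' g' w' w hs,
    graded_of_isZero hX hY hYz, graded_of_isZero hX hZ hZz⟩

theorem exists_graded_precover (hA : ∀ {X}, IsZero X → A X) (hB : ∀ {X}, IsZero X → B X)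
    (h : ∀ {X : C}, FC X → ∃ (Y Z : C) (f : Y ⟶ Z) (g : Z ⟶ X) (w : f ≫ g = 0),
      (ShortComplex.mk f g w).ShortExact ∧ A Y ∧ B Z) {X : Discrete ℤ ⥤ C} (hX : graded FC X) :
    ∃ (Y Z : Discrete ℤ ⥤ C) (f : Y ⟶ Z) (g : Z ⟶ X) (w : f ≫ g = 0),
      (ShortComplex.mk f g w).ShortExact ∧ graded A Y ∧ graded B Z := by
  have : ∀ i, ∃ (Y Z : C) (f : Y ⟶ Z) (g : Z ⟶ X.obj i) (w : f ≫ g = 0),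
      (ShortComplex.mk f g w).ShortExact ∧ A Y ∧ B Z ∧
        (IsZero (X.obj i) → IsZero Y) ∧ (IsZero (X.obj i) → IsZero Z) := by
    intro i
    by_cases hi : IsZero (X.obj i)
    · exact ⟨_, _, _, _, _, shortExact_of_isZero hi, hA hi, hB hi, id, id⟩
    · obtain ⟨Y, Z, f, g, w, hs, hY, hZ⟩ := h (hX.1 i)
      exact ⟨Y, Z, f, g, w, hs, hY, hZ, fun h => (hi h).elim, fun h => (hi h).elim⟩
  choose Y Z f g w hs hY hZ hYz hZz using this
  let f' : gradedObj Y ⟶ gradedObj Z := gradedHom f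
  let g' : gradedObj Z ⟶ X := gradedHom g
  have w' : f' ≫ g' = 0 := by
    ext i
    exact w i
  exact ⟨gradedObj Y, gradedObj Z, f', g', w', shortExact_of_app f' g' w' w hs,
    graded_of_isZero hX hY hYz, graded_of_isZero hX hZ hZz⟩

theorem exists_graded_extension
    (h : ∀ {s : ShortComplex C}, s.ShortExact → B s.X₃ → ∀ {Y : C}, A Y → ∀ f : s.X₁ ⟶ Y,
      ∃ g : s.X₂ ⟶ Y, s.f ≫ g = f) {s : ShortComplex (Discrete ℤ ⥤ C)} (hs : s.ShortExact)
    (hB : graded B s.X₃) {Y : Discrete ℤ ⥤ C} (hY : graded A Y) (f : s.X₁ ⟶ Y) :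
    ∃ g : s.X₂ ⟶ Y, s.f ≫ g = f := by
  have : ∀ i, ∃ g : s.X₂.obj i ⟶ Y.obj i, s.f.app i ≫ g = f.app i := fun i =>
    h (shortExact_app hs i) (hB.1 i) (hY.1 i) (f.app i)
  choose g hg using this
  refine ⟨gradedHom g, ?_⟩
  ext i
  exact hg i

theorem exists_graded_lift
    (h : ∀ {s : ShortComplex C}, s.ShortExact → A s.X₁ → ∀ {Y : C}, B Y → ∀ f : Y ⟶ s.X₃,
      ∃ g : Y ⟶ s.X₂, g ≫ s.g = f) {s : ShortComplex (Discrete ℤ ⥤ C)} (hs : s.ShortExact)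
    (hA : graded A s.X₁) {Y : Discrete ℤ ⥤ C} (hY : graded B Y) (f : Y ⟶ s.X₃) :
    ∃ g : Y ⟶ s.X₂, g ≫ s.g = f := by
  have : ∀ i, ∃ g : Y.obj i ⟶ s.X₂.obj i, g ≫ s.g.app i = f.app i := fun i =>
    h (shortExact_app hs i) (hA.1 i) (hY.1 i) (f.app i)
  choose g hg using this
  refine ⟨gradedHom g, ?_⟩
  ext i
  exact hg i

theorem graded_kernel (h : ∀ {s : ShortComplex C}, s.ShortExact → B s.X₂ → B s.X₃ → B s.X₁)
    {s : ShortComplex (Discrete ℤ ⥤ C)} (hs : s.ShortExact) (h₂ : graded B s.X₂)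
    (h₃ : graded B s.X₃) : graded B s.X₁ :=
  graded_of_isZero h₂ (fun i => h (shortExact_app hs i) (h₂.1 i) (h₃.1 i)) fun i hi =>
    have : Mono (s.f.app i) := (shortExact_app hs i).mono_f
    IsZero.of_mono (s.f.app i) hi

theorem graded_cokernel (h : ∀ {s : ShortComplex C}, s.ShortExact → B s.X₁ → B s.X₂ → B s.X₃)
    {s : ShortComplex (Discrete ℤ ⥤ C)} (hs : s.ShortExact) (h₁ : graded B s.X₁)
    (h₂ : graded B s.X₂) : graded B s.X₃ :=
  graded_of_isZero h₂ (fun i => h (shortExact_app hs i) (h₁.1 i) (h₂.1 i)) fun i hi =>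
    have : Epi (s.g.app i) := (shortExact_app hs i).epi_g
    IsZero.of_epi (s.g.app i) hi

theorem graded_of_epi (h : ∀ {X Y : C} (f : X ⟶ Y) [Epi f], FC X → FC Y) {X Y : Discrete ℤ ⥤ C}
    (f : X ⟶ Y) [Epi f] (hX : graded FC X) : graded FC Y :=
  graded_of_isZero hX (fun i => h (f.app i) (hX.1 i)) fun i hi => IsZero.of_epi (f.app i) hi

theorem graded_of_mono (h : ∀ {X Y : C} (f : X ⟶ Y) [Mono f], FC Y → FC X) {X Y : Discrete ℤ ⥤ C}
    (f : X ⟶ Y) [Mono f] (hY : graded FC Y) : graded FC X :=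
  graded_of_isZero hY (fun i => h (f.app i) (hY.1 i)) fun i hi => IsZero.of_mono (f.app i) hi

end

/-! ### The graded counter system. -/

section

variable {C : Type u₁} [Category.{v₁} C] [Abelian C] {D : Type u₂} [Category.{v₂} D] [Abelian D]

/-- The classes of a counter system contain the zero objects, and the classes `A` and `G` are closed
under isomorphisms. -/
structure CounterSystem.IsClosed (S : CounterSystem C D) : Prop where
  A_zero : ∀ {X}, IsZero X → S.A X
  B_zero : ∀ {X}, IsZero X → S.B X
  P_zero : ∀ {X}, IsZero X → S.P X
  G_zero : ∀ {X}, IsZero X → S.G X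
  K_zero : ∀ {X}, IsZero X → S.K X
  Q_zero : ∀ {X}, IsZero X → S.Q X
  A_iso : ∀ {X Y}, (X ≅ Y) → S.A X → S.A Y
  G_iso : ∀ {X Y}, (X ≅ Y) → S.G X → S.G Y

/-- The counter system of graded objects, with the second adjunction shifted by one degree. -/
def gradedSystem (S : CounterSystem C D) (h : S.IsClosed) :
    CounterSystem (Discrete ℤ ⥤ C) (Discrete ℤ ⥤ D) where
  L := degreewise S.L
  H := degreewise S.H
  -- The whole shift sits in the second adjunction, so that `H' H` and `H H'` both put the component
  -- of index `i - 1` in degree `i`, as structure maps of repe-complexes require.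
  L' := shiftUp C ⋙ degreewise S.L'
  H' := degreewise S.H' ⋙ shiftDown C
  adj := gradedAdj S.adj
  adj' := shiftedAdj S.adj'
  additiveL := inferInstance
  additiveH := inferInstance
  additiveL' := inferInstance
  additiveH' := inferInstance
  FC := graded S.FC
  A := graded S.A
  B := graded S.B
  P := graded S.P
  FD := graded S.FD
  G := graded S.G
  K := graded S.K
  Q := graded S.Q
  FC_epi := graded_of_epi S.FC_epi
  FC_mono := graded_of_mono S.FC_mono
  FC_biprod := graded_biprod S.FC_biprod fun e => S.FC_epi e.hom
  FD_epi := graded_of_epi S.FD_epi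
  FD_mono := graded_of_mono S.FD_mono
  FD_biprod := graded_biprod S.FD_biprod fun e => S.FD_epi e.hom
  FC_L := graded_map S.L S.FC_L
  FD_H := graded_map S.H S.FD_H
  FD_L' := fun hX => graded_map S.L' S.FD_L' (graded_shiftUp hX)
  FC_H' := fun hX => graded_shiftDown (graded_map S.H' S.FC_H' hX)
  A_le := graded_mono S.A_le
  B_le := graded_mono S.B_le
  G_le := graded_mono S.G_le
  K_le := graded_mono S.K_le
  A_biprod := graded_biprod S.A_biprod h.A_iso
  G_biprod := graded_biprod S.G_biprod h.G_iso
  extC := exists_graded_extension S.extC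
  liftC := exists_graded_lift S.liftC
  extD := exists_graded_extension S.extD
  liftD := exists_graded_lift S.liftD
  B_kernel := graded_kernel S.B_kernel
  G_kernel := graded_kernel S.G_kernel
  K_cokernel := graded_cokernel S.K_cokernel
  preenvelope := exists_graded_preenvelope h.A_zero h.B_zero S.preenvelope
  precover := exists_graded_precover h.K_zero h.G_zero S.precover
  P_projective := projective_graded S.P_projective
  P_le := graded_mono S.P_le
  P_cover := exists_graded_cover h.P_zero S.P_cover
  Q_projective := projective_graded S.Q_projective
  Q_le := graded_mono S.Q_le
  Q_cover := exists_graded_cover h.Q_zero S.Q_cover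
  A_H := graded_map S.H S.A_H
  G_L := graded_map S.L S.G_L
  B_L' := fun hX => graded_map S.L' S.B_L' (graded_shiftUp hX)
  K_H' := fun hX => graded_shiftDown (graded_map S.H' S.K_H' hX)
  isIso_cu := fun hX => isIso_cu_gradedAdj S.adj fun i => S.isIso_cu (hX.1 i)
  isIso_un := fun hX => isIso_un_gradedAdj S.adj fun i => S.isIso_un (hX.1 i)
  isIso_cu' := fun hX => isIso_cu_shiftedAdj S.adj' fun i => S.isIso_cu' (hX.1 i)
  isIso_un' := fun hX => isIso_un_shiftedAdj S.adj' fun i => S.isIso_un' (hX.1 i)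
  Q_L := graded_map S.L S.Q_L
  P_L' := fun hX => graded_map S.L' S.P_L' (graded_shiftUp hX)
  P_embedding := exists_graded_shifted_embedding h.P_zero (S.L' ⋙ S.L) S.P_embedding
  Q_embedding := exists_graded_shifted_embedding h.Q_zero (S.L ⋙ S.L') S.Q_embedding

end

end Graded

/-! ## Objects with zero structure map -/

section ZeroStructure

universe v₁ v₂ u₁ u₂

open Limits
open scoped ZeroObject

theorem RepObj.isIso_of_isIso_f {C : Type u₁} [Category.{v₁} C] [Abelian C] {D : Type u₂}
    [Category.{v₂} D] [Abelian D] {H : C ⥤ D} {H' : D ⥤ C} {F : ObjectProperty C}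
    {X Y : RepObj H H' F} (φ : X ⟶ Y) (h : IsIso φ.f) : IsIso φ := by
  let ψ : Y ⟶ X :=
    { f := inv φ.f
      comm := by
        rw [← cancel_epi φ.f, IsIso.hom_inv_id_assoc, ← Category.assoc, RepObj.hom_comm,
          Category.assoc, ← H'.map_comp, ← H.map_comp, IsIso.hom_inv_id, H.map_id, H'.map_id,
          Category.comp_id] }
  exact ⟨ψ, RepObj.hom_ext (IsIso.hom_inv_id φ.f), RepObj.hom_ext (IsIso.inv_hom_id φ.f)⟩

namespace CounterSystem

variable {C : Type u₁} [Category.{v₁} C] [Abelian C] {D : Type u₂} [Category.{v₂} D] [Abelian D]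
  (S : CounterSystem C D)

/-- The objects of `A` with zero structure map. -/
def zeroStructure : ObjectProperty S.RepC := fun X => S.A X.X ∧ X.δ = 0

theorem shortExact_id_zero (X : C) :
    (ShortComplex.mk (𝟙 X) (0 : X ⟶ (0 : C)) comp_zero).ShortExact :=
  ShortComplex.Splitting.shortExact
    { r := 𝟙 X
      s := 0
      s_g := (isZero_zero C).eq_of_src _ _ }

/-- An object of `A` with zero structure map, with the identity as preenvelope. -/
def zeroEnveloped (hB : S.B 0) : S.zeroStructure.FullSubcategory ⥤ S.Enveloped where
  obj X :=
    { X := X.obj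
      A := X.obj.X
      B := 0
      ι := 𝟙 _
      κ := 0
      w := comp_zero
      exact := shortExact_id_zero _
      memA := X.property.1
      memB := hB }
  map f :=
    { f := f.hom
      α := f.hom.f
      comm := (Category.id_comp _).trans (Category.comp_id _).symm }

/-- The functor `H` on objects of `A` with zero structure map. -/
def zeroHom : S.zeroStructure.FullSubcategory ⥤ S.RepD where
  obj X :=
    { X := S.H.obj X.obj.X
      mem := S.FD_H X.obj.mem
      δ := 0
      sq := zero_comp }
  map f :=
    { f := S.H.map f.hom.f
      comm := by rw [zero_comp, comp_zero] }
  map_id X := RepObj.hom_ext (S.H.map_id _)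
  map_comp f g := RepObj.hom_ext (S.H.map_comp _ _)

variable {S}

/-- The preenvelope is the identity and the structure map is zero, so the pushout relation `map_ι_j`
reads `j = 0`. -/
theorem zeroEnveloped_j (hB : S.B 0) (X : S.zeroStructure.FullSubcategory) :
    ((S.zeroEnveloped hB).obj X).j = 0 := by
  have h := ((S.zeroEnveloped hB).obj X).map_ι_j
  have h₁ : trs S.adj' ((S.zeroEnveloped hB).obj X).X.δ = 0 := by
    have h₂ : ((S.zeroEnveloped hB).obj X).X.δ = 0 := X.property.2
    rw [h₂, trs_zero]
  rw [h₁, zero_comp] at h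
  have h₃ : S.L'.map ((S.zeroEnveloped hB).obj X).ι = 𝟙 _ := S.L'.map_id _
  rw [h₃] at h
  exact (Category.id_comp _).symm.trans h

/-- `Phi` is here the pushout of an identity and a zero map, which leaves only `H A`. -/
theorem zeroEnveloped_isIso_h (hB : S.B 0) (X : S.zeroStructure.FullSubcategory) :
    IsIso ((S.zeroEnveloped hB).obj X).h := by
  have h₁ : trs S.adj' ((S.zeroEnveloped hB).obj X).X.δ = 0 := by
    have h₂ : ((S.zeroEnveloped hB).obj X).X.δ = 0 := X.property.2
    rw [h₂, trs_zero]
  refine ⟨Enveloped.phiDesc 0 (𝟙 _) (by rw [h₁, zero_comp, comp_zero]), Enveloped.h_desc _ _ _, ?_⟩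
  refine Enveloped.phi_ext ?_ ?_
  · rw [zeroEnveloped_j, zero_comp, zero_comp]
  · rw [reassoc_of% Enveloped.h_desc, Category.comp_id, Category.id_comp]

/-- The map `H A ⟶ Φ` as a morphism of `RepD`. -/
def zeroComponent (hB : S.B 0) (X : S.zeroStructure.FullSubcategory) :
    S.zeroHom.obj X ⟶ ((S.zeroEnveloped hB).obj X).Phi where
  f := ((S.zeroEnveloped hB).obj X).h
  comm := by
    refine ((Enveloped.h_δ _).trans ?_).trans zero_comp.symm
    rw [zeroEnveloped_j, tr_zero, S.H.map_zero]

variable (S) in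
/-- The functor `Φ` on objects of `A` with zero structure map is `H`. -/
def zeroIso (hB : S.B 0) :
    S.zeroHom ≅ S.zeroEnveloped hB ⋙ Enveloped.phiFunctor S :=
  NatIso.ofComponents (fun X =>
    @asIso _ _ (S.zeroHom.obj X) ((S.zeroEnveloped hB).obj X).Phi (zeroComponent hB X)
      (RepObj.isIso_of_isIso_f (zeroComponent hB X) (zeroEnveloped_isIso_h hB X)))
    fun f => RepObj.hom_ext (Enveloped.h_phiMap ((S.zeroEnveloped hB).map f)).symm

/-- A stable equivalence restricts to `H` on objects of `A` with zero structure map. -/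
theorem exists_stable_equivalence_extending {X : Type*} [Category* X] {Y : Type*} [Category* Y]
    (hB : S.B 0) (p : S.RepC ⥤ X) (q : S.RepD ⥤ Y) [p.Full] [p.EssSurj] [q.Full] [q.EssSurj]
    (hp : ∀ {a b : S.RepC} (f g : a ⟶ b), p.map f = p.map g ↔
      RepObj.StablyZero S.adj S.adj' S.P (f - g).f)
    (hq : ∀ {a b : S.RepD} (f g : a ⟶ b), q.map f = q.map g ↔
      RepObj.StablyZero S.adj' S.adj S.Q (f - g).f) :
    ∃ F : X ≌ Y, Nonempty ((S.zeroStructure.ι ⋙ p) ⋙ F.functor ≅ S.zeroHom ⋙ q) := by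
  obtain ⟨F, ⟨i⟩⟩ := S.exists_stable_equivalence p q hp hq
  exact ⟨F, ⟨(Functor.isoWhiskerLeft (S.zeroEnveloped hB) i :
    (S.zeroStructure.ι ⋙ p) ⋙ F.functor ≅ _) ≪≫
      (Functor.isoWhiskerRight (S.zeroIso hB) q).symm⟩⟩

end CounterSystem

end ZeroStructure

/-! ## Repe-complexes as graded objects with a square-zero map -/

section ToRepObj

universe v w

open Limits

variable {k R E : Type u} [CommRing k] [Ring R] [Algebra k R] [AddCommGroup E] [Module k E]

namespace RepeComplex

/-- The underlying graded object of a repe-complex. -/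
def toGraded (X : RepeComplex k R E) : Discrete ℤ ⥤ ModuleCat.{u} Rᵐᵒᵖ :=
  gradedObj fun i => X.X i.as

variable (k R E) in
/-- The functor that maps `X` to `Hom_R(DR, X (i - 1))` in degree `i`. -/
def gradedDual : (Discrete ℤ ⥤ ModuleCat.{u} Rᵐᵒᵖ) ⥤ (Discrete ℤ ⥤ ModuleCat.{u} Rᵐᵒᵖ) :=
  degreewise (homDual k R E) ⋙ shiftDown _

/-- The structure map of a repe-complex. -/
def gradedδ (X : RepeComplex k R E) : X.toGraded ⟶ (gradedDual k R E).obj X.toGraded :=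
  gradedHom fun i => X.δ i.as

theorem gradedδ_comp (X : RepeComplex k R E) :
    X.gradedδ ≫ (gradedDual k R E).map X.gradedδ = 0 := by
  ext1
  funext i
  exact X.δ_comp_δ i.as

theorem toGraded_mem (X : RepeComplex k R E) : graded (ModuleCat.isFG Rᵐᵒᵖ) X.toGraded := by
  refine ⟨fun i => X.finite i.as, ?_⟩
  refine (X.bounded.image Discrete.mk).subset ?_
  rintro ⟨i⟩ hi
  refine ⟨i, ?_, rfl⟩
  by_contra hn
  have : Subsingleton (X.X i) := not_nontrivial_iff_subsingleton.1 hn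
  exact hi (ModuleCat.isZero_of_subsingleton (X.X i))

/-- The underlying map of graded objects. -/
def mapGraded {X Y : RepeComplex k R E} (φ : X ⟶ Y) : X.toGraded ⟶ Y.toGraded :=
  gradedHom fun i => φ.f i.as

theorem mapGraded_comm {X Y : RepeComplex k R E} (φ : X ⟶ Y) :
    mapGraded φ ≫ Y.gradedδ = X.gradedδ ≫ (gradedDual k R E).map (mapGraded φ) := by
  ext1
  funext i
  exact φ.comm i.as

end RepeComplex

open RepeComplex

variable {D : Type w} [Category.{v} D] [Abelian D] {H : (Discrete ℤ ⥤ ModuleCat.{u} Rᵐᵒᵖ) ⥤ D}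
  {H' : D ⥤ (Discrete ℤ ⥤ ModuleCat.{u} Rᵐᵒᵖ)} [H.Additive] [H'.Additive]
  (θ : gradedDual k R E ⟶ H ⋙ H')

theorem nat_comm {X Y : Discrete ℤ ⥤ ModuleCat.{u} Rᵐᵒᵖ} (f : X ⟶ Y) :
    θ.app X ≫ H'.map (H.map f) = (gradedDual k R E).map f ≫ θ.app Y := (θ.naturality f).symm

theorem mapGraded_nat {X Y : RepeComplex k R E} (φ : X ⟶ Y) :
    mapGraded φ ≫ Y.gradedδ ≫ θ.app Y.toGraded =
      (X.gradedδ ≫ θ.app X.toGraded) ≫ H'.map (H.map (mapGraded φ)) := by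
  rw [← Category.assoc, mapGraded_comm, Category.assoc, Category.assoc, nat_comm]

/-- Repe-complexes as graded objects with a square-zero map. -/
def toRepObj : RepeComplex k R E ⥤ RepObj H H' (graded (ModuleCat.isFG Rᵐᵒᵖ)) where
  obj X :=
    { X := X.toGraded
      mem := X.toGraded_mem
      δ := X.gradedδ ≫ θ.app X.toGraded
      sq := by
        rw [H.map_comp, H'.map_comp, Category.assoc, reassoc_of% nat_comm θ,
          reassoc_of% X.gradedδ_comp, zero_comp] }
  map φ :=
    { f := mapGraded φ
      comm := mapGraded_nat θ φ }
  map_id X := RepObj.hom_ext (by ext1; rfl)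
  map_comp φ ψ := RepObj.hom_ext (by ext1; rfl)

variable (hθ : ∀ X, graded (ModuleCat.isFG Rᵐᵒᵖ) X → IsIso (θ.app X))

theorem faithful_toRepObj : (toRepObj θ).Faithful where
  map_injective {X Y φ ψ} h := by
    refine RepeComplex.hom_ext fun i => ?_
    exact NatTrans.congr_app (congrArg RepObj.Hom.f h) ⟨i⟩

include hθ in
theorem full_toRepObj : (toRepObj θ).Full where
  map_surjective {X Y} g := by
    obtain ⟨ρ, hρ, -⟩ := (hθ _ Y.toGraded_mem).out
    let g' : X.toGraded ⟶ Y.toGraded := g.f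
    have h₀ : g' ≫ Y.gradedδ ≫ θ.app Y.toGraded =
      (X.gradedδ ≫ θ.app X.toGraded) ≫ H'.map (H.map g') := g.comm
    have h : g' ≫ Y.gradedδ = X.gradedδ ≫ (gradedDual k R E).map g' := by
      rw [Category.assoc, nat_comm] at h₀
      have h₁ := congrArg (· ≫ ρ) h₀
      simp only [Category.assoc, hρ, Category.comp_id] at h₁
      exact h₁
    exact ⟨{ f := fun i => g'.app ⟨i⟩, comm := fun i => NatTrans.congr_app h ⟨i⟩ },
      RepObj.hom_ext (by ext1; rfl)⟩

/-- The repe-complex of a graded module with a square-zero map. -/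
def ofGraded (X : Discrete ℤ ⥤ ModuleCat.{u} Rᵐᵒᵖ) (hX : graded (ModuleCat.isFG Rᵐᵒᵖ) X)
    (δ : X ⟶ (gradedDual k R E).obj X) (hδ : δ ≫ (gradedDual k R E).map δ = 0) :
    RepeComplex k R E where
  X i := X.obj ⟨i⟩
  finite i := hX.1 ⟨i⟩
  bounded := by
    refine Set.Finite.of_finite_image (f := Discrete.mk) (hX.2.subset ?_)
      fun i _ j _ h => congrArg Discrete.as h
    rintro _ ⟨i, hi, rfl⟩ hz
    have := ModuleCat.subsingleton_of_isZero hz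
    exact not_nontrivial_iff_subsingleton.2 this hi
  δ i := δ.app ⟨i⟩
  δ_comp_δ i := NatTrans.congr_app hδ ⟨i⟩

/-- Naturality of `θ` turns the composite into `δ ≫ H' H δ`, once `θ` is cancelled at `H' H X`. So
`θ` must be invertible at `H' H X` as well as at `X`. -/
theorem inverse_comp_map (X : Discrete ℤ ⥤ ModuleCat.{u} Rᵐᵒᵖ) (δ : X ⟶ H'.obj (H.obj X))
    (hδ : δ ≫ H'.map (H.map δ) = 0) (ρ : H'.obj (H.obj X) ⟶ (gradedDual k R E).obj X)
    (hρ : ρ ≫ θ.app X = 𝟙 _) (hθ : IsIso (θ.app (H'.obj (H.obj X)))) :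
    δ ≫ ρ ≫ (gradedDual k R E).map δ = 0 := by
  obtain ⟨ρ', hρ', -⟩ := hθ.out
  have h : (δ ≫ ρ ≫ (gradedDual k R E).map δ) ≫ θ.app _ = 0 := by
    rw [Category.assoc, Category.assoc, ← nat_comm, reassoc_of% hρ, hδ]
  have h₁ := congrArg (· ≫ ρ') h
  simp only [Category.assoc, hρ', Category.comp_id, zero_comp] at h₁
  exact h₁

include hθ in
theorem essSurj_toRepObj (hF : ∀ X, graded (ModuleCat.isFG Rᵐᵒᵖ) X →
    graded (ModuleCat.isFG Rᵐᵒᵖ) (H'.obj (H.obj X))) : (toRepObj θ).EssSurj where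
  mem_essImage Y := by
    obtain ⟨X, hX, δ, hδ⟩ := Y
    obtain ⟨ρ, hρ, hρ'⟩ := (hθ _ hX).out
    have h : (δ ≫ ρ) ≫ (gradedDual k R E).map (δ ≫ ρ) = 0 := by
      have h₁ := inverse_comp_map θ X δ hδ ρ hρ' (hθ _ (hF _ hX))
      rw [Functor.map_comp, Category.assoc, ← Category.assoc ρ, ← Category.assoc δ, h₁, zero_comp]
    let i : (ofGraded X hX _ h).toGraded ⟶ X := gradedHom fun j => 𝟙 _
    have hi : IsIso i := by
      have : ∀ j, IsIso (i.app j) := fun j => inferInstanceAs (IsIso (𝟙 (X.obj j)))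
      exact NatIso.isIso_of_isIso_app i
    have hiδ : (ofGraded X hX _ h).gradedδ ≫ (gradedDual k R E).map i = i ≫ δ ≫ ρ := by
      ext1
      funext j
      have h₁ : ((gradedDual k R E).map i).app j = 𝟙 _ := (homDual k R E).map_id _
      have h₂ : (i ≫ δ ≫ ρ).app j = (δ ≫ ρ).app j := Category.id_comp _
      rw [h₂]
      refine (congrArg (_ ≫ ·) h₁).trans (Category.comp_id _)
    let g : (toRepObj θ).obj (ofGraded X hX _ h) ⟶ (⟨X, hX, δ, hδ⟩ : RepObj H H' _) :=
      { f := i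
        comm := by
          have h₁ : i ≫ δ = ((ofGraded X hX _ h).gradedδ ≫ θ.app _) ≫ H'.map (H.map i) := by
            rw [Category.assoc, nat_comm, ← Category.assoc, hiδ, Category.assoc, Category.assoc,
              hρ']
            exact congrArg (i ≫ ·) (Category.comp_id δ).symm
          exact h₁ }
    exact ⟨_, ⟨@asIso _ _ _ _ g (RepObj.isIso_of_isIso_f g hi)⟩⟩

/-! ### Comparison of the two stable relations. -/

section Stable

variable (hF : ∀ X, graded (ModuleCat.isFG Rᵐᵒᵖ) X →
    graded (ModuleCat.isFG Rᵐᵒᵖ) (H'.obj (H.obj X)))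

include hθ hF in
theorem isEquivalence_toRepObj : (toRepObj θ).IsEquivalence where
  faithful := faithful_toRepObj θ
  full := full_toRepObj θ hθ
  essSurj := essSurj_toRepObj θ hθ hF

variable {L : D ⥤ (Discrete ℤ ⥤ ModuleCat.{u} Rᵐᵒᵖ)} {L' : (Discrete ℤ ⥤ ModuleCat.{u} Rᵐᵒᵖ) ⥤ D}
  {adj : L ⊣ H} {adj' : L' ⊣ H'} {Q : ObjectProperty (Discrete ℤ ⥤ ModuleCat.{u} Rᵐᵒᵖ)}
  (hQ : RepObj.EnoughFree adj adj' (graded (ModuleCat.isFG Rᵐᵒᵖ)) Q)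

theorem RepObj.EnoughFree.stablyZero_zero {C : Type*} [Category* C] [Abelian C] {D : Type*}
    [Category* D] [Abelian D] {L : D ⥤ C} {H : C ⥤ D} {L' : C ⥤ D} {H' : D ⥤ C} [H.Additive]
    [H'.Additive] {adj : L ⊣ H} {adj' : L' ⊣ H'} {F Q : ObjectProperty C}
    (hQ : RepObj.EnoughFree adj adj' F Q) (X Y : RepObj H H' F) :
    RepObj.StablyZero adj adj' Q (0 : X.X ⟶ Y.X) := by
  obtain ⟨P, hP, p, -⟩ := hQ.cover Y.X Y.mem
  exact ⟨P, hQ.free_mem P hP, hP,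
    { f := 0, comm := by rw [H.map_zero, H'.map_zero, zero_comp, comp_zero] },
    RepObj.freeDesc _ p, zero_comp.symm⟩

theorem RepObj.stablyZero_sub_iff {C : Type*} [Category* C] [Abelian C] {D : Type*}
    [Category* D] [Abelian D] {L : D ⥤ C} {H : C ⥤ D} {L' : C ⥤ D} {H' : D ⥤ C} [H.Additive]
    [H'.Additive] {adj : L ⊣ H} {adj' : L' ⊣ H'} {F Q : ObjectProperty C} {X X' Y Y' : RepObj H H' F}
    (i : X' ≅ X) (j : Y' ≅ Y) {f g : X ⟶ Y} {f' g' : X' ⟶ Y'} (hf : f' = i.hom ≫ f ≫ j.inv)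
    (hg : g' = i.hom ≫ g ≫ j.inv) :
    RepObj.StablyZero adj adj' Q (f'.f - g'.f) ↔ RepObj.StablyZero adj adj' Q (f - g).f := by
  constructor
  · intro h
    have h₁ := (h.precomp i.inv).comp j.hom
    have hf' : f = i.inv ≫ f' ≫ j.hom := by simp [hf]
    have hg' : g = i.inv ≫ g' ≫ j.hom := by simp [hg]
    rw [hf', hg', RepObj.sub_f]
    simpa [Preadditive.comp_sub, Preadditive.sub_comp] using h₁
  · intro h
    have h₁ := (h.precomp i.hom).comp j.inv
    rw [hf, hg]
    simpa [Preadditive.comp_sub, Preadditive.sub_comp] using h₁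

-- An equivalence preserves and reflects projective objects, and factoring through any projective
-- object amounts to factoring through a free one on a generator in `Q`.
include hθ hF hQ in
theorem stableRel_iff {X Y : RepeComplex k R E} (φ ψ : X ⟶ Y) :
    stableRel k R E φ ψ ↔ RepObj.StablyZero adj adj' Q
      (((toRepObj θ).map φ).f - ((toRepObj θ).map ψ).f) := by
  have := isEquivalence_toRepObj θ hθ hF
  constructor
  · rintro ⟨P, hP, a, b, h⟩
    have : Projective ((toRepObj θ).obj P) :=
      ((toRepObj θ).asEquivalence.map_projective_iff P).2 hP
    have h₁ := hQ.stablyZero_of_projective ((toRepObj θ).map a) ((toRepObj θ).map b)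
    have h₂ : ((toRepObj θ).map φ).f - ((toRepObj θ).map ψ).f =
        ((toRepObj θ).map a).f ≫ ((toRepObj θ).map b).f := by
      ext1
      funext i
      exact h i.as
    rw [h₂]
    exact h₁
  · rintro ⟨P, hP, hPQ, a, b, h⟩
    obtain ⟨Z, ⟨e⟩⟩ : ∃ Z, Nonempty ((toRepObj θ).obj Z ≅ RepObj.free adj adj' P hP) :=
      ⟨_, ⟨(toRepObj θ).objObjPreimageIso _⟩⟩
    have h₁ : Projective (RepObj.free adj adj' P hP) := hQ.projective_free hPQ
    have h₂ : Projective ((toRepObj θ).obj Z) := Projective.of_iso e.symm h₁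
    obtain ⟨a', ha⟩ := (toRepObj θ).map_surjective (a ≫ e.inv)
    obtain ⟨b', hb⟩ := (toRepObj θ).map_surjective (e.hom ≫ b)
    refine ⟨Z, ((toRepObj θ).asEquivalence.map_projective_iff Z).1 h₂, a', b', fun i => ?_⟩
    have h₃ : (toRepObj θ).map (a' ≫ b') = a ≫ b := by
      rw [Functor.map_comp, ha, hb, Category.assoc, e.inv_hom_id_assoc]
    have h₄ : ((toRepObj θ).map φ).f - ((toRepObj θ).map ψ).f = ((toRepObj θ).map (a' ≫ b')).f := by
      rw [h₃]
      exact h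
    exact NatTrans.congr_app h₄ ⟨i⟩

-- Being a congruence is what makes equality in the quotient category the relation itself, not
-- merely the relation it generates. Closure under sums of stably trivial maps gives transitivity.
include hθ hF hQ in
theorem congruence_stableRel : Congruence (stableRel k R E) where
  equivalence {X Y} :=
    { refl := fun φ => by
        rw [stableRel_iff θ hθ hF hQ, sub_self]
        exact hQ.stablyZero_zero _ _
      symm := fun {φ ψ} h => by
        rw [stableRel_iff θ hθ hF hQ] at h ⊢
        have := hQ.sub (hQ.stablyZero_zero _ _) h
        rwa [zero_sub, neg_sub] at this
      trans := fun {φ ψ χ} h h' => by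
        rw [stableRel_iff θ hθ hF hQ] at h h' ⊢
        have := hQ.add h h'
        rwa [sub_add_sub_cancel] at this }
  comp_left {X Y Z} f φ ψ h := by
    rw [stableRel_iff θ hθ hF hQ] at h ⊢
    have := h.precomp ((toRepObj θ).map f)
    rw [Functor.map_comp, Functor.map_comp, RepObj.comp_f, RepObj.comp_f, ← Preadditive.comp_sub]
    exact this
  comp_right {X Y Z φ ψ} g h := by
    rw [stableRel_iff θ hθ hF hQ] at h ⊢
    have := h.comp ((toRepObj θ).map g)
    rw [Functor.map_comp, Functor.map_comp, RepObj.comp_f, RepObj.comp_f, ← Preadditive.sub_comp]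
    exact this

include hθ hF in
theorem exists_quotient_functor (hQ : RepObj.EnoughFree adj adj' (graded (ModuleCat.isFG Rᵐᵒᵖ)) Q) :
    ∃ p : RepObj H H' (graded (ModuleCat.isFG Rᵐᵒᵖ)) ⥤ RepetitiveCategory k R E,
      p.Full ∧ p.EssSurj ∧
      (∀ {a b : RepObj H H' (graded (ModuleCat.isFG Rᵐᵒᵖ))} (f g : a ⟶ b),
        p.map f = p.map g ↔ RepObj.StablyZero adj adj' Q (f - g).f) ∧
      Nonempty (toRepObj θ ⋙ p ≅ CategoryTheory.Quotient.functor (stableRel k R E)) := by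
  have := isEquivalence_toRepObj θ hθ hF
  have := congruence_stableRel θ hθ hF hQ
  let e := (toRepObj θ).asEquivalence
  refine ⟨e.inverse ⋙ CategoryTheory.Quotient.functor _, inferInstance, inferInstance, ?_,
    ⟨(Functor.isoWhiskerRight e.unitIso.symm (CategoryTheory.Quotient.functor (stableRel k R E)) :
      toRepObj θ ⋙ e.inverse ⋙ CategoryTheory.Quotient.functor (stableRel k R E) ≅
        CategoryTheory.Quotient.functor (stableRel k R E))⟩⟩
  intro a b f g
  refine (CategoryTheory.Quotient.functor_map_eq_iff _ _ _).trans ?_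
  rw [stableRel_iff θ hθ hF hQ]
  -- Stable triviality is invariant under isomorphisms of source and target, so it may be tested
  -- after applying the inverse and returning.
  let i : ∀ a, (toRepObj θ).obj (e.inverse.obj a) ≅ a := e.counitIso.app
  exact RepObj.stablyZero_sub_iff (i a) (i b) (e.fun_inv_map _ _ f) (e.fun_inv_map _ _ g)

end Stable

end ToRepObj

/-! ## The equivalence of repetitive categories -/

section Final

open Limits RepeComplex
open scoped ZeroObject

/-! ### Modules placed in degree zero. -/

section Single

variable {Λ Γ : Type u} [Ring Λ] [Ring Γ] (F : ModuleCat.{u} Λ ⥤ ModuleCat.{u} Γ) [F.Additive]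

theorem isZero_single (M : ModuleCat.{u} Λ) (i : ℤ) (h : i ≠ 0) :
    IsZero ((GradedObject.single₀ (C := ModuleCat.{u} Λ) ℤ).obj M i) :=
  (isZero_zero _).of_iso
    ((GradedObject.isInitialSingleObjApply 0 M i h).uniqueUpToIso (isZero_zero _).isInitial)

/-- Additive functors commute with placing a module in degree zero. -/
def mapSingleIso (M : ModuleCat.{u} Λ) (i : ℤ) :
    F.obj ((GradedObject.single₀ (C := ModuleCat.{u} Λ) ℤ).obj M i) ≅
      (GradedObject.single₀ (C := ModuleCat.{u} Γ) ℤ).obj (F.obj M) i :=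
  if h : i = 0 then
    F.mapIso (GradedObject.singleObjApplyIsoOfEq 0 M i h) ≪≫
      (GradedObject.singleObjApplyIsoOfEq 0 (F.obj M) i h).symm
  else (F.map_isZero (isZero_single M i h)).iso (isZero_single (F.obj M) i h)

theorem mapSingleIso_naturality {M N : ModuleCat.{u} Λ} (f : M ⟶ N) (i : ℤ) :
    F.map ((GradedObject.single₀ (C := ModuleCat.{u} Λ) ℤ).map f i) ≫ (mapSingleIso F N i).hom =
      (mapSingleIso F M i).hom ≫ (GradedObject.single₀ (C := ModuleCat.{u} Γ) ℤ).map (F.map f) i := by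
  by_cases h : i = 0
  · rw [mapSingleIso, mapSingleIso, dif_pos h, dif_pos h, Iso.trans_hom, Iso.trans_hom,
      Functor.mapIso_hom, Functor.mapIso_hom, Iso.symm_hom, Iso.symm_hom, Category.assoc,
      GradedObject.singleObjApplyIsoOfEq_inv_single_map, ← F.map_comp_assoc, ← F.map_comp_assoc,
      GradedObject.single_map_singleObjApplyIsoOfEq_hom]
  · exact (isZero_single _ i h).eq_of_tgt _ _

end Single

theorem toRepObj_single_δ {k R E : Type u} [CommRing k] [Ring R] [Algebra k R] [AddCommGroup E]
    [Module k E] {D : Type*} [Category* D] [Abelian D] {H : (Discrete ℤ ⥤ ModuleCat.{u} Rᵐᵒᵖ) ⥤ D}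
    {H' : D ⥤ (Discrete ℤ ⥤ ModuleCat.{u} Rᵐᵒᵖ)} [H.Additive] [H'.Additive]
    (θ : gradedDual k R E ⟶ H ⋙ H') (M : FGModuleCat.{u} Rᵐᵒᵖ) :
    ((toRepObj θ).obj ((singleFunctor k R E).obj M)).δ = 0 := by
  have h : ((singleFunctor k R E).obj M).gradedδ = 0 := by
    ext1
    rfl
  have h₁ : ((singleFunctor k R E).obj M).gradedδ ≫ θ.app _ = 0 := by rw [h, zero_comp]
  exact h₁

/-! ### The Nakayama transformations in graded form. -/

section GradedNat

variable {k R E S : Type u} [CommRing k] [Ring R] [Algebra k R] [AddCommGroup E] [Module k E]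
  [Ring S] {F : ModuleCat.{u} Rᵐᵒᵖ ⥤ ModuleCat.{u} Sᵐᵒᵖ} {F' : ModuleCat.{u} Sᵐᵒᵖ ⥤ ModuleCat.{u} Rᵐᵒᵖ}
  (α : homDual k R E ⟶ F ⋙ F')

/-- A transformation from `Hom_R(DR, -)`, applied degreewise. -/
def gradedNat : gradedDual k R E ⟶ degreewise F ⋙ degreewise F' ⋙ shiftDown _ where
  app X := gradedHom fun i => α.app (X.obj (shiftIndex.functor.obj i))
  naturality X Y f := by
    ext1
    funext i
    exact α.naturality (f.app (shiftIndex.functor.obj i))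

/-- A transformation from `Hom_R(DR, -)`, applied degreewise, with the shift in the middle. -/
def gradedNat' : gradedDual k R E ⟶ (degreewise F ⋙ shiftDown _) ⋙ degreewise F' where
  app X := gradedHom fun i => α.app (X.obj (shiftIndex.functor.obj i))
  naturality X Y f := by
    ext1
    funext i
    exact α.naturality (f.app (shiftIndex.functor.obj i))

variable {α} (hα : ∀ M, ModuleCat.isFG Rᵐᵒᵖ M → IsIso (α.app M)) {X : Discrete ℤ ⥤ ModuleCat.{u} Rᵐᵒᵖ}
  (hX : graded (ModuleCat.isFG Rᵐᵒᵖ) X)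
include hα hX

theorem isIso_gradedNat : IsIso ((gradedNat α).app X) := by
  have : ∀ i, IsIso (((gradedNat α).app X).app i) := fun i => hα _ (hX.1 _)
  exact NatIso.isIso_of_isIso_app _

theorem isIso_gradedNat' : IsIso ((gradedNat' α).app X) := by
  have : ∀ i, IsIso (((gradedNat' α).app X).app i) := fun i => hα _ (hX.1 _)
  exact NatIso.isIso_of_isIso_app _

end GradedNat

variable {k E S R T : Type u} [CommRing k] [IsArtinianRing k] [AddCommGroup E] [Module k E]
  [Ring S] [Ring R] [Algebra k S] [Algebra k R]
  [AddCommGroup T] [Module k T] [Module S T] [Module Rᵐᵒᵖ T] [SMulCommClass S Rᵐᵒᵖ T]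
  [IsScalarTower k S T] [IsScalarTower k Rᵐᵒᵖ T]
  [Module.Finite k S] [Module.Finite k R] [Module.Finite k T]
  (hE : IsInjectiveEnvelope k (k ⧸ Ring.jacobson k) E) (hT : IsFaithfullyBalanced S R T)
  {B A : ObjectProperty (ModuleCat.{u} Rᵐᵒᵖ)} {G K : ObjectProperty (ModuleCat.{u} Sᵐᵒᵖ)}
  (hBA : IsCompleteHereditaryCotorsionPair B A) (hGK : IsCompleteHereditaryCotorsionPair G K)
  (hAG : RepresentsEquivalence S R T A G) (hKB : RepresentsEquivalence R S (KDual k E T) K B)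

theorem isFGProjective_of_isZero {Λ : Type u} [Ring Λ] {X : ModuleCat.{u} Λ} (hX : IsZero X) :
    isFGProjective Λ X := by
  have := ModuleCat.subsingleton_of_isZero hX
  exact ⟨inferInstance, Module.Projective.of_free (R := Λ)⟩

theorem isClosed_moduleSystem : (moduleSystem hE hBA hGK hAG hKB).IsClosed where
  A_zero := hBA.right_of_isZero
  B_zero := hBA.left_of_isZero
  P_zero := isFGProjective_of_isZero
  G_zero := hGK.left_of_isZero
  K_zero := hGK.right_of_isZero
  Q_zero := isFGProjective_of_isZero
  A_iso := hBA.right_of_iso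
  G_iso := hGK.left_of_iso

/-- The graded counter system of a good Wakamatsu-tilting module. -/
def repetitiveSystem :
    CounterSystem (Discrete ℤ ⥤ ModuleCat.{u} Rᵐᵒᵖ) (Discrete ℤ ⥤ ModuleCat.{u} Sᵐᵒᵖ) :=
  gradedSystem (moduleSystem hE hBA hGK hAG hKB) (isClosed_moduleSystem hE hBA hGK hAG hKB)

/-- Repe-complexes over `R` as objects of the counter system. -/
def toRepC : RepeComplex k R E ⥤ (repetitiveSystem hE hBA hGK hAG hKB).RepC :=
  toRepObj (gradedNat (nakayamaRight k E S R T))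

/-- Repe-complexes over `S` as objects of the counter system. -/
def toRepD : RepeComplex k S E ⥤ (repetitiveSystem hE hBA hGK hAG hKB).RepD :=
  toRepObj (gradedNat' (nakayamaLeft k E S R T))

include hT in
theorem exists_quotient_functor_right :
    ∃ p : (repetitiveSystem hE hBA hGK hAG hKB).RepC ⥤ RepetitiveCategory k R E,
      p.Full ∧ p.EssSurj ∧
      (∀ {a b : (repetitiveSystem hE hBA hGK hAG hKB).RepC} (f g : a ⟶ b),
        p.map f = p.map g ↔ RepObj.StablyZero (repetitiveSystem hE hBA hGK hAG hKB).adj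
          (repetitiveSystem hE hBA hGK hAG hKB).adj' (repetitiveSystem hE hBA hGK hAG hKB).P
          (f - g).f) ∧
      Nonempty (toRepC hE hBA hGK hAG hKB ⋙ p ≅
        CategoryTheory.Quotient.functor (stableRel k R E)) :=
  exists_quotient_functor (gradedNat (nakayamaRight k E S R T))
    (fun _ hX => isIso_gradedNat (fun M (_ : Module.Finite Rᵐᵒᵖ M) =>
      isIso_nakayamaRight hE hT M) hX)
    (fun _ hX => (repetitiveSystem hE hBA hGK hAG hKB).FC_H'
      ((repetitiveSystem hE hBA hGK hAG hKB).FD_H hX))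
    (repetitiveSystem hE hBA hGK hAG hKB).enoughC

include hT in
theorem exists_quotient_functor_left :
    ∃ q : (repetitiveSystem hE hBA hGK hAG hKB).RepD ⥤ RepetitiveCategory k S E,
      q.Full ∧ q.EssSurj ∧
      (∀ {a b : (repetitiveSystem hE hBA hGK hAG hKB).RepD} (f g : a ⟶ b),
        q.map f = q.map g ↔ RepObj.StablyZero (repetitiveSystem hE hBA hGK hAG hKB).adj'
          (repetitiveSystem hE hBA hGK hAG hKB).adj (repetitiveSystem hE hBA hGK hAG hKB).Q
          (f - g).f) ∧
      Nonempty (toRepD hE hBA hGK hAG hKB ⋙ q ≅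
        CategoryTheory.Quotient.functor (stableRel k S E)) :=
  exists_quotient_functor (gradedNat' (nakayamaLeft k E S R T))
    (fun _ hX => isIso_gradedNat' (fun M (_ : Module.Finite Sᵐᵒᵖ M) =>
      isIso_nakayamaLeft hE hT M) hX)
    (fun _ hX => (repetitiveSystem hE hBA hGK hAG hKB).FD_H
      ((repetitiveSystem hE hBA hGK hAG hKB).FC_H' hX))
    (repetitiveSystem hE hBA hGK hAG hKB).enoughD

theorem toRepC_single_mem (M : A.FullSubcategory) :
    (repetitiveSystem hE hBA hGK hAG hKB).zeroStructure ((toRepC hE hBA hGK hAG hKB).obj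
      ((singleFunctor k R E).obj ((ObjectProperty.ιOfLE hBA.right_le).obj M))) := by
  constructor
  · refine ⟨fun i => ?_, (toGraded_mem _).2⟩
    by_cases h : i.as = 0
    · exact hBA.right_of_iso (GradedObject.singleObjApplyIsoOfEq 0 M.obj i.as h).symm M.property
    · exact hBA.right_of_isZero (isZero_single M.obj i.as h)
  · exact toRepObj_single_δ (gradedNat (nakayamaRight k E S R T)) _

/-- The objects of `A` in degree zero, as objects with zero structure map. -/
def singleZero : A.FullSubcategory ⥤
    (repetitiveSystem hE hBA hGK hAG hKB).zeroStructure.FullSubcategory :=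
  ObjectProperty.lift _ ((ObjectProperty.ιOfLE hBA.right_le ⋙ singleFunctor k R E) ⋙
    toRepC hE hBA hGK hAG hKB) (toRepC_single_mem hE hBA hGK hAG hKB)

/-- The comparison map between `Hom_R(T, M)` in degree zero and `Hom_R(T, -)` of `M` in degree
zero. -/
def singleComponent (M : A.FullSubcategory) :
    (repetitiveSystem hE hBA hGK hAG hKB).zeroHom.obj ((singleZero hE hBA hGK hAG hKB).obj M) ⟶
      (toRepD hE hBA hGK hAG hKB).obj ((singleFunctor k S E).obj
        ((ObjectProperty.ιOfLE hGK.left_le).obj (hAG.restrictedHom.obj M))) where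
  f := gradedHom fun i => (mapSingleIso (homFunctor S R T) M.obj i.as).hom
  comm := by
    refine Eq.trans ?_ zero_comp.symm
    have h : ((toRepD hE hBA hGK hAG hKB).obj ((singleFunctor k S E).obj
        ((ObjectProperty.ιOfLE hGK.left_le).obj (hAG.restrictedHom.obj M)))).δ = 0 :=
      toRepObj_single_δ (gradedNat' (nakayamaLeft k E S R T)) _
    rw [h, comp_zero]

theorem isIso_singleComponent (M : A.FullSubcategory) :
    IsIso (singleComponent hE hBA hGK hAG hKB M) := by
  refine RepObj.isIso_of_isIso_f _ ?_
  have : ∀ i, IsIso ((singleComponent hE hBA hGK hAG hKB M).f.app i) := fun i =>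
    inferInstanceAs (IsIso (mapSingleIso (homFunctor S R T) M.obj i.as).hom)
  exact NatIso.isIso_of_isIso_app _

/-- Placing `Hom_R(T, M)` in degree zero is `Hom_R(T, -)` of `M` in degree zero. -/
def singleIso :
    singleZero hE hBA hGK hAG hKB ⋙ (repetitiveSystem hE hBA hGK hAG hKB).zeroHom ≅
      (hAG.restrictedHom ⋙ ObjectProperty.ιOfLE hGK.left_le ⋙ singleFunctor k S E) ⋙
        toRepD hE hBA hGK hAG hKB :=
  NatIso.ofComponents (fun M =>
    @asIso _ _ _ _ (singleComponent hE hBA hGK hAG hKB M)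
      (isIso_singleComponent hE hBA hGK hAG hKB M))
    fun f => RepObj.hom_ext (by
      ext1
      funext i
      exact mapSingleIso_naturality (homFunctor S R T) f.hom i.as)

include hE hT hKB in
/-- The repetitive categories of the two rings of a faithfully balanced bimodule that represents a
counter equivalence of cotorsion pairs are equivalent. -/
theorem exists_repetitive_equivalence :
    ∃ F : RepetitiveCategory k R E ≌ RepetitiveCategory k S E,
      Nonempty (toRepetitive k E A hBA.right_le ⋙ F.functor ≅
        hAG.restrictedHom ⋙ toRepetitive k E G hGK.left_le) ∧
      Nonempty (toRepetitive k E G hGK.left_le ⋙ F.inverse ≅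
        hAG.restrictedTensor ⋙ toRepetitive k E A hBA.right_le) := by
  obtain ⟨p, hp₁, hp₂, hp, ⟨ip⟩⟩ := exists_quotient_functor_right hE hT hBA hGK hAG hKB
  obtain ⟨q, hq₁, hq₂, hq, ⟨iq⟩⟩ := exists_quotient_functor_left hE hT hBA hGK hAG hKB
  have hB : (repetitiveSystem hE hBA hGK hAG hKB).B 0 := by
    have hz : ∀ i, IsZero ((0 : Discrete ℤ ⥤ ModuleCat.{u} Rᵐᵒᵖ).obj i) := fun i =>
      (isZero_zero (Discrete ℤ ⥤ ModuleCat.{u} Rᵐᵒᵖ)).obj i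
    refine ⟨fun i => hBA.left_of_isZero (hz i), ?_⟩
    have h : {i | ¬ IsZero ((0 : Discrete ℤ ⥤ ModuleCat.{u} Rᵐᵒᵖ).obj i)} = ∅ :=
      Set.eq_empty_of_forall_notMem fun i hi => hi (hz i)
    rw [h]
    exact Set.finite_empty
  obtain ⟨F, ⟨j⟩⟩ := CounterSystem.exists_stable_equivalence_extending hB p q hp hq
  let j₁ : toRepetitive k E A hBA.right_le ≅
      singleZero hE hBA hGK hAG hKB ⋙
        (repetitiveSystem hE hBA hGK hAG hKB).zeroStructure.ι ⋙ p :=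
    Functor.isoWhiskerLeft (ObjectProperty.ιOfLE hBA.right_le ⋙ singleFunctor k R E) ip.symm
  let j₂ : (hAG.restrictedHom ⋙ ObjectProperty.ιOfLE hGK.left_le ⋙ singleFunctor k S E) ⋙
      toRepD hE hBA hGK hAG hKB ⋙ q ≅ hAG.restrictedHom ⋙ toRepetitive k E G hGK.left_le :=
    Functor.isoWhiskerLeft (hAG.restrictedHom ⋙ ObjectProperty.ιOfLE hGK.left_le ⋙
      singleFunctor k S E) iq
  let j₃ : toRepetitive k E A hBA.right_le ⋙ F.functor ≅
      hAG.restrictedHom ⋙ toRepetitive k E G hGK.left_le :=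
    Functor.isoWhiskerRight j₁ F.functor ≪≫
      Functor.isoWhiskerLeft (singleZero hE hBA hGK hAG hKB) j ≪≫
        Functor.isoWhiskerRight (singleIso hE hBA hGK hAG hKB) q ≪≫ j₂
  refine ⟨F, ⟨j₃⟩, ?_⟩
  obtain ⟨e, ⟨i⟩, ⟨i'⟩⟩ := hAG.exists_equivalence
  -- The restriction of the inverse is formal: a module in `G` is `Hom_R(T, -)` of its tensor
  -- product with `T`, so by `j₃` its image under the inverse is that tensor product.
  let j₄ : hAG.restrictedTensor ⋙ hAG.restrictedHom ≅ 𝟭 _ :=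
    Functor.isoWhiskerRight i'.symm hAG.restrictedHom ≪≫
      Functor.isoWhiskerLeft e.inverse i.symm ≪≫ e.counitIso
  let j₅ : toRepetitive k E G hGK.left_le ≅
      (hAG.restrictedTensor ⋙ toRepetitive k E A hBA.right_le) ⋙ F.functor :=
    (Functor.leftUnitor _).symm ≪≫ Functor.isoWhiskerRight j₄.symm _ ≪≫
      Functor.isoWhiskerLeft hAG.restrictedTensor j₃.symm
  exact ⟨Functor.isoWhiskerRight j₅ F.inverse ≪≫
    Functor.isoWhiskerLeft (hAG.restrictedTensor ⋙ toRepetitive k E A hBA.right_le)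
      F.unitIso.symm ≪≫ Functor.rightUnitor _⟩

end Final

/-! ### The endomorphism ring of a Wakamatsu-tilting module. -/

section EndomorphismRing

variable {k R T : Type u} [CommRing k] [Ring R] [Algebra k R] [AddCommGroup T] [Module k T]
  [Module Rᵐᵒᵖ T] [IsScalarTower k Rᵐᵒᵖ T]

theorem IsWakamatsuTilting.isFaithfullyBalanced (hT : IsWakamatsuTilting R T) :
    IsFaithfullyBalanced (Module.End Rᵐᵒᵖ T) R T where
  exists_right f hadd hsmul := by
    obtain ⟨r, hr⟩ := hT.double_centralizer.2
      { toFun := f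
        map_add' := hadd
        map_smul' := hsmul }
    exact ⟨unop r, fun x => (DFunLike.congr_fun hr x).symm⟩
  eq_right r r' h := by
    refine op_injective (hT.double_centralizer.1 ?_)
    exact LinearMap.ext h
  exists_left f hadd hsmul :=
    ⟨{ toFun := f
       map_add' := hadd
       map_smul' := fun r x => hsmul (unop r) x }, fun x => rfl⟩
  eq_left _ _ h := LinearMap.ext h

/-- Evaluation at generators of `T` over `k` embeds the endomorphism ring into a power of `T`, a
noetherian `k`-module. So `S` is again an artin algebra. -/
theorem finite_end [IsNoetherianRing k] [Module.Finite k T] :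
    Module.Finite k (Module.End Rᵐᵒᵖ T) := by
  obtain ⟨n, t, ht⟩ := Module.Finite.exists_fin (R := k) (M := T)
  let l : Module.End Rᵐᵒᵖ T →ₗ[k] (Fin n → T) :=
    { toFun := fun f i => f (t i)
      map_add' := fun _ _ => rfl
      map_smul' := fun _ _ => rfl }
  refine Module.Finite.of_injective l fun f g h => ?_
  have h₁ : f.restrictScalars k = g.restrictScalars k :=
    LinearMap.ext_on_range (v := t) ht fun i => congrFun h i
  exact LinearMap.restrictScalars_injective k h₁

end EndomorphismRing

end Repetitive

end

theorem mainTheorem1 {k R E T : Type u}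
    -- `R` is an artin algebra over `k`, with duality `D = Hom_k(-, E)`
    [CommRing k] [IsArtinianRing k] [Ring R] [Algebra k R] [Module.Finite k R]
    [AddCommGroup E] [Module k E] (hE : IsInjectiveEnvelope k (k ⧸ Ring.jacobson k) E)
    -- `T` is a right `R`-module
    [AddCommGroup T] [Module k T] [Module Rᵐᵒᵖ T] [IsScalarTower k Rᵐᵒᵖ T]
    (hT : IsWakamatsuTilting R T)
    (B A : ObjectProperty (ModuleCat.{u} Rᵐᵒᵖ))
    (G K : ObjectProperty (ModuleCat.{u} (Module.End Rᵐᵒᵖ T)ᵐᵒᵖ))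
    (hBA : IsCompleteHereditaryCotorsionPair B A)
    (hGK : IsCompleteHereditaryCotorsionPair G K)
    (hAG : RepresentsEquivalence (Module.End Rᵐᵒᵖ T) R T A G)
    (hKB : RepresentsEquivalence R (Module.End Rᵐᵒᵖ T) (KDual k E T) K B) :
    ∃ F : RepetitiveCategory k R E ≌ RepetitiveCategory k (Module.End Rᵐᵒᵖ T) E,
      Nonempty (toRepetitive k E A hBA.right_le ⋙ F.functor ≅
        hAG.restrictedHom ⋙ toRepetitive k E G hGK.left_le) ∧
      Nonempty (toRepetitive k E G hGK.left_le ⋙ F.inverse ≅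
        hAG.restrictedTensor ⋙ toRepetitive k E A hBA.right_le) := by
  have := hT.finite
  have : Module.Finite k Rᵐᵒᵖ := Module.Finite.equiv (opLinearEquiv k : R ≃ₗ[k] Rᵐᵒᵖ)
  have : Module.Finite k T := Module.Finite.trans Rᵐᵒᵖ T
  have : Module.Finite k (Module.End Rᵐᵒᵖ T) := finite_end
  exact exists_repetitive_equivalence hE hT.isFaithfullyBalanced hBA hGK hAG hKB
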